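/- A *knot pseudodiagram* is a generic one-component knot projection on the sphere in which each crossing is either resolved (over/under information is given) or unresolved; it is a *shadow* if all crossings are unresolved. Two pseudodiagrams are *equivalent* if they are related by isotopies of the sphere, by Reidemeister moves involving only resolved crossings, and by sliding a pseudodiagram that is inserted in a strand along that strand past a crossing of any kind. A connected sum of pseudodiagrams is formed by cutting each summand open at a point and joining the pieces end to end, and is considered up to equivalence. In the *knotting-unknotting game* two players, the Unknotter and the Knotter, alternately resolve one unresolved crossing in one of the two possible ways, until all crossings are resolved; the Unknotter wins if the resulting diagram is equivalent to the crossingless diagram of the unknot, and the Knotter wins otherwise. For integers $a_1,\dots,a_n\ge 0$ ($n\ge 0$) the tangle shadow $[(a_1),\dots,(a_n)]$ is defined recursively: $[\ ]$ consists of two vertical strands, and $[(a_1),\dots,(a_n)]$ is obtained from $[(a_1),\dots,(a_{n-1})]$ by reflecting in a diagonal and adding $a_n$ unresolved half-twists (crossings) on the right. The same symbol denotes the closed diagram obtained by connecting the two upper ends and connecting the two lower ends. A *rational shadow* is such a closed diagram that has one component. An *odd-even shadow* is a closed diagram $[(a_1),\dots,(a_n)]$ with $n\ge 1$ in which exactly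 one $a_i$ is odd, and $i\in\{1,n\}$. Write $P\stackrel{1}{\Rightarrow}Q$ if $Q$ is obtained from $P$, up to equivalence, by zero or more pseudo Reidemeister I moves, that is, deletions of a loop with an unresolved crossing. **Theorem.** Let $T_1,\dots,T_n$ ($n\ge 1$) be rational shadows and let $S$ be a connected sum $T_1\#\cdots\#T_n$. - If every $T_i$ either has no crossings or satisfies $T_i\stackrel{1}{\Rightarrow}O_i$ for some odd-even shadow $O_i$, then the Unknotter has a winning strategy on $S$, no matter which player moves first. - Otherwise, if $S$ has an even number of unresolved crossings, then whichever player moves second has a winning strategy; and if $S$ has an odd number of unresolved crossings, then whichever player moves first has a winning strategy. -/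

import Mathlib

namespace KnotGame

/-! ### Pseudodiagrams

Link pseudodiagrams are written as sliced (Morse generic) plane diagrams: a diagram is the list,
from bottom to top, of its elementary horizontal slices.  Each slice consists of vertical strands
and exactly one local minimum, local maximum or crossing. -/

/-- The state of a crossing: unresolved, or resolved with the strand that runs from the lower left
to the upper right on top (`rise`), or resolved with the other strand on top (`fall`). -/
inductive Crossing
  | flat
  | rise
  | fall
  deriving DecidableEq

/-- The crossing seen after a quarter turn of the plane. -/
def Crossing.turn : Crossing → Crossing
  | flat => flat
  | rise => fall
  | fall => rise

/-- The nontrivial part of a slice: a local minimum `∪`, a local maximum `∩`, or a crossing. -/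
inductive Piece
  | cup
  | cap
  | cross (c : Crossing)
  deriving DecidableEq

/-- Number of strands entering a piece from below. -/
def Piece.ins : Piece → ℕ
  | cup => 0
  | cap => 2
  | cross _ => 2

/-- Number of strands leaving a piece at the top. -/
def Piece.outs : Piece → ℕ
  | cup => 2
  | cap => 0
  | cross _ => 2

/-- A slice: `piece`, with exactly `pos` vertical strands on its left (and any number on its
right). -/
structure Slice where
  pos : ℕ
  piece : Piece
  deriving DecidableEq

/-- A diagram, read from bottom to top. -/
abbrev Diagram := List Slice

/-- `∪` with `i` strands on its left. -/
abbrev cup (i : ℕ) : Slice := ⟨i, Piece.cup⟩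

/-- `∩` with `i` strands on its left. -/
abbrev cap (i : ℕ) : Slice := ⟨i, Piece.cap⟩

/-- A crossing in state `c` with `i` strands on its left. -/
abbrev cross (c : Crossing) (i : ℕ) : Slice := ⟨i, Piece.cross c⟩

/-- `IsTangle m n D`: the slices of `D` fit together to a tangle diagram with `m` end points at the
bottom and `n` end points at the top. -/
def IsTangle : ℕ → ℕ → Diagram → Prop
  | m, n, [] => m = n
  | m, n, x :: D => x.pos + x.piece.ins ≤ m ∧ IsTangle (m - x.piece.ins + x.piece.outs) n D

/-- The diagram with `i` additional vertical strands on its left. -/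
def shift (i : ℕ) (D : Diagram) : Diagram := D.map fun x => ⟨i + x.pos, x.piece⟩

/-- The number of strands above the first `t` slices of a diagram without lower end points. -/
def widthAt (D : Diagram) (t : ℕ) : ℕ :=
  (D.take t).foldl (fun w x => w - x.piece.ins + x.piece.outs) 0

/-- The points of the diagram on the horizontal lines that separate its slices: `(t, j)` is the
`j`-th point from the left (counted from `0`) on the line above the first `t` slices. -/
def IsPoint (D : Diagram) (p : ℕ × ℕ) : Prop := p.1 ≤ D.length ∧ p.2 < widthAt D p.1

/-- Two such points are the two ends of one strand of a single slice. -/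
inductive Adj (D : Diagram) : ℕ × ℕ → ℕ × ℕ → Prop
  | left (t j : ℕ) (x : Slice) : D[t]? = some x → j < x.pos → Adj D (t, j) (t + 1, j)
  | right (t g : ℕ) (x : Slice) : D[t]? = some x →
      Adj D (t, x.pos + x.piece.ins + g) (t + 1, x.pos + x.piece.outs + g)
  | cup (t i : ℕ) : D[t]? = some (KnotGame.cup i) → Adj D (t + 1, i) (t + 1, i + 1)
  | cap (t i : ℕ) : D[t]? = some (KnotGame.cap i) → Adj D (t, i) (t, i + 1)
  | crossUp (t i : ℕ) (c : Crossing) : D[t]? = some (KnotGame.cross c i) →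
      Adj D (t, i) (t + 1, i + 1)
  | crossDown (t i : ℕ) (c : Crossing) : D[t]? = some (KnotGame.cross c i) →
      Adj D (t, i + 1) (t + 1, i)

/-- A knot pseudodiagram: a nonempty closed diagram with exactly one component. -/
def IsKnot (D : Diagram) : Prop :=
  IsTangle 0 0 D ∧ D ≠ [] ∧
    ∀ p q, IsPoint D p → IsPoint D q → Relation.EqvGen (Adj D) p q

/-- The number of unresolved crossings. -/
def unresolved (D : Diagram) : ℕ := D.countP fun x => x.piece = Piece.cross Crossing.flat

/-- The crossingless diagram of the unknot. -/
def circle : Diagram := [cup 0, cap 0]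

/-- The closure of a `1`-`1` tangle. -/
def closure (K : Diagram) : Diagram := [cup 0] ++ K ++ [cap 0]

/-! ### Equivalence of pseudodiagrams -/

/-- The local moves: plane isotopy, the Reidemeister moves (for resolved crossings), and sliding an
arbitrary pseudodiagram `K`, inserted in a strand, past a crossing of any kind. -/
inductive LocalMove : Diagram → Diagram → Prop
  /-- Plane isotopy: two pieces side by side change their heights. -/
  | exchange (i g : ℕ) (x y : Piece) :
      LocalMove [⟨i, x⟩, ⟨i + x.outs + g, y⟩] [⟨i + x.ins + g, y⟩, ⟨i, x⟩]
  /-- Plane isotopy: straightening a strand. -/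
  | zigzagLeft (i : ℕ) : LocalMove [cup i, cap (i + 1)] []
  | zigzagRight (i : ℕ) : LocalMove [cup (i + 1), cap i] []
  /-- Plane isotopy: turning a crossing. -/
  | turn (i : ℕ) (c : Crossing) :
      LocalMove [cross c (i + 1), cap i] [cross c.turn i, cap (i + 1)]
  /-- Reidemeister I. -/
  | oneRight (i : ℕ) (c : Crossing) (hc : c ≠ Crossing.flat) :
      LocalMove [cup (i + 1), cross c i, cap (i + 1)] []
  | oneLeft (i : ℕ) (c : Crossing) (hc : c ≠ Crossing.flat) :
      LocalMove [cup i, cross c (i + 1), cap i] []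
  /-- Reidemeister II. -/
  | two (i : ℕ) (c : Crossing) (hc : c ≠ Crossing.flat) :
      LocalMove [cross c i, cross c.turn i] []
  /-- Reidemeister III.  The last hypothesis says that one of the three strands lies above, and one
  below, the two others. -/
  | three (i : ℕ) (a b c : Crossing) (ha : a ≠ Crossing.flat) (hb : b ≠ Crossing.flat)
      (hc : c ≠ Crossing.flat) (habc : a = b ∨ a ≠ c) :
      LocalMove [cross a i, cross b (i + 1), cross c i]
        [cross c (i + 1), cross b i, cross a (i + 1)]
  /-- Sliding `K` past a crossing along either strand. -/
  | slideUp (i : ℕ) (c : Crossing) (K : Diagram) (hK : IsTangle 1 1 K) :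
      LocalMove (shift i K ++ [cross c i]) ([cross c i] ++ shift (i + 1) K)
  | slideDown (i : ℕ) (c : Crossing) (K : Diagram) (hK : IsTangle 1 1 K) :
      LocalMove (shift (i + 1) K ++ [cross c i]) ([cross c i] ++ shift i K)

/-- An elementary move between closed diagrams: a local move inside the diagram, or swinging an
outermost arc around the sphere. -/
inductive Step : Diagram → Diagram → Prop
  | inside (A B r r' : Diagram) : LocalMove r r' → IsTangle 0 0 (A ++ r ++ B) →
      IsTangle 0 0 (A ++ r' ++ B) → Step (A ++ r ++ B) (A ++ r' ++ B)
  | sphere (K : Diagram) : IsTangle 1 1 K → Step (closure K) (closure (shift 1 K))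

/-- Equivalence of pseudodiagrams. -/
def Equivalent : Diagram → Diagram → Prop := Relation.EqvGen Step

/-- A pseudo Reidemeister I move: deletion of an unresolved loop. -/
inductive PseudoOne : Diagram → Diagram → Prop
  | right (A B : Diagram) (i : ℕ) :
      IsTangle 0 0 (A ++ [cup (i + 1), cross Crossing.flat i, cap (i + 1)] ++ B) →
      PseudoOne (A ++ [cup (i + 1), cross Crossing.flat i, cap (i + 1)] ++ B) (A ++ B)
  | left (A B : Diagram) (i : ℕ) :
      IsTangle 0 0 (A ++ [cup i, cross Crossing.flat (i + 1), cap i] ++ B) →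
      PseudoOne (A ++ [cup i, cross Crossing.flat (i + 1), cap i] ++ B) (A ++ B)

/-- `P` is turned into `Q`, up to equivalence, by zero or more pseudo Reidemeister I moves. -/
def ReducesByOne : Diagram → Diagram → Prop :=
  Relation.ReflTransGen fun P Q => Equivalent P Q ∨ PseudoOne P Q

/-! ### Connected sums -/

/-- `S` is, up to equivalence, a connected sum of `G` and `H`: cut `G` and `H` open at one point
each and join them end to end.  All choices of the cuts and of the way to join are allowed. -/
def IsConnectedSum (G H S : Diagram) : Prop :=
  ∃ K L : Diagram, IsTangle 1 1 K ∧ IsTangle 1 1 L ∧ Equivalent (closure K) G ∧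
    Equivalent (closure L) H ∧ Equivalent (closure (K ++ L)) S

/-- `S` is, up to equivalence, a connected sum of the diagrams in a (nonempty) list. -/
inductive IsConnectedSumOf : List Diagram → Diagram → Prop
  | single (T S : Diagram) : Equivalent T S → IsConnectedSumOf [T] S
  | sum (l l' : List Diagram) (G H S : Diagram) : IsConnectedSumOf l G → IsConnectedSumOf l' H →
      IsConnectedSum G H S → IsConnectedSumOf (l ++ l') S

/-! ### Rational shadows -/

/-- Add an unresolved crossing to the right of a `2`-`2` tangle. -/
def addRight (T : Diagram) : Diagram := [cup 1] ++ T ++ [cross Crossing.flat 2, cap 1]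

/-- Add an unresolved crossing at the bottom of a `2`-`2` tangle. -/
def addBelow (T : Diagram) : Diagram := [cross Crossing.flat 0] ++ T

/-- `rationalTangle true [aₙ, …, a₁]` is the rational tangle shadow `[(a₁), …, (aₙ)]`, and
`rationalTangle false [aₙ, …, a₁]` is its reflection in the diagonal that exchanges right and
bottom.  The starting tangle `[ ]` consists of two vertical strands. -/
def rationalTangle : Bool → List ℕ → Diagram
  | true, [] => []
  | false, [] => [cap 0, cup 0]
  | true, a :: l => addRight^[a] (rationalTangle false l)
  | false, a :: l => addBelow^[a] (rationalTangle true l)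

/-- The closed diagram `[(a₁), …, (aₙ)]`: the two upper ends of the tangle are connected, and so are
the two lower ends. -/
def rationalDiagram (a : List ℕ) : Diagram :=
  [cup 0] ++ rationalTangle true a.reverse ++ [cap 0]

/-- Rational knot shadows. -/
def IsRationalShadow (T : Diagram) : Prop := ∃ a : List ℕ, T = rationalDiagram a ∧ IsKnot T

/-- Odd-even shadows: exactly one term is odd, and it is the first or the last one. -/
def IsOddEvenShadow (O : Diagram) : Prop :=
  ∃ (k : ℕ) (b : List ℕ), Odd k ∧ (∀ x ∈ b, Even x) ∧
    (O = rationalDiagram (k :: b) ∨ O = rationalDiagram (b ++ [k]))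

/-! ### The knotting-unknotting game -/

inductive Player
  | unknotter
  | knotter
  deriving DecidableEq

def Player.other : Player → Player
  | unknotter => knotter
  | knotter => unknotter

/-- `D'` is an option of `D`: one unresolved crossing of `D` is resolved. -/
def IsOption (D D' : Diagram) : Prop :=
  ∃ (A B : Diagram) (i : ℕ) (c : Crossing), c ≠ Crossing.flat ∧
    D = A ++ [cross Crossing.flat i] ++ B ∧ D' = A ++ [cross c i] ++ B

/-- The winner of a finished game. -/
def WonBy : Player → Diagram → Prop
  | Player.unknotter, D => Equivalent D circle
  | Player.knotter, D => ¬ Equivalent D circle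

/-- `Wins p q D`: player `p` has a winning strategy in the position `D` when it is the turn of
player `q`. -/
inductive Wins (p : Player) : Player → Diagram → Prop
  | finished (q : Player) (D : Diagram) : unresolved D = 0 → WonBy p D → Wins p q D
  | own (D D' : Diagram) : IsOption D D' → Wins p p.other D' → Wins p p D
  | opponent (D : Diagram) : unresolved D ≠ 0 → (∀ D', IsOption D D' → Wins p p D') →
      Wins p p.other D

end KnotGame

namespace KnotGame

/-! ### Tangles and their equivalence -/

/-! A move in a connected sum is a move in one of its summands (`IsConnectedSumOf.option`,
`IsConnectedSumOf.listOption`), and the final diagram can be judged by its summands. If all of them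
are unknots, so is the sum: a 1-1 tangle inserted in an unknot slides out of the way of every move
that unknots its host (`closure_append_of_circle`). Conversely, a 1-1 tangle acts on Fox colorings
as multiplication by a natural number (`eval_oneOne`). These numbers multiply under connected sum,
so a sum with as many colorings as the unknot has only such summands
(`IsConnectedSumOf.colorings_eq`). One summand with a wrong count makes the sum knotted.

The Unknotter therefore needs a class of diagrams in which threats can be answered inside the
summand (`wins_unknotter`). Two classes are used. `Unknottable` diagrams reduce to a circle by
deletion of unresolved loops and bigons. All rational knot shadows are of this kind, and the
Unknotter wins on them when he makes the last move: after a move in a bigon he cancels it, and a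
move in a loop does no harm. `Safe` diagrams come from words of doubled letters with one final
crossing of any state. A move in a pair is again cancelled, but the Unknotter also has a tempo move:
he resolves the final crossing, or, if that is resolved already, cancels it against its neighbour,
whose partner becomes the new final crossing. Odd-even shadows are of this kind, so he wins whoever
begins.

For the Knotter, all play outside one chosen summand amounts to passes. `KnotterSecond` says that he
wins with the last move for every admissible number of passes. Surplus passes can be answered by
passes, so at most one has to be considered (`KnotterSecond.of_second`). An unresolved loop is worth
a pass and a bigon is a pair of moves that cancel, so the property is inherited by every diagram
that reduces to one having it (`KnotterSecond.of_reduces`).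

It remains to show that a rational knot shadow with crossings either reduces by loops alone to an
odd-even shadow or satisfies `KnotterSecond`. Such a shadow is a closed three-strand word in two
letters (`rationalDiagram_equivalent`). The word is read letter by letter while a normal form of the
part already read is maintained: doubled letters with a few stray letters at the ends
(`NormalForm.append`). Either the normal form survives, and the closed word can be judged
(`NormalForm.outcome`), or every continuation is hard. Hardness is reduced to finitely many words by
deleting bigons, and each of these closes to a link or reduces to a word with runs (2,2), (2,1,1,2),
(3,1,3) or (2,2,1,2,2). Links are excluded for knots by counting colorings modulo two, which do not
see the crossing states. On the four minimal words a strategy is found by a verified search, whose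
positions record the twist and the number of free crossings of each run. A final position counts as
won if its integer determinant is not 1 or -1, since a prime divisor then gives too many colorings
(`knotted_wordDiagram`). -/

theorem isTangle_append {m n : ℕ} {A B : Diagram} :
    IsTangle m n (A ++ B) ↔ ∃ k, IsTangle m k A ∧ IsTangle k n B := by
  induction A generalizing m with
  | nil => simp [IsTangle]
  | cons x A ih =>
    simp only [List.cons_append, IsTangle, ih]
    constructor
    · rintro ⟨h, k, h1, h2⟩
      exact ⟨k, ⟨h, h1⟩, h2⟩
    · rintro ⟨k, ⟨h, h1⟩, h2⟩
      exact ⟨h, k, h1, h2⟩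

theorem IsTangle.append {m k n : ℕ} {A B : Diagram} (hA : IsTangle m k A) (hB : IsTangle k n B) :
    IsTangle m n (A ++ B) :=
  isTangle_append.2 ⟨k, hA, hB⟩

theorem IsTangle.unique {m n n' : ℕ} {A : Diagram} (h : IsTangle m n A) (h' : IsTangle m n' A) :
    n = n' := by
  induction A generalizing m with
  | nil => exact h.symm.trans h'
  | cons x A ih => exact ih h.2 h'.2

theorem IsTangle.append_right {m k n : ℕ} {A B : Diagram} (hA : IsTangle m k A)
    (h : IsTangle m n (A ++ B)) : IsTangle k n B := by
  obtain ⟨k', h1, h2⟩ := isTangle_append.1 h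
  rwa [hA.unique h1]

@[simp] theorem shift_nil (i : ℕ) : shift i [] = [] := rfl

@[simp] theorem shift_cons (i : ℕ) (x : Slice) (D : Diagram) :
    shift i (x :: D) = ⟨i + x.pos, x.piece⟩ :: shift i D := rfl

@[simp] theorem shift_append (i : ℕ) (A B : Diagram) :
    shift i (A ++ B) = shift i A ++ shift i B := List.map_append

@[simp] theorem shift_zero (A : Diagram) : shift 0 A = A := by
  induction A with
  | nil => rfl
  | cons x A ih => simp [ih]

theorem shift_shift (i j : ℕ) (A : Diagram) : shift i (shift j A) = shift (i + j) A := by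
  induction A with
  | nil => rfl
  | cons x A ih => simp [ih, add_assoc]

theorem IsTangle.widen {m n : ℕ} {A : Diagram} (h : IsTangle m n A) (i j : ℕ) :
    IsTangle (i + m + j) (i + n + j) (shift i A) := by
  induction A generalizing m with
  | nil => simp only [IsTangle] at h; simp [IsTangle, h]
  | cons x A ih =>
    obtain ⟨h1, h2⟩ := h
    refine ⟨by simp only; omega, ?_⟩
    have := ih h2
    simp only
    have e : i + m + j - x.piece.ins + x.piece.outs = i + (m - x.piece.ins + x.piece.outs) + j := by
      omega
    rw [e]
    exact this

/-- One local move inside a tangle. -/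
inductive TStep (m n : ℕ) : Diagram → Diagram → Prop
  | mk (A B r r' : Diagram) : LocalMove r r' → IsTangle m n (A ++ r ++ B) →
      IsTangle m n (A ++ r' ++ B) → TStep m n (A ++ r ++ B) (A ++ r' ++ B)

/-- Equivalence of tangles with fixed end points. -/
def TEq (m n : ℕ) : Diagram → Diagram → Prop := Relation.EqvGen (TStep m n)

theorem TEq.refl {m n : ℕ} (A : Diagram) : TEq m n A A := Relation.EqvGen.refl A

theorem TEq.symm {m n : ℕ} {A B : Diagram} (h : TEq m n A B) : TEq m n B A :=
  Relation.EqvGen.symm _ _ h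

theorem TEq.trans {m n : ℕ} {A B C : Diagram} (h : TEq m n A B) (h' : TEq m n B C) :
    TEq m n A C :=
  Relation.EqvGen.trans _ _ _ h h'

theorem TEq.of_move {m n : ℕ} {r r' : Diagram} (h : LocalMove r r') (hr : IsTangle m n r)
    (hr' : IsTangle m n r') : TEq m n r r' := by
  have := TStep.mk (m := m) (n := n) [] [] r r' h (by simpa) (by simpa)
  exact Relation.EqvGen.rel _ _ (by simpa using this)

theorem TEq.equivalent {A B : Diagram} (h : TEq 0 0 A B) : Equivalent A B := by
  induction h with
  | rel x y h =>
    obtain ⟨A, B, r, r', h, h1, h2⟩ := h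
    exact Relation.EqvGen.rel _ _ (Step.inside A B r r' h h1 h2)
  | refl => exact Relation.EqvGen.refl _
  | symm _ _ _ ih => exact Relation.EqvGen.symm _ _ ih
  | trans _ _ _ _ _ ih ih' => exact Relation.EqvGen.trans _ _ _ ih ih'

theorem TEq.isTangle {m n : ℕ} {A B : Diagram} (h : TEq m n A B) :
    IsTangle m n A ↔ IsTangle m n B := by
  induction h with
  | rel x y h =>
    obtain ⟨A, B, r, r', h, h1, h2⟩ := h
    exact ⟨fun _ => h2, fun _ => h1⟩
  | refl => exact Iff.rfl
  | symm _ _ _ ih => exact ih.symm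
  | trans _ _ _ _ _ ih ih' => exact ih.trans ih'

theorem TEq.congr {k m n l : ℕ} {A X Y B : Diagram} (hA : IsTangle k m A) (h : TEq m n X Y)
    (hB : IsTangle n l B) : TEq k l (A ++ X ++ B) (A ++ Y ++ B) := by
  induction h with
  | rel x y h =>
    obtain ⟨A', B', r, r', h, h1, h2⟩ := h
    have := TStep.mk (m := k) (n := l) (A ++ A') (B' ++ B) r r' h
      (by simpa using (hA.append h1).append hB) (by simpa using (hA.append h2).append hB)
    exact Relation.EqvGen.rel _ _ (by simpa using this)
  | refl => exact Relation.EqvGen.refl _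
  | symm _ _ _ ih => exact Relation.EqvGen.symm _ _ ih
  | trans _ _ _ _ _ ih ih' => exact Relation.EqvGen.trans _ _ _ ih ih'

theorem TEq.append_left {k m n : ℕ} {A X Y : Diagram} (hA : IsTangle k m A) (h : TEq m n X Y) :
    TEq k n (A ++ X) (A ++ Y) := by
  simpa using TEq.congr hA h (B := []) (rfl : n = n)

theorem TEq.append_right {m n l : ℕ} {X Y B : Diagram} (h : TEq m n X Y)
    (hB : IsTangle n l B) : TEq m l (X ++ B) (Y ++ B) := by
  simpa using TEq.congr (A := []) (rfl : m = m) h hB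

theorem LocalMove.shift {r r' : Diagram} (h : LocalMove r r') (k : ℕ) :
    LocalMove (shift k r) (shift k r') := by
  cases h with
  | exchange i g x y =>
    simpa [add_assoc] using LocalMove.exchange (k + i) g x y
  | zigzagLeft i => simpa [add_assoc] using LocalMove.zigzagLeft (k + i)
  | zigzagRight i => simpa [add_assoc] using LocalMove.zigzagRight (k + i)
  | turn i c => simpa [add_assoc] using LocalMove.turn (k + i) c
  | oneRight i c hc => simpa [add_assoc] using LocalMove.oneRight (k + i) c hc
  | oneLeft i c hc => simpa [add_assoc] using LocalMove.oneLeft (k + i) c hc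
  | two i c hc => simpa [add_assoc] using LocalMove.two (k + i) c hc
  | three i a b c ha hb hc h => simpa [add_assoc] using LocalMove.three (k + i) a b c ha hb hc h
  | slideUp i c K hK => simpa [add_assoc, shift_shift] using LocalMove.slideUp (k + i) c K hK
  | slideDown i c K hK => simpa [add_assoc, shift_shift] using LocalMove.slideDown (k + i) c K hK

theorem TEq.widen {m n : ℕ} {X Y : Diagram} (h : TEq m n X Y) (i j : ℕ) :
    TEq (i + m + j) (i + n + j) (shift i X) (shift i Y) := by
  induction h with
  | rel x y h =>
    obtain ⟨A, B, r, r', h, h1, h2⟩ := h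
    have := TStep.mk (m := i + m + j) (n := i + n + j) (shift i A) (shift i B) _ _ (h.shift i)
      (by simpa using h1.widen i j) (by simpa using h2.widen i j)
    exact Relation.EqvGen.rel _ _ (by simpa using this)
  | refl => exact Relation.EqvGen.refl _
  | symm _ _ _ ih => exact Relation.EqvGen.symm _ _ ih
  | trans _ _ _ _ _ ih ih' => exact Relation.EqvGen.trans _ _ _ ih ih'

theorem TEq.widen_right {m n : ℕ} {X Y : Diagram} (h : TEq m n X Y) (j : ℕ) :
    TEq (m + j) (n + j) X Y := by
  simpa using h.widen 0 j

theorem IsTangle.widen_right {m n : ℕ} {X : Diagram} (h : IsTangle m n X) (j : ℕ) :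
    IsTangle (m + j) (n + j) X := by
  simpa using h.widen 0 j

theorem isTangle_singleton {m n : ℕ} {x : Slice} :
    IsTangle m n [x] ↔ x.pos + x.piece.ins ≤ m ∧ m - x.piece.ins + x.piece.outs = n := Iff.rfl

theorem exchange_slice {m m' : ℕ} {x : Slice} (hx : IsTangle m m' [x]) {n n' : ℕ} {y : Slice}
    (hy : IsTangle n n' [y]) : TEq (m + n) (m' + n') ([x] ++ shift m' [y]) (shift m [y] ++ [x]) := by
  have h1 := (hx.widen_right n).append (by simpa using hy.widen m' 0)
  have h2 := (show IsTangle (m + n) (m + n') (shift m [y]) by simpa using hy.widen m 0).append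
    (hx.widen_right n')
  rw [isTangle_singleton] at hx
  obtain ⟨i, x⟩ := x
  obtain ⟨g, rfl⟩ := Nat.exists_eq_add_of_le hx.1
  have e : m' = i + x.outs + g := by simp only at hx; omega
  subst e
  have := LocalMove.exchange i (g + y.pos) x y.piece
  refine TEq.of_move ?_ h1 h2
  simpa [add_assoc] using this

/-- Two tangles side by side change their heights. -/
theorem exchange_blocks {m m' : ℕ} {X : Diagram} (hX : IsTangle m m' X) {n n' : ℕ} {Y : Diagram}
    (hY : IsTangle n n' Y) : TEq (m + n) (m' + n') (X ++ shift m' Y) (shift m Y ++ X) := by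
  have key : ∀ (x : Slice) {m m' : ℕ}, IsTangle m m' [x] → ∀ {n n' : ℕ} {Y : Diagram},
      IsTangle n n' Y → TEq (m + n) (m' + n') ([x] ++ shift m' Y) (shift m Y ++ [x]) := by
    intro x m m' hx n n' Y hY
    induction Y generalizing n with
    | nil => simpa using TEq.refl _
    | cons y Y ih =>
      have hy : IsTangle n (n - y.piece.ins + y.piece.outs) [y] := ⟨hY.1, rfl⟩
      have h1 := (exchange_slice hx hy).append_right
        (show IsTangle _ (m' + n') (shift m' Y) by simpa using hY.2.widen m' 0)
      have h2 := (ih hY.2).append_left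
        (show IsTangle (m + n) _ (shift m [y]) by simpa using hy.widen m 0)
      simpa using h1.trans (by simpa using h2)
  induction X generalizing m with
  | nil =>
    simp only [IsTangle] at hX
    subst hX
    simpa using TEq.refl _
  | cons x X ih =>
    have hx : IsTangle m (m - x.piece.ins + x.piece.outs) [x] := ⟨hX.1, rfl⟩
    have h1 := (ih hX.2).append_left (hx.widen_right n)
    have h2 := (key x hx hY).append_right (hX.2.widen_right n')
    simpa using h1.trans (by simpa using h2)

/-! ### Options -/

theorem Equivalent.refl (A : Diagram) : Equivalent A A := Relation.EqvGen.refl A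

theorem Equivalent.symm {A B : Diagram} (h : Equivalent A B) : Equivalent B A :=
  Relation.EqvGen.symm _ _ h

theorem Equivalent.trans {A B C : Diagram} (h : Equivalent A B) (h' : Equivalent B C) :
    Equivalent A C :=
  Relation.EqvGen.trans _ _ _ h h'

@[simp] theorem unresolved_nil : unresolved [] = 0 := rfl

@[simp] theorem unresolved_append (A B : Diagram) :
    unresolved (A ++ B) = unresolved A + unresolved B := List.countP_append

@[simp] theorem unresolved_cons (x : Slice) (A : Diagram) :
    unresolved (x :: A) =
      unresolved A + if x.piece = Piece.cross Crossing.flat then 1 else 0 := by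
  simp [unresolved, List.countP_cons]

@[simp] theorem unresolved_shift (i : ℕ) (A : Diagram) : unresolved (shift i A) = unresolved A := by
  induction A with
  | nil => rfl
  | cons x A ih => simp [ih]

@[simp] theorem unresolved_closure (K : Diagram) : unresolved (closure K) = unresolved K := by
  simp [closure]

@[simp] theorem turn_turn (c : Crossing) : c.turn.turn = c := by cases c <;> rfl

@[simp] theorem turn_eq_flat (c : Crossing) : c.turn = Crossing.flat ↔ c = Crossing.flat := by
  cases c <;> simp [Crossing.turn]

theorem LocalMove.unresolved_eq {r r' : Diagram} (h : LocalMove r r') :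
    unresolved r = unresolved r' := by
  cases h <;> simp_all [add_comm]

theorem Equivalent.unresolved_eq {A B : Diagram} (h : Equivalent A B) :
    unresolved A = unresolved B := by
  induction h with
  | rel x y h =>
    cases h with
    | inside A B r r' h => simp [h.unresolved_eq]
    | sphere K => simp
  | refl => rfl
  | symm _ _ _ ih => exact ih.symm
  | trans _ _ _ _ _ ih ih' => exact ih.trans ih'

theorem not_isOption_nil (E : Diagram) : ¬ IsOption [] E := by
  rintro ⟨A, B, i, c, -, h, -⟩
  simp at h

theorem isOption_cons {x : Slice} {D E : Diagram} :
    IsOption (x :: D) E ↔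
      (∃ c, c ≠ Crossing.flat ∧ x.piece = Piece.cross Crossing.flat ∧ E = cross c x.pos :: D) ∨
        ∃ D', IsOption D D' ∧ E = x :: D' := by
  constructor
  · rintro ⟨A, B, i, c, hc, h, rfl⟩
    cases A with
    | nil =>
      simp only [List.nil_append, List.cons_append, List.cons.injEq] at h
      obtain ⟨rfl, rfl⟩ := h
      exact Or.inl ⟨c, hc, rfl, rfl⟩
    | cons a A =>
      simp only [List.cons_append, List.cons.injEq] at h
      obtain ⟨rfl, rfl⟩ := h
      exact Or.inr ⟨A ++ [cross c i] ++ B, ⟨A, B, i, c, hc, rfl, rfl⟩, by simp⟩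
  · rintro (⟨c, hc, hx, rfl⟩ | ⟨D', ⟨A, B, i, c, hc, rfl, rfl⟩, rfl⟩)
    · obtain ⟨i, p⟩ := x
      simp only at hx
      subst hx
      exact ⟨[], D, i, c, hc, rfl, rfl⟩
    · exact ⟨x :: A, B, i, c, hc, rfl, rfl⟩

theorem isOption_append {A B E : Diagram} :
    IsOption (A ++ B) E ↔
      (∃ A', IsOption A A' ∧ E = A' ++ B) ∨ ∃ B', IsOption B B' ∧ E = A ++ B' := by
  induction A generalizing E with
  | nil => simp [not_isOption_nil]
  | cons x A ih =>
    simp only [List.cons_append, isOption_cons, ih]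
    constructor
    · rintro (⟨c, hc, hx, rfl⟩ | ⟨D', (⟨A', hA, rfl⟩ | ⟨B', hB, rfl⟩), rfl⟩)
      · exact Or.inl ⟨_, Or.inl ⟨c, hc, hx, rfl⟩, rfl⟩
      · exact Or.inl ⟨_, Or.inr ⟨A', hA, rfl⟩, rfl⟩
      · exact Or.inr ⟨B', hB, rfl⟩
    · rintro (⟨A', (⟨c, hc, hx, rfl⟩ | ⟨D', hA, rfl⟩), rfl⟩ | ⟨B', hB, rfl⟩)
      · exact Or.inl ⟨c, hc, hx, rfl⟩
      · exact Or.inr ⟨_, Or.inl ⟨D', hA, rfl⟩, rfl⟩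
      · exact Or.inr ⟨_, Or.inr ⟨B', hB, rfl⟩, rfl⟩

theorem isOption_singleton {x : Slice} {E : Diagram} :
    IsOption [x] E ↔
      ∃ c, c ≠ Crossing.flat ∧ x.piece = Piece.cross Crossing.flat ∧ E = [cross c x.pos] := by
  simp [isOption_cons, not_isOption_nil]

theorem isOption_shift {i : ℕ} {D E : Diagram} :
    IsOption (shift i D) E ↔ ∃ D', IsOption D D' ∧ E = shift i D' := by
  induction D generalizing E with
  | nil => simp [not_isOption_nil]
  | cons x D ih =>
    simp only [shift_cons, isOption_cons, ih]
    constructor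
    · rintro (⟨c, hc, hx, rfl⟩ | ⟨_, ⟨D', hD, rfl⟩, rfl⟩)
      · exact ⟨_, Or.inl ⟨c, hc, hx, rfl⟩, rfl⟩
      · exact ⟨_, Or.inr ⟨D', hD, rfl⟩, rfl⟩
    · rintro ⟨_, (⟨c, hc, hx, rfl⟩ | ⟨D', hD, rfl⟩), rfl⟩
      · exact Or.inl ⟨c, hc, hx, rfl⟩
      · exact Or.inr ⟨_, ⟨D', hD, rfl⟩, rfl⟩

theorem IsOption.isTangle {D E : Diagram} (h : IsOption D E) {m n : ℕ} :
    IsTangle m n D ↔ IsTangle m n E := by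
  obtain ⟨A, B, i, c, -, rfl, rfl⟩ := h
  simp only [isTangle_append]
  rfl

theorem IsOption.unresolved_eq {D E : Diagram} (h : IsOption D E) :
    unresolved D = unresolved E + 1 := by
  obtain ⟨A, B, i, c, hc, rfl, rfl⟩ := h
  simp [hc]
  omega

theorem exists_isOption {D : Diagram} (h : unresolved D ≠ 0) : ∃ E, IsOption D E := by
  induction D with
  | nil => simp at h
  | cons x D ih =>
    by_cases hx : x.piece = Piece.cross Crossing.flat
    · exact ⟨_, isOption_cons.2 (Or.inl ⟨Crossing.rise, by simp, hx, rfl⟩)⟩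
    · simp only [unresolved_cons, hx, if_false, add_zero] at h
      obtain ⟨E, hE⟩ := ih h
      exact ⟨_, isOption_cons.2 (Or.inr ⟨E, hE, rfl⟩)⟩

theorem isOption_closure {K E : Diagram} :
    IsOption (closure K) E ↔ ∃ K', IsOption K K' ∧ E = closure K' := by
  simp only [closure, isOption_append, isOption_singleton]
  constructor
  · rintro (⟨A, (⟨A', ⟨c, -, h, -⟩, -⟩ | ⟨K', hK, rfl⟩), rfl⟩ | ⟨B, ⟨c, -, h, -⟩, -⟩)
    · simp at h
    · exact ⟨K', hK, rfl⟩
    · simp at h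
  · rintro ⟨K', hK, rfl⟩
    exact Or.inl ⟨_, Or.inr ⟨K', hK, rfl⟩, rfl⟩

/-- Reidemeister moves involve no unresolved crossing, while isotopies and slides are available for
crossings in every state. So each resolution on one side has a counterpart on the other side, joined
to it by a move of the same kind. -/
theorem LocalMove.option_left {r r' s : Diagram} (h : LocalMove r r') (hs : IsOption r s) :
    ∃ s', IsOption r' s' ∧ LocalMove s s' := by
  cases h with
  | exchange i g x y =>
    simp only [isOption_cons, not_isOption_nil, false_and, exists_false, or_false] at hs
    rcases hs with ⟨c, hc, hx, rfl⟩ | ⟨_, ⟨c, hc, hx, rfl⟩, rfl⟩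
    · subst hx
      exact ⟨[⟨i + 2 + g, y⟩, cross c i],
        ⟨[⟨i + 2 + g, y⟩], [], i, c, hc, rfl, rfl⟩, LocalMove.exchange i g (.cross c) y⟩
    · subst hx
      exact ⟨[cross c (i + x.ins + g), ⟨i, x⟩],
        ⟨[], [⟨i, x⟩], _, c, hc, rfl, rfl⟩, LocalMove.exchange i g x (.cross c)⟩
  | zigzagLeft i => simp [isOption_cons, not_isOption_nil] at hs
  | zigzagRight i => simp [isOption_cons, not_isOption_nil] at hs
  | turn i c =>
    simp only [isOption_cons, not_isOption_nil, false_and, exists_false, or_false] at hs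
    rcases hs with ⟨d, hd, hx, rfl⟩ | ⟨_, ⟨d, hd, hx, rfl⟩, rfl⟩
    · simp only [Piece.cross.injEq] at hx
      subst hx
      -- A quarter turn exchanges the two resolved states, so the matching choice on the other side
      -- is `d.turn`.
      exact ⟨[cross d.turn i, cap (i + 1)], ⟨[], [cap (i + 1)], i, d.turn, by simpa, rfl, rfl⟩,
        LocalMove.turn i d⟩
    · simp at hx
  | oneRight i c hc => simp [isOption_cons, not_isOption_nil, hc] at hs
  | oneLeft i c hc => simp [isOption_cons, not_isOption_nil, hc] at hs
  | two i c hc => simp [isOption_cons, not_isOption_nil, hc] at hs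
  | three i a b c ha hb hc h => simp [isOption_cons, not_isOption_nil, ha, hb, hc] at hs
  | slideUp i c K hK =>
    rcases isOption_append.1 hs with ⟨_, h, rfl⟩ | ⟨_, h, rfl⟩
    · obtain ⟨K', h', rfl⟩ := isOption_shift.1 h
      exact ⟨_, isOption_append.2 (Or.inr ⟨_, isOption_shift.2 ⟨K', h', rfl⟩, rfl⟩),
        LocalMove.slideUp i c K' (h'.isTangle.1 hK)⟩
    · obtain ⟨d, hd, hx, rfl⟩ := isOption_singleton.1 h
      exact ⟨_, isOption_append.2 (Or.inl ⟨_, isOption_singleton.2 ⟨d, hd, hx, rfl⟩, rfl⟩),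
        LocalMove.slideUp i d K hK⟩
  | slideDown i c K hK =>
    rcases isOption_append.1 hs with ⟨_, h, rfl⟩ | ⟨_, h, rfl⟩
    · obtain ⟨K', h', rfl⟩ := isOption_shift.1 h
      exact ⟨_, isOption_append.2 (Or.inr ⟨_, isOption_shift.2 ⟨K', h', rfl⟩, rfl⟩),
        LocalMove.slideDown i c K' (h'.isTangle.1 hK)⟩
    · obtain ⟨d, hd, hx, rfl⟩ := isOption_singleton.1 h
      exact ⟨_, isOption_append.2 (Or.inl ⟨_, isOption_singleton.2 ⟨d, hd, hx, rfl⟩, rfl⟩),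
        LocalMove.slideDown i d K hK⟩

theorem LocalMove.option_right {r r' s' : Diagram} (h : LocalMove r r') (hs : IsOption r' s') :
    ∃ s, IsOption r s ∧ LocalMove s s' := by
  cases h with
  | exchange i g x y =>
    simp only [isOption_cons, not_isOption_nil, false_and, exists_false, or_false] at hs
    rcases hs with ⟨c, hc, hx, rfl⟩ | ⟨_, ⟨c, hc, hx, rfl⟩, rfl⟩
    · subst hx
      exact ⟨[⟨i, x⟩, cross c (i + x.outs + g)],
        ⟨[⟨i, x⟩], [], _, c, hc, rfl, rfl⟩, LocalMove.exchange i g x (.cross c)⟩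
    · subst hx
      exact ⟨[cross c i, ⟨i + 2 + g, y⟩],
        ⟨[], [⟨i + 2 + g, y⟩], _, c, hc, rfl, rfl⟩, LocalMove.exchange i g (.cross c) y⟩
  | zigzagLeft i => exact absurd hs (not_isOption_nil _)
  | zigzagRight i => exact absurd hs (not_isOption_nil _)
  | turn i c =>
    simp only [isOption_cons, not_isOption_nil, false_and, exists_false, or_false] at hs
    rcases hs with ⟨d, hd, hx, rfl⟩ | ⟨_, ⟨d, hd, hx, rfl⟩, rfl⟩
    · simp only [Piece.cross.injEq, turn_eq_flat] at hx
      subst hx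
      refine ⟨[cross d.turn (i + 1), cap i], ⟨[], [cap i], _, d.turn, by simpa, rfl, rfl⟩, ?_⟩
      simpa using LocalMove.turn i d.turn
    · simp at hx
  | oneRight i c hc => exact absurd hs (not_isOption_nil _)
  | oneLeft i c hc => exact absurd hs (not_isOption_nil _)
  | two i c hc => exact absurd hs (not_isOption_nil _)
  | three i a b c ha hb hc h => simp [isOption_cons, not_isOption_nil, ha, hb, hc] at hs
  | slideUp i c K hK =>
    rcases isOption_append.1 hs with ⟨_, h, rfl⟩ | ⟨_, h, rfl⟩
    · obtain ⟨d, hd, hx, rfl⟩ := isOption_singleton.1 h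
      exact ⟨_, isOption_append.2 (Or.inr ⟨_, isOption_singleton.2 ⟨d, hd, hx, rfl⟩, rfl⟩),
        LocalMove.slideUp i d K hK⟩
    · obtain ⟨K', h', rfl⟩ := isOption_shift.1 h
      exact ⟨_, isOption_append.2 (Or.inl ⟨_, isOption_shift.2 ⟨K', h', rfl⟩, rfl⟩),
        LocalMove.slideUp i c K' (h'.isTangle.1 hK)⟩
  | slideDown i c K hK =>
    rcases isOption_append.1 hs with ⟨_, h, rfl⟩ | ⟨_, h, rfl⟩
    · obtain ⟨d, hd, hx, rfl⟩ := isOption_singleton.1 h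
      exact ⟨_, isOption_append.2 (Or.inr ⟨_, isOption_singleton.2 ⟨d, hd, hx, rfl⟩, rfl⟩),
        LocalMove.slideDown i d K hK⟩
    · obtain ⟨K', h', rfl⟩ := isOption_shift.1 h
      exact ⟨_, isOption_append.2 (Or.inl ⟨_, isOption_shift.2 ⟨K', h', rfl⟩, rfl⟩),
        LocalMove.slideDown i c K' (h'.isTangle.1 hK)⟩

theorem isOption_append_three {A r B E : Diagram} :
    IsOption (A ++ r ++ B) E ↔ (∃ A', IsOption A A' ∧ E = A' ++ r ++ B) ∨
      (∃ s, IsOption r s ∧ E = A ++ s ++ B) ∨ ∃ B', IsOption B B' ∧ E = A ++ r ++ B' := by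
  rw [isOption_append]
  constructor
  · rintro (⟨_, h, rfl⟩ | ⟨B', h, rfl⟩)
    · rcases isOption_append.1 h with ⟨A', h', rfl⟩ | ⟨s, h', rfl⟩
      · exact Or.inl ⟨A', h', rfl⟩
      · exact Or.inr (Or.inl ⟨s, h', rfl⟩)
    · exact Or.inr (Or.inr ⟨B', h, rfl⟩)
  · rintro (⟨A', h, rfl⟩ | ⟨s, h, rfl⟩ | ⟨B', h, rfl⟩)
    · exact Or.inl ⟨_, isOption_append.2 (Or.inl ⟨A', h, rfl⟩), rfl⟩
    · exact Or.inl ⟨_, isOption_append.2 (Or.inr ⟨s, h, rfl⟩), rfl⟩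
    · exact Or.inr ⟨B', h, rfl⟩

theorem IsTangle.replace {m n : ℕ} {A A' r B B' : Diagram}
    (h : IsTangle m n (A ++ r ++ B)) (hA : ∀ m n, IsTangle m n A ↔ IsTangle m n A')
    (hB : ∀ m n, IsTangle m n B ↔ IsTangle m n B') : IsTangle m n (A' ++ r ++ B') := by
  simpa only [isTangle_append, hA, hB] using h

theorem Step.option_left {D D' E : Diagram} (h : Step D D') (hE : IsOption D E) :
    ∃ E', IsOption D' E' ∧ Step E E' := by
  cases h with
  | inside A B r r' h h1 h2 =>
    rcases isOption_append_three.1 hE with ⟨A', hA, rfl⟩ | ⟨s, hs, rfl⟩ | ⟨B', hB, rfl⟩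
    · exact ⟨_, isOption_append_three.2 (Or.inl ⟨A', hA, rfl⟩), Step.inside _ _ _ _ h
        (hE.isTangle.1 h1) (h2.replace (fun _ _ => hA.isTangle) fun _ _ => Iff.rfl)⟩
    · obtain ⟨s', hs', h'⟩ := h.option_left hs
      exact ⟨_, isOption_append_three.2 (Or.inr (Or.inl ⟨s', hs', rfl⟩)), Step.inside _ _ _ _ h'
        (hE.isTangle.1 h1)
        ((isOption_append_three.2 (Or.inr (Or.inl ⟨s', hs', rfl⟩))).isTangle.1 h2)⟩
    · exact ⟨_, isOption_append_three.2 (Or.inr (Or.inr ⟨B', hB, rfl⟩)), Step.inside _ _ _ _ h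
        (hE.isTangle.1 h1) (h2.replace (fun _ _ => Iff.rfl) fun _ _ => hB.isTangle)⟩
  | sphere K hK =>
    obtain ⟨K', h, rfl⟩ := isOption_closure.1 hE
    exact ⟨_, isOption_closure.2 ⟨_, isOption_shift.2 ⟨K', h, rfl⟩, rfl⟩,
      Step.sphere K' (h.isTangle.1 hK)⟩

theorem Step.option_right {D D' E' : Diagram} (h : Step D D') (hE : IsOption D' E') :
    ∃ E, IsOption D E ∧ Step E E' := by
  cases h with
  | inside A B r r' h h1 h2 =>
    rcases isOption_append_three.1 hE with ⟨A', hA, rfl⟩ | ⟨s, hs, rfl⟩ | ⟨B', hB, rfl⟩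
    · exact ⟨_, isOption_append_three.2 (Or.inl ⟨A', hA, rfl⟩), Step.inside _ _ _ _ h
        (h1.replace (fun _ _ => hA.isTangle) fun _ _ => Iff.rfl) (hE.isTangle.1 h2)⟩
    · obtain ⟨s', hs', h'⟩ := h.option_right hs
      exact ⟨_, isOption_append_three.2 (Or.inr (Or.inl ⟨s', hs', rfl⟩)), Step.inside _ _ _ _ h'
        ((isOption_append_three.2 (Or.inr (Or.inl ⟨s', hs', rfl⟩))).isTangle.1 h1)
        (hE.isTangle.1 h2)⟩
    · exact ⟨_, isOption_append_three.2 (Or.inr (Or.inr ⟨B', hB, rfl⟩)), Step.inside _ _ _ _ h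
        (h1.replace (fun _ _ => Iff.rfl) fun _ _ => hB.isTangle) (hE.isTangle.1 h2)⟩
  | sphere K hK =>
    obtain ⟨_, h, rfl⟩ := isOption_closure.1 hE
    obtain ⟨K', h', rfl⟩ := isOption_shift.1 h
    exact ⟨_, isOption_closure.2 ⟨_, h', rfl⟩, Step.sphere K' (h'.isTangle.1 hK)⟩

/-- Equivalent diagrams have equivalent options. -/
theorem Equivalent.option {D D' E : Diagram} (h : Equivalent D D') (hE : IsOption D E) :
    ∃ E', IsOption D' E' ∧ Equivalent E E' := by
  suffices H : ∀ D D', Equivalent D D' → (∀ E, IsOption D E → ∃ E', IsOption D' E' ∧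
      Equivalent E E') ∧ ∀ E', IsOption D' E' → ∃ E, IsOption D E ∧ Equivalent E' E from
    (H D D' h).1 E hE
  clear h hE
  intro D D' h
  induction h with
  | rel x y h =>
    refine ⟨fun E hE => ?_, fun E' hE => ?_⟩
    · obtain ⟨E', h1, h2⟩ := h.option_left hE
      exact ⟨E', h1, Relation.EqvGen.rel _ _ h2⟩
    · obtain ⟨E, h1, h2⟩ := h.option_right hE
      exact ⟨E, h1, Equivalent.symm (Relation.EqvGen.rel _ _ h2)⟩
  | refl => exact ⟨fun E hE => ⟨E, hE, .refl _⟩, fun E hE => ⟨E, hE, .refl _⟩⟩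
  | symm _ _ _ ih => exact ⟨ih.2, ih.1⟩
  | trans _ _ _ _ _ ih ih' =>
    refine ⟨fun E hE => ?_, fun E hE => ?_⟩
    · obtain ⟨E1, h1, h2⟩ := ih.1 E hE
      obtain ⟨E2, h3, h4⟩ := ih'.1 E1 h1
      exact ⟨E2, h3, h2.trans h4⟩
    · obtain ⟨E1, h1, h2⟩ := ih'.2 E hE
      obtain ⟨E2, h3, h4⟩ := ih.2 E1 h1
      exact ⟨E2, h3, h2.trans h4⟩

/-! ### Counting colorings -/

section Colorings

variable {p : ℕ} [NeZero p]

/-- The action of a piece on a weight of colored strands, read from top to bottom: `f` weighs the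
colorings of the strands above the piece, and the result the colorings of those below. -/
def baseEval : Piece → (List (ZMod p) → ℕ) → List (ZMod p) → ℕ
  | .cup, f, s => ∑ a, f (a :: a :: s)
  | .cap, f, a :: b :: s => if a = b then f s else 0
  | .cross .fall, f, a :: b :: s => f (b :: (2 * b - a) :: s)
  | .cross _, f, a :: b :: s => f ((2 * a - b) :: a :: s)
  | _, _, _ => 0

def pieceEval (x : Piece) : ℕ → (List (ZMod p) → ℕ) → List (ZMod p) → ℕ
  | 0, f, s => baseEval x f s
  | i + 1, f, a :: s => pieceEval x i (fun t => f (a :: t)) s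
  | _ + 1, _, [] => 0

/-- The number of ways, weighted by `f`, to extend a coloring of the lower ends of a tangle. -/
def eval : Diagram → (List (ZMod p) → ℕ) → List (ZMod p) → ℕ
  | [], f => f
  | x :: D, f => pieceEval x.piece x.pos (eval D f)

theorem eval_append (A B : Diagram) (f : List (ZMod p) → ℕ) :
    eval (A ++ B) f = eval A (eval B f) := by
  induction A with
  | nil => rfl
  | cons x A ih => simp [eval, ih]

theorem eval_shift_succ (i : ℕ) (D : Diagram) (f : List (ZMod p) → ℕ) (a : ZMod p)
    (s : List (ZMod p)) :
    eval (shift (i + 1) D) f (a :: s) = eval (shift i D) (fun t => f (a :: t)) s := by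
  induction D generalizing s f with
  | nil => rfl
  | cons x D ih =>
    simp only [shift_cons, eval]
    rw [show i + 1 + x.pos = (i + x.pos) + 1 by omega]
    simp only [pieceEval]
    congr 1
    ext t
    exact ih _ _

theorem baseEval_congr {x : Piece} {f g : List (ZMod p) → ℕ} {s : List (ZMod p)}
    (h : ∀ t, t.length + x.ins = s.length + x.outs →
      t.alternatingSum = s.alternatingSum → f t = g t) :
    baseEval x f s = baseEval x g s := by
  rcases x with _ | _ | c
  · simp only [baseEval]
    refine Finset.sum_congr rfl fun a _ => h _ (by simp [Piece.ins, Piece.outs]) ?_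
    simp
  · rcases s with _ | ⟨a, _ | ⟨b, s⟩⟩ <;> simp only [baseEval]
    split_ifs with hab
    · subst hab
      exact h _ (by simp [Piece.ins, Piece.outs]) (by simp)
    · rfl
  · rcases s with _ | ⟨a, _ | ⟨b, s⟩⟩ <;> cases c <;> simp only [baseEval]
    all_goals
      refine h _ (by simp [Piece.ins, Piece.outs]) ?_
      simp only [List.alternatingSum_cons_cons]
      ring

theorem pieceEval_congr {x : Piece} {i : ℕ} {f g : List (ZMod p) → ℕ} {s : List (ZMod p)}
    (h : ∀ t, t.length + x.ins = s.length + x.outs →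
      t.alternatingSum = s.alternatingSum → f t = g t) :
    pieceEval x i f s = pieceEval x i g s := by
  induction i generalizing s f g with
  | zero => exact baseEval_congr h
  | succ i ih =>
    cases s with
    | nil => rfl
    | cons a s =>
      refine ih fun t ht ht' => h _ (by simp only [List.length_cons]; omega) ?_
      simp [List.alternatingSum_cons, ht']

/-- Each piece preserves the alternating sum of the colors, so the evaluation only consults
colorings of the upper ends with the same alternating sum as the lower ends. -/
theorem eval_congr {m n : ℕ} {D : Diagram} (hD : IsTangle m n D) {f g : List (ZMod p) → ℕ}
    {s : List (ZMod p)} (hs : s.length = m)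
    (h : ∀ t, t.length = n → t.alternatingSum = s.alternatingSum → f t = g t) :
    eval D f s = eval D g s := by
  induction D generalizing m s with
  | nil => exact h s (hs.trans hD) rfl
  | cons x D ih =>
    refine pieceEval_congr fun t ht ht' => ih hD.2 ?_ fun u hu hu' => h u hu (hu'.trans ht')
    have := hD.1
    omega

theorem baseEval_sum {ι : Type*} (I : Finset ι) (x : Piece) (F : ι → List (ZMod p) → ℕ)
    (s : List (ZMod p)) :
    baseEval x (fun t => ∑ a ∈ I, F a t) s = ∑ a ∈ I, baseEval x (F a) s := by
  rcases x with _ | _ | c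
  · simp only [baseEval]
    exact Finset.sum_comm
  · rcases s with _ | ⟨a, _ | ⟨b, s⟩⟩ <;> simp only [baseEval, Finset.sum_const_zero]
    split_ifs <;> simp
  · rcases s with _ | ⟨a, _ | ⟨b, s⟩⟩ <;> cases c <;> simp only [baseEval, Finset.sum_const_zero]

theorem pieceEval_sum {ι : Type*} (I : Finset ι) (x : Piece) (i : ℕ) (F : ι → List (ZMod p) → ℕ)
    (s : List (ZMod p)) :
    pieceEval x i (fun t => ∑ a ∈ I, F a t) s = ∑ a ∈ I, pieceEval x i (F a) s := by
  induction i generalizing s F with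
  | zero => exact baseEval_sum I x F s
  | succ i ih =>
    cases s with
    | nil => simp [pieceEval]
    | cons a s => exact ih _ _

theorem pieceEval_const_mul (x : Piece) (i k : ℕ) (f : List (ZMod p) → ℕ) (s : List (ZMod p)) :
    pieceEval x i (fun t => k * f t) s = k * pieceEval x i f s := by
  have := pieceEval_sum (Finset.range k) x i (fun _ => f) s
  simpa using this

theorem eval_const_mul (D : Diagram) (k : ℕ) (f : List (ZMod p) → ℕ) (s : List (ZMod p)) :
    eval D (fun t => k * f t) s = k * eval D f s := by
  induction D generalizing s with
  | nil => rfl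
  | cons x D ih =>
    simp only [eval]
    rw [← pieceEval_const_mul]
    congr 1
    ext t
    exact ih t

theorem baseEval_translate (x : Piece) (f : List (ZMod p) → ℕ) (c : ZMod p) (s : List (ZMod p)) :
    baseEval x f (s.map (· + c)) = baseEval x (fun t => f (t.map (· + c))) s := by
  rcases x with _ | _ | d
  · simp only [baseEval, List.map_cons]
    exact (Equiv.sum_comp (Equiv.addRight c) fun a => f (a :: a :: s.map (· + c))).symm
  · rcases s with _ | ⟨a, _ | ⟨b, s⟩⟩ <;> simp [baseEval]
  · rcases s with _ | ⟨a, _ | ⟨b, s⟩⟩ <;> cases d <;> simp only [baseEval, List.map_cons, List.map_nil]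
    all_goals congr 3; ring

theorem pieceEval_translate (x : Piece) (i : ℕ) (f : List (ZMod p) → ℕ) (c : ZMod p)
    (s : List (ZMod p)) :
    pieceEval x i f (s.map (· + c)) = pieceEval x i (fun t => f (t.map (· + c))) s := by
  induction i generalizing s f with
  | zero => exact baseEval_translate x f c s
  | succ i ih =>
    cases s with
    | nil => rfl
    | cons a s => exact ih _ _

/-- The coloring rule 2a - b is affine, so a constant may be added to all colors. -/
theorem eval_translate (D : Diagram) (f : List (ZMod p) → ℕ) (c : ZMod p) (s : List (ZMod p)) :
    eval D f (s.map (· + c)) = eval D (fun t => f (t.map (· + c))) s := by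
  induction D generalizing s with
  | nil => rfl
  | cons x D ih =>
    simp only [eval]
    rw [pieceEval_translate]
    congr 1
    ext t
    exact ih t

theorem baseEval_append (x : Piece) (f : List (ZMod p) → ℕ) (s t : List (ZMod p))
    (h : x.ins ≤ s.length) :
    baseEval x f (s ++ t) = baseEval x (fun u => f (u ++ t)) s := by
  rcases x with _ | _ | d
  · rfl
  · rcases s with _ | ⟨a, _ | ⟨b, s⟩⟩ <;> simp_all [baseEval, Piece.ins]
  · rcases s with _ | ⟨a, _ | ⟨b, s⟩⟩ <;> cases d <;> simp_all [baseEval, Piece.ins]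

theorem pieceEval_append (x : Piece) (i : ℕ) (f : List (ZMod p) → ℕ) (s t : List (ZMod p))
    (h : i + x.ins ≤ s.length) :
    pieceEval x i f (s ++ t) = pieceEval x i (fun u => f (u ++ t)) s := by
  induction i generalizing s f with
  | zero => exact baseEval_append x f s t (by omega)
  | succ i ih =>
    cases s with
    | nil => simp at h
    | cons a s => exact ih _ _ (by simp at h; omega)

theorem eval_append_right {m n : ℕ} {D : Diagram} (hD : IsTangle m n D) (f : List (ZMod p) → ℕ)
    (s t : List (ZMod p)) (hs : s.length = m) :
    eval D f (s ++ t) = eval D (fun u => f (u ++ t)) s := by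
  induction D generalizing m s with
  | nil => rfl
  | cons x D ih =>
    simp only [eval]
    rw [pieceEval_append _ _ _ _ _ (hs ▸ hD.1)]
    refine pieceEval_congr fun u hu _ => ih hD.2 u ?_
    have := hD.1
    omega

/-- The number of colorings of a `1`-`1` tangle whose lower end has a given color. -/
def multiplicity (p : ℕ) [NeZero p] (K : Diagram) : ℕ := eval K (fun _ => 1) [(0 : ZMod p)]

/-- With a single end below and above, the preserved alternating sum forces both ends to have the
same color. By translation the number of colorings does not depend on that color. This makes slides
invisible to colorings and connected sums multiplicative. -/
theorem eval_oneOne {K : Diagram} (hK : IsTangle 1 1 K) (f : List (ZMod p) → ℕ) (a : ZMod p)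
    (s : List (ZMod p)) : eval K f (a :: s) = multiplicity p K * f (a :: s) := by
  have h1 := eval_append_right hK f [a] s rfl
  simp only [List.singleton_append] at h1
  rw [h1, eval_congr hK (g := fun _ => f (a :: s) * 1) rfl, eval_const_mul, mul_comm]
  · congr 1
    have := eval_translate K (fun _ => 1) a [0]
    simpa [multiplicity] using this
  · intro t ht ht'
    obtain ⟨b, rfl⟩ := List.length_eq_one_iff.1 ht
    simp only [List.alternatingSum_singleton] at ht'
    simp [ht']

theorem multiplicity_append {K L : Diagram} (hK : IsTangle 1 1 K) :
    multiplicity p (K ++ L) = multiplicity p K * multiplicity p L := by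
  conv_lhs => rw [multiplicity, eval_append, eval_oneOne hK]
  rfl

/-- The number of Fox colorings of a closed diagram. -/
def colorings (p : ℕ) [NeZero p] (D : Diagram) : ℕ :=
  eval D (fun _ => 1) ([] : List (ZMod p))

theorem colorings_closure {K : Diagram} (hK : IsTangle 1 1 K) :
    colorings p (closure K) = p * multiplicity p K := by
  simp only [colorings, closure, eval_append]
  simp only [eval, pieceEval, baseEval]
  simp [eval_oneOne hK]

theorem colorings_closure_shift {K : Diagram} (hK : IsTangle 1 1 K) :
    colorings p (closure (shift 1 K)) = p * multiplicity p K := by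
  simp only [colorings, closure, eval_append]
  simp only [eval, pieceEval, baseEval, eval_shift_succ, shift_zero]
  simp [eval_oneOne hK]

/-! ### Invariance -/

/-- Strands to the left of a move can be absorbed in the weight, so each move has to be checked only
at the left margin. -/
theorem eval_local_congr {m i : ℕ} {r r' : Diagram}
    (h : ∀ (f : List (ZMod p) → ℕ) s, s.length = m → eval r f s = eval r' f s)
    (f : List (ZMod p) → ℕ) (s : List (ZMod p)) (hs : s.length = i + m) :
    eval (shift i r) f s = eval (shift i r') f s := by
  induction i generalizing f s with
  | zero => simpa using h f s (by omega)
  | succ i ih =>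
    cases s with
    | nil => simp at hs; omega
    | cons a s =>
      rw [eval_shift_succ, eval_shift_succ]
      exact ih _ _ (by simp at hs; omega)


theorem pieceEval_zero (x : Piece) (i : ℕ) (s : List (ZMod p)) :
    pieceEval x i (fun _ => 0) s = 0 := by
  simpa using pieceEval_const_mul x i 0 (fun _ => 0) s

theorem baseEval_exchange (x y : Piece) (g : ℕ) (f : List (ZMod p) → ℕ) (s : List (ZMod p))
    (h : x.ins ≤ s.length) :
    baseEval x (pieceEval y (x.outs + g) f) s = pieceEval y (x.ins + g) (baseEval x f) s := by
  rcases x with _ | _ | c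
  · simp only [Piece.ins, Piece.outs, zero_add, show 2 + g = g + 1 + 1 by omega]
    simp only [baseEval, pieceEval]
    exact (pieceEval_sum Finset.univ y g (fun a t => f (a :: a :: t)) s).symm
  · rcases s with _ | ⟨a, _ | ⟨b, s⟩⟩
    · simp [Piece.ins] at h
    · simp [Piece.ins] at h
    · simp only [Piece.ins, Piece.outs, zero_add, show 2 + g = g + 1 + 1 by omega]
      simp only [baseEval, pieceEval]
      split_ifs
      · rfl
      · exact (pieceEval_zero y g s).symm
  · rcases s with _ | ⟨a, _ | ⟨b, s⟩⟩
    · simp [Piece.ins] at h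
    · simp [Piece.ins] at h
    · simp only [Piece.ins, Piece.outs, show 2 + g = g + 1 + 1 by omega]
      cases c <;> simp only [baseEval, pieceEval]

/-- The Reidemeister moves express identities of the operation 2a - b, and slides follow from
`eval_oneOne`. The alternative in the hypothesis is needed because an unresolved crossing is
evaluated like `rise`, which a quarter turn does not respect unless 2 = 0. -/
theorem eval_localMove {r r' : Diagram} (h : LocalMove r r')
    (h2 : unresolved r = 0 ∨ (2 : ZMod p) = 0) {m n : ℕ} (hr : IsTangle m n r)
    (hr' : IsTangle m n r') (f : List (ZMod p) → ℕ) (s : List (ZMod p)) (hs : s.length = m) :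
    eval r f s = eval r' f s := by
  cases h with
  | exchange i g x y =>
    obtain ⟨k, rfl⟩ := Nat.exists_eq_add_of_le (show i ≤ m by have := hr.1; simp only at this; omega)
    have := eval_local_congr (p := p) (m := k) (i := i) (r := [⟨0, x⟩, ⟨x.outs + g, y⟩])
      (r' := [⟨x.ins + g, y⟩, ⟨0, x⟩]) (fun f s hs => ?_) f s hs
    · simpa [add_assoc] using this
    · have h1 := hr.1
      simp only at h1
      exact baseEval_exchange x y g f s (by omega)
  | zigzagLeft i =>
    obtain ⟨k, rfl⟩ := Nat.exists_eq_add_of_le (show i ≤ m by have := hr.1; simpa [Piece.ins] using this)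
    refine eval_local_congr (p := p) (m := k) (i := i) (r := [cup 0, cap 1])
      (r' := []) (fun f s hs => ?_) f s hs
    have h1 := hr.2.1
    simp only [Piece.ins, Piece.outs] at h1
    rcases s with _ | ⟨a, s⟩
    · simp at hs; omega
    · simp [eval, pieceEval, baseEval]
  | zigzagRight i =>
    have h1 := hr.1
    simp only [Piece.ins] at h1
    obtain ⟨k, rfl⟩ := Nat.exists_eq_add_of_le (show i ≤ m by omega)
    refine eval_local_congr (p := p) (m := k) (i := i) (r := [cup 1, cap 0])
      (r' := []) (fun f s hs => ?_) f s hs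
    rcases s with _ | ⟨a, s⟩
    · simp at hs; omega
    · simp [eval, pieceEval, baseEval]
  | turn i c =>
    have h1 := hr.1
    simp only [Piece.ins] at h1
    obtain ⟨k, rfl⟩ := Nat.exists_eq_add_of_le (show i ≤ m by omega)
    refine eval_local_congr (p := p) (m := k) (i := i) (r := [cross c 1, cap 0])
      (r' := [cross c.turn 0, cap 1]) (fun f s hs => ?_) f s hs
    rcases s with _ | ⟨a, _ | ⟨b, _ | ⟨d, s⟩⟩⟩
    · simp at hs; omega
    · simp at hs; omega
    · simp at hs; omega
    · cases c <;> simp only [eval, pieceEval, baseEval, Crossing.turn]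
      -- An unresolved crossing counts as `rise` both before and after the turn; this is consistent
      -- only modulo two.
      · have h2 : (2 : ZMod p) = 0 := by simpa using h2
        have h3 : ∀ x : ZMod p, -x = x := fun x => by linear_combination (-x) * h2
        simp only [h2, zero_mul, zero_sub, h3]
      · congr 1
        exact propext ⟨fun h => by rw [h]; ring, fun h => by rw [← h]; ring⟩
      · rcases eq_or_ne a d with rfl | had
        · simp
        · simp [had]
  | oneRight i c hc =>
    have h1 := hr.1
    simp only [Piece.ins] at h1
    obtain ⟨k, rfl⟩ := Nat.exists_eq_add_of_le (show i ≤ m by omega)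
    refine eval_local_congr (p := p) (m := k) (i := i) (r := [cup 1, cross c 0, cap 1])
      (r' := []) (fun f s hs => ?_) f s hs
    rcases s with _ | ⟨a, s⟩
    · simp at hs; omega
    · have e : ∀ x : ZMod p, 2 * x - a = x ↔ x = a := fun x =>
        ⟨fun h => by linear_combination h, fun h => by rw [h]; ring⟩
      cases c <;> simp [eval, pieceEval, baseEval, e, show 2 * a - a = a by ring] at hc ⊢
  | oneLeft i c hc =>
    have h1 := hr.2.1
    simp only [Piece.ins, Piece.outs] at h1
    obtain ⟨k, rfl⟩ := Nat.exists_eq_add_of_le (show i ≤ m by omega)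
    refine eval_local_congr (p := p) (m := k) (i := i) (r := [cup 0, cross c 1, cap 0])
      (r' := []) (fun f s hs => ?_) f s hs
    rcases s with _ | ⟨a, s⟩
    · simp at hs; omega
    · have e : ∀ x : ZMod p, x = 2 * x - a ↔ x = a := fun x =>
        ⟨fun h => by linear_combination -h, fun h => by rw [h]; ring⟩
      cases c <;> simp [eval, pieceEval, baseEval, e, show 2 * a - a = a by ring] at hc ⊢
  | two i c hc =>
    have h1 := hr.1
    simp only [Piece.ins] at h1
    obtain ⟨k, rfl⟩ := Nat.exists_eq_add_of_le (show i ≤ m by omega)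
    refine eval_local_congr (p := p) (m := k) (i := i) (r := [cross c 0, cross c.turn 0])
      (r' := []) (fun f s hs => ?_) f s hs
    rcases s with _ | ⟨a, _ | ⟨b, s⟩⟩
    · simp at hs; omega
    · simp at hs; omega
    · cases c <;> simp [eval, pieceEval, baseEval, Crossing.turn] at hc ⊢
  | three i a b c ha hb hc habc =>
    have h1 := hr.2.1
    simp only [Piece.ins, Piece.outs] at h1
    obtain ⟨k, rfl⟩ := Nat.exists_eq_add_of_le (show i ≤ m by omega)
    refine eval_local_congr (p := p) (m := k) (i := i) (r := [cross a 0, cross b 1, cross c 0])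
      (r' := [cross c 1, cross b 0, cross a 1]) (fun f s hs => ?_) f s hs
    rcases s with _ | ⟨x, _ | ⟨y, _ | ⟨z, s⟩⟩⟩
    · simp at hs; omega
    · simp at hs; omega
    · simp at hs; omega
    · cases a <;> cases b <;> cases c <;>
        simp [eval, pieceEval, baseEval] at ha hb hc habc ⊢
      all_goals (congr 2; ring_nf)
  | slideUp i c K hK =>
    have h1 := hr'.1
    simp only [Piece.ins] at h1
    obtain ⟨k, rfl⟩ := Nat.exists_eq_add_of_le (show i ≤ m by omega)
    have := eval_local_congr (p := p) (m := k) (i := i) (r := K ++ [cross c 0])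
      (r' := [cross c 0] ++ shift 1 K) (fun f s hs => ?_) f s hs
    · simpa [shift_shift] using this
    · rcases s with _ | ⟨a, _ | ⟨b, s⟩⟩
      · simp at hs; omega
      · simp at hs; omega
      · simp only [eval_append]
        cases c <;> simp [eval, pieceEval, baseEval, eval_oneOne hK, eval_shift_succ]
  | slideDown i c K hK =>
    have h1 := hr'.1
    simp only [Piece.ins] at h1
    obtain ⟨k, rfl⟩ := Nat.exists_eq_add_of_le (show i ≤ m by omega)
    have := eval_local_congr (p := p) (m := k) (i := i) (r := shift 1 K ++ [cross c 0])
      (r' := [cross c 0] ++ K) (fun f s hs => ?_) f s hs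
    · simpa [shift_shift] using this
    · rcases s with _ | ⟨a, _ | ⟨b, s⟩⟩
      · simp at hs; omega
      · simp at hs; omega
      · simp only [eval_append]
        cases c <;> simp [eval, pieceEval, baseEval, eval_oneOne hK, eval_shift_succ]

theorem IsTangle.unique_left {m m' n : ℕ} {A : Diagram} (h : IsTangle m n A)
    (h' : IsTangle m' n A) : m = m' := by
  induction A generalizing m m' with
  | nil => exact Eq.trans h h'.symm
  | cons x A ih =>
    have := ih h.2 h'.2
    have h1 := h.1
    have h2 := h'.1
    omega

theorem Step.colorings_eq {D D' : Diagram} (h : Step D D')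
    (h2 : unresolved D = 0 ∨ (2 : ZMod p) = 0) : colorings p D = colorings p D' := by
  cases h with
  | inside A B r r' h h1 h1' =>
    obtain ⟨n, h3, h4⟩ := isTangle_append.1 h1
    obtain ⟨m, h5, h6⟩ := isTangle_append.1 h3
    obtain ⟨n', h3', h4'⟩ := isTangle_append.1 h1'
    obtain rfl := h4.unique_left h4'
    simp only [colorings, eval_append]
    refine eval_congr h5 rfl fun s hs _ => eval_localMove h (h2.imp_left fun h => ?_) h6
      (h5.append_right h3') _ s hs
    simp only [unresolved_append] at h
    omega
  | sphere K hK => rw [colorings_closure hK, colorings_closure_shift hK]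

theorem Equivalent.colorings_eq {D D' : Diagram} (h : Equivalent D D')
    (h2 : unresolved D = 0 ∨ (2 : ZMod p) = 0) : colorings p D = colorings p D' := by
  induction h with
  | rel x y h => exact h.colorings_eq h2
  | refl => rfl
  | symm x y h ih => exact (ih (h2.imp_left fun e => (Equivalent.unresolved_eq h).trans e)).symm
  | trans x y z h h' ih ih' =>
    exact (ih h2).trans (ih' (h2.imp_left fun e => (Equivalent.unresolved_eq h).symm.trans e))

theorem colorings_circle : colorings p circle = p := by
  have := colorings_closure (p := p) (K := []) rfl
  rw [show closure [] = circle from rfl] at this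
  simpa [multiplicity, eval] using this

end Colorings

/-! ### Colorings modulo two and components -/

/-- How colors modulo two pass through a piece. -/
inductive PieceRel : Piece → List (ZMod 2) → List (ZMod 2) → Prop
  | cup (a : ZMod 2) : PieceRel .cup [] [a, a]
  | cap (a : ZMod 2) : PieceRel .cap [a, a] []
  | cross (c : Crossing) (a b : ZMod 2) : PieceRel (.cross c) [a, b] [b, a]

/-- How colors modulo two pass through a slice. -/
inductive Next : Slice → List (ZMod 2) → List (ZMod 2) → Prop
  | mk (x : Piece) (u v s t : List (ZMod 2)) : PieceRel x s t →
      Next ⟨u.length, x⟩ (u ++ s ++ v) (u ++ t ++ v)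

/-- A nonzero count contains an actual coloring. Modulo two, 2a - b equals b, so colors run straight
through crossings. -/
theorem exists_next {x : Piece} {i : ℕ} {f : List (ZMod 2) → ℕ} {s : List (ZMod 2)}
    (h : pieceEval x i f s ≠ 0) : ∃ t, Next ⟨i, x⟩ s t ∧ f t ≠ 0 := by
  have two : (2 : ZMod 2) = 0 := rfl
  have neg : ∀ a : ZMod 2, -a = a := by decide
  induction i generalizing s f with
  | zero =>
    simp only [pieceEval] at h
    rcases x with _ | _ | c
    · simp only [baseEval] at h
      obtain ⟨a, -, ha⟩ := Finset.exists_ne_zero_of_sum_ne_zero h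
      exact ⟨_, Next.mk .cup [] s _ _ (PieceRel.cup a), ha⟩
    · rcases s with _ | ⟨a, _ | ⟨b, s⟩⟩ <;> simp only [baseEval, ne_eq, not_true_eq_false] at h
      split_ifs at h with hab
      · subst hab
        exact ⟨_, Next.mk .cap [] s _ _ (PieceRel.cap a), h⟩
      · simp at h
    · rcases s with _ | ⟨a, _ | ⟨b, s⟩⟩ <;> cases c <;>
        simp only [baseEval, ne_eq, not_true_eq_false] at h
      all_goals
        refine ⟨_, Next.mk (.cross _) [] s _ _ (PieceRel.cross _ a b), ?_⟩
        simpa [two, neg] using h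
  | succ i ih =>
    cases s with
    | nil => simp [pieceEval] at h
    | cons a s =>
      obtain ⟨t, ht, hf⟩ := ih h
      cases ht with
      | mk _ u v s t hst => exact ⟨_, Next.mk x (a :: u) v s t hst, hf⟩

/-- A coloring modulo two, as the sequence of the colors of the strands between the slices. -/
def IsRun : Diagram → (ℕ → List (ZMod 2)) → Prop
  | [], _ => True
  | x :: D, R => Next x (R 0) (R 1) ∧ IsRun D fun t => R (t + 1)

/-- A run preceded by a given state. -/
def prepend (s : List (ZMod 2)) (R : ℕ → List (ZMod 2)) : ℕ → List (ZMod 2)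
  | 0 => s
  | t + 1 => R t

theorem exists_isRun {D : Diagram} {s : List (ZMod 2)} {f : List (ZMod 2) → ℕ}
    (h : eval D f s ≠ 0) : ∃ R, R 0 = s ∧ IsRun D R := by
  induction D generalizing s with
  | nil => exact ⟨fun _ => s, rfl, trivial⟩
  | cons x D ih =>
    obtain ⟨t, ht, h'⟩ := exists_next h
    obtain ⟨R, rfl, hR⟩ := ih h'
    exact ⟨prepend s R, rfl, ht, hR⟩

theorem IsRun.next {D : Diagram} {R : ℕ → List (ZMod 2)} (h : IsRun D R) {t : ℕ} {x : Slice}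
    (hx : D[t]? = some x) : Next x (R t) (R (t + 1)) := by
  induction D generalizing t R with
  | nil => simp at hx
  | cons y D ih =>
    cases t with
    | zero =>
      simp only [List.getElem?_cons_zero, Option.some.injEq] at hx
      exact hx ▸ h.1
    | succ t => exact ih h.2 (by simpa using hx)

theorem Next.length_eq {x : Slice} {s t : List (ZMod 2)} (h : Next x s t) :
    t.length = s.length - x.piece.ins + x.piece.outs := by
  obtain ⟨x, u, v, s, t, h⟩ := h
  cases h <;> simp [Piece.ins, Piece.outs] <;> omega

theorem IsRun.length_eq {D : Diagram} {R : ℕ → List (ZMod 2)} (h : IsRun D R) {t : ℕ}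
    (ht : t ≤ D.length) : (R t).length =
      (D.take t).foldl (fun w x => w - x.piece.ins + x.piece.outs) (R 0).length := by
  induction D generalizing t R with
  | nil => simp at ht; simp [ht]
  | cons y D ih =>
    cases t with
    | zero => simp
    | succ t =>
      rw [List.take_succ_cons, List.foldl_cons, ← h.1.length_eq]
      exact ih h.2 (by simpa using ht)

theorem Next.left {x : Slice} {s t : List (ZMod 2)} (h : Next x s t) {j : ℕ} (hj : j < x.pos) :
    s[j]? = t[j]? := by
  obtain ⟨x, u, v, s, t, h⟩ := h
  simp only at hj
  simp [hj, Nat.lt_add_right]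

theorem Next.right {x : Slice} {s t : List (ZMod 2)} (h : Next x s t) (g : ℕ) :
    s[x.pos + x.piece.ins + g]? = t[x.pos + x.piece.outs + g]? := by
  obtain ⟨x, u, v, s, t, h⟩ := h
  have e : s.length = x.ins ∧ t.length = x.outs := by cases h <;> simp [Piece.ins, Piece.outs]
  rw [← e.1, ← e.2]
  simp only
  rw [List.getElem?_append_right (by simp), List.getElem?_append_right (by simp)]
  simp

theorem IsRun.adj {D : Diagram} {R : ℕ → List (ZMod 2)} (h : IsRun D R) {p q : ℕ × ℕ}
    (hpq : Adj D p q) : (R p.1)[p.2]? = (R q.1)[q.2]? := by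
  cases hpq with
  | left t j x hx hj => exact (h.next hx).left hj
  | right t g x hx => exact (h.next hx).right g
  | cup t i hx =>
    have := h.next hx
    generalize R t = s at this
    simp only
    generalize R (t + 1) = s' at this
    obtain ⟨_, u, v, _, _, ⟨⟩⟩ := this
    simp
  | cap t i hx =>
    have := h.next hx
    simp only
    generalize R t = s at this
    generalize R (t + 1) = s' at this
    obtain ⟨_, u, v, _, _, ⟨⟩⟩ := this
    simp
  | crossUp t i c hx =>
    have := h.next hx
    simp only
    generalize R t = s at this
    generalize R (t + 1) = s' at this
    obtain ⟨_, u, v, _, _, ⟨⟩⟩ := this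
    simp
  | crossDown t i c hx =>
    have := h.next hx
    simp only
    generalize R t = s at this
    generalize R (t + 1) = s' at this
    obtain ⟨_, u, v, _, _, ⟨⟩⟩ := this
    simp

theorem baseEval_replicate {x : Piece} {f : List (ZMod 2) → ℕ} {m : ℕ} {a : ZMod 2}
    (h : x.ins ≤ m) :
    baseEval x f (List.replicate m a) = f (List.replicate (m - x.ins + x.outs) a) ∨
      x = .cup ∧ baseEval x f (List.replicate m a) = f (List.replicate (m + 2) a) +
        f ((a + 1) :: (a + 1) :: List.replicate m a) := by
  rcases x with _ | _ | d
  · refine Or.inr ⟨rfl, ?_⟩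
    have : ∀ g : ZMod 2 → ℕ, ∀ a : ZMod 2, ∑ b, g b = g a + g (a + 1) := by
      intro g a
      have e : ∑ b, g b = g 0 + g 1 := Fin.sum_univ_two g
      rw [e]
      fin_cases a
      · rfl
      · exact add_comm _ _
    exact this (fun b => f (b :: b :: List.replicate m a)) a
  · obtain ⟨m, rfl⟩ := Nat.exists_eq_add_of_le' h
    exact Or.inl (by simp [Piece.ins, Piece.outs, List.replicate_succ, baseEval])
  · obtain ⟨m, rfl⟩ := Nat.exists_eq_add_of_le' h
    left
    cases d <;>
      simp [Piece.ins, Piece.outs, List.replicate_succ, baseEval, two_mul]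

/-- Above strands of constant color only a minimum leaves a choice: its arc may take either of the
two colors. -/
theorem pieceEval_replicate {x : Piece} {i : ℕ} {f : List (ZMod 2) → ℕ} {m : ℕ} {a : ZMod 2}
    (h : i + x.ins ≤ m) :
    pieceEval x i f (List.replicate m a) = f (List.replicate (m - x.ins + x.outs) a) ∨
      x = .cup ∧ pieceEval x i f (List.replicate m a) = f (List.replicate (m + 2) a) +
        f (List.replicate i a ++ (a + 1) :: (a + 1) :: List.replicate (m - i) a) := by
  induction i generalizing f m with
  | zero => simpa [pieceEval] using baseEval_replicate (by omega)
  | succ i ih =>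
    obtain ⟨m, rfl⟩ := Nat.exists_eq_add_of_le' (show 1 ≤ m by omega)
    rcases ih (f := fun t => f (a :: t)) (m := m) (by omega) with h' | ⟨rfl, h'⟩
    · left
      rw [show m + 1 - x.ins + x.outs = (m - x.ins + x.outs) + 1 by omega]
      exact h'
    · refine Or.inr ⟨rfl, ?_⟩
      rw [show m + 1 - (i + 1) = m - i by omega]
      exact h'

/-- A second coloring has to leave the constant one at a minimum, and the first minimum where the
other color extends to the top supplies the run. -/
theorem exists_nonconstant_run {m n : ℕ} {D : Diagram} (hD : IsTangle m n D) {a : ZMod 2}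
    (h : 2 ≤ eval D (fun _ => 1) (List.replicate m a)) :
    ∃ R, R 0 = List.replicate m a ∧ IsRun D R ∧ ∃ t j : ℕ, t ≤ D.length ∧
      (R t)[j]? = some (a + 1) := by
  induction D generalizing m with
  | nil => simp [eval] at h
  | cons x D ih =>
    have step : 2 ≤ eval D (fun _ => 1) (List.replicate (m - x.piece.ins + x.piece.outs) a) →
        Next x (List.replicate m a) (List.replicate (m - x.piece.ins + x.piece.outs) a) →
        ∃ R, R 0 = List.replicate m a ∧ IsRun (x :: D) R ∧ ∃ t j : ℕ, t ≤ (x :: D).length ∧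
          (R t)[j]? = some (a + 1) := by
      intro h2 hx
      obtain ⟨R, h1, hR, t, j, ht, htj⟩ := ih hD.2 h2
      exact ⟨prepend _ R, rfl, ⟨by rw [← h1] at hx; exact hx, hR⟩, t + 1, j, by simpa using ht, htj⟩
    have hx : Next x (List.replicate m a)
        (List.replicate (m - x.piece.ins + x.piece.outs) a) := by
      obtain ⟨i, x⟩ := x
      have h1 := hD.1
      simp only at h1
      obtain ⟨k, rfl⟩ := Nat.exists_eq_add_of_le h1
      have : PieceRel x (List.replicate x.ins a) (List.replicate x.outs a) := by
        rcases x with _ | _ | c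
        · exact PieceRel.cup a
        · exact PieceRel.cap a
        · exact PieceRel.cross c a a
      have := Next.mk x (List.replicate i a) (List.replicate k a) _ _ this
      simp only [List.length_replicate, List.replicate_append_replicate] at this
      simpa [show i + x.ins + k - x.ins + x.outs = i + x.outs + k by omega] using this
    rcases pieceEval_replicate (f := eval D fun _ => 1) (a := a) hD.1 with h' | ⟨hc, h'⟩
    · exact step (by rw [← h']; exact h) hx
    · by_cases h0 : eval D (fun _ => 1)
        (List.replicate x.pos a ++ (a + 1) :: (a + 1) :: List.replicate (m - x.pos) a) = 0
      · refine step ?_ hx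
        rw [h0, add_zero] at h'
        rw [hc, show m - Piece.cup.ins + Piece.cup.outs = m + 2 from rfl, ← h']
        exact h
      · obtain ⟨R, h1, hR⟩ := exists_isRun h0
        have hp : x.pos ≤ m := by have := hD.1; omega
        have := Next.mk .cup (List.replicate x.pos a) (List.replicate (m - x.pos) a) _ _
          (PieceRel.cup (a + 1))
        refine ⟨prepend (List.replicate m a) R, rfl, ⟨?_, hR⟩, 1, x.pos, by simp, ?_⟩
        · obtain ⟨i, x⟩ := x
          simp only at hc hp h1
          subst hc
          simp only [List.length_replicate, List.append_nil, List.replicate_append_replicate,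
            Nat.add_sub_cancel' hp] at this
          rw [prepend, prepend, h1]
          simpa using this
        · rw [prepend, h1]
          simp

/-- Modulo two, a coloring is constant along each component. If the color of the lowest arc did not
determine everything, there would be a nonconstant coloring, against connectedness. So there is at
most one coloring for each of the two colors of that arc. -/
theorem IsKnot.colorings_two_le {D : Diagram} (h : IsKnot (cup 0 :: D)) :
    colorings 2 (cup 0 :: D) ≤ 2 := by
  obtain ⟨h1, -, h2⟩ := h
  have key : ∀ a : ZMod 2, eval D (fun _ => 1) [a, a] ≤ 1 := by
    intro a
    by_contra hlt
    obtain ⟨R, hR0, hR, t, j, ht, htj⟩ := exists_nonconstant_run (m := 2) h1.2 (a := a)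
      (Nat.lt_of_not_le hlt)
    have hrun : IsRun (cup 0 :: D) (prepend [] R) := by
      refine ⟨?_, hR⟩
      rw [prepend, prepend, hR0]
      exact Next.mk .cup [] [] _ _ (PieceRel.cup a)
    have hpt : ∀ (t j : ℕ) b, t ≤ D.length → (R t)[j]? = some b → IsPoint (cup 0 :: D) (t + 1, j) := by
      intro t j b ht hj
      refine ⟨by simpa using ht, ?_⟩
      have := hrun.length_eq (t := t + 1) (by simpa using ht)
      exact lt_of_lt_of_eq (List.getElem?_eq_some_iff.1 hj).1 this
    have h0 : (R 0)[0]? = some a := by rw [hR0]; rfl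
    have hconn := h2 _ _ (hpt 0 0 a (Nat.zero_le _) h0) (hpt t j _ ht htj)
    have : ∀ p q, Relation.EqvGen (Adj (cup 0 :: D)) p q →
        (prepend [] R p.1)[p.2]? = (prepend [] R q.1)[q.2]? := by
      intro p q h
      induction h with
      | rel p q h => exact hrun.adj h
      | refl => rfl
      | symm _ _ _ ih => exact ih.symm
      | trans _ _ _ _ _ ih ih' => exact ih.trans ih'
    have := this _ _ hconn
    simp only [prepend] at this
    rw [h0, htj] at this
    simp at this
  have e : colorings 2 (cup 0 :: D) = ∑ a : ZMod 2, eval D (fun _ => 1) [a, a] := rfl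
  rw [e]
  exact (Finset.sum_le_sum fun a _ => key a).trans (by simp)

/-! ### Moving an inserted tangle along a strand -/

theorem isTangle_shift_one {L : Diagram} (hL : IsTangle 1 1 L) {j m : ℕ} (hj : j < m) :
    IsTangle m m (shift j L) := by
  obtain ⟨k, rfl⟩ := Nat.exists_eq_add_of_le (show j + 1 ≤ m from hj)
  exact hL.widen j k

theorem TEq.of_eq {m n : ℕ} {X Y : Diagram} (h : X = Y) : TEq m n X Y := h ▸ TEq.refl X

/-- A `1`-`1` tangle on a strand to the left of a tangle `X`. -/
theorem pass_left {L : Diagram} (hL : IsTangle 1 1 L) {k n : ℕ} {X : Diagram}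
    (hX : IsTangle k n X) {i j m : ℕ} (hj : j < i) :
    TEq (i + k + m) (i + n + m) (shift j L ++ shift i X) (shift i X ++ shift j L) := by
  obtain ⟨g, rfl⟩ := Nat.exists_eq_add_of_le (show j + 1 ≤ i from hj)
  have h := (exchange_blocks hL (hX.widen g m)).widen j 0
  simpa [shift_shift, add_assoc] using h

/-- A `1`-`1` tangle on a strand to the right of a tangle `X`. -/
theorem pass_right {L : Diagram} (hL : IsTangle 1 1 L) {k n : ℕ} {X : Diagram}
    (hX : IsTangle k n X) {i g m : ℕ} (hg : g < m) :
    TEq (i + k + m) (i + n + m) (shift (i + k + g) L ++ shift i X)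
      (shift i X ++ shift (i + n + g) L) := by
  obtain ⟨m, rfl⟩ := Nat.exists_eq_add_of_le (show g + 1 ≤ m from hg)
  have h := ((exchange_blocks (hX.widen i g) hL).widen_right m).symm
  simpa [add_assoc] using h

/-- The half turn of a `1`-`1` tangle. -/
def halfTurn (L : Diagram) : Diagram := [cup 1] ++ shift 1 L ++ [cap 0]

/-- The half turn of a `1`-`1` tangle in the other direction. -/
def halfTurn' (L : Diagram) : Diagram := [cup 0] ++ shift 1 L ++ [cap 1]

theorem isTangle_halfTurn {L : Diagram} (hL : IsTangle 1 1 L) : IsTangle 1 1 (halfTurn L) :=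
  ((show IsTangle 1 3 [cup 1] by simp [IsTangle, Piece.ins, Piece.outs]).append
    (isTangle_shift_one hL (by omega))).append (by simp [IsTangle, Piece.ins, Piece.outs])

theorem isTangle_halfTurn' {L : Diagram} (hL : IsTangle 1 1 L) : IsTangle 1 1 (halfTurn' L) :=
  ((show IsTangle 1 3 [cup 0] by simp [IsTangle, Piece.ins, Piece.outs]).append
    (isTangle_shift_one hL (by omega))).append (by simp [IsTangle, Piece.ins, Piece.outs])

theorem isTangle_cup {i m : ℕ} (h : i ≤ m) : IsTangle m (m + 2) [cup i] := by
  simpa [IsTangle, Piece.ins, Piece.outs] using h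

theorem isTangle_cap {i m : ℕ} (h : i ≤ m) : IsTangle (m + 2) m [cap i] := by
  simpa [IsTangle, Piece.ins, Piece.outs] using h

theorem isTangle_cross {c : Crossing} {i m : ℕ} (h : i + 2 ≤ m) : IsTangle m m [cross c i] := by
  simp [IsTangle, Piece.ins, Piece.outs]
  omega

theorem cap_cap : TEq 4 0 [cap 0, cap 0] [cap 2, cap 0] :=
  TEq.of_move (LocalMove.exchange 0 0 .cap .cap) (by simp [IsTangle, Piece.ins, Piece.outs])
    (by simp [IsTangle, Piece.ins, Piece.outs])

theorem cup_cup : TEq 0 4 [cup 0, cup 2] [cup 0, cup 0] :=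
  TEq.of_move (LocalMove.exchange 0 0 .cup .cup) (by simp [IsTangle, Piece.ins, Piece.outs])
    (by simp [IsTangle, Piece.ins, Piece.outs])

theorem zigzag_left {i m : ℕ} (h : i < m) : TEq m m [cup i, cap (i + 1)] [] :=
  TEq.of_move (LocalMove.zigzagLeft i)
    (by simp [IsTangle, Piece.ins, Piece.outs]; omega) rfl

theorem zigzag_right {i m : ℕ} (h : i < m) : TEq m m [cup (i + 1), cap i] [] :=
  TEq.of_move (LocalMove.zigzagRight i)
    (by simp [IsTangle, Piece.ins, Piece.outs]; omega) rfl

/-- The two maxima exchange their heights, the tangle moves past the one that does not touch it, and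
the remaining zigzag is straightened. The same argument gives the other three passages across an
extremum. -/
theorem halfTurn_cap {L : Diagram} (hL : IsTangle 1 1 L) :
    TEq 2 0 (halfTurn L ++ [cap 0]) (shift 1 L ++ [cap 0]) := by
  have h1 := TEq.append_left (k := 2) ((isTangle_cup (i := 1) (m := 2) (by omega)).append
    (isTangle_shift_one hL (j := 1) (by omega))) cap_cap
  have h2 := TEq.congr (k := 2) (l := 0) (A := [cup 1]) (B := [cap 0])
    (isTangle_cup (i := 1) (m := 2) (by omega))
    (pass_left hL (isTangle_cap (i := 0) (m := 0) le_rfl) (i := 2) (j := 1) (m := 0) (by omega))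
    (isTangle_cap (i := 0) (m := 0) le_rfl)
  have h3 := (zigzag_left (i := 1) (m := 2) (by omega)).append_right (l := 0)
    (B := shift 1 L ++ [cap 0])
    ((isTangle_shift_one hL (by omega)).append (isTangle_cap (i := 0) (m := 0) le_rfl))
  simp only [halfTurn]
  refine (TEq.of_eq (by simp)).trans (h1.trans ((TEq.of_eq (by simp)).trans
    (h2.trans ((TEq.of_eq (by simp)).trans (h3.trans (TEq.of_eq (by simp)))))))

theorem halfTurn'_cap {L : Diagram} (hL : IsTangle 1 1 L) :
    TEq 2 0 (shift 1 (halfTurn' L) ++ [cap 0]) (L ++ [cap 0]) := by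
  have h1 := TEq.append_left (k := 2) ((isTangle_cup (i := 1) (m := 2) (by omega)).append
    (isTangle_shift_one hL (j := 2) (by omega))) cap_cap.symm
  have h2 := TEq.congr (k := 2) (l := 0) (A := [cup 1]) (B := [cap 0])
    (isTangle_cup (i := 1) (m := 2) (by omega))
    (pass_right hL (isTangle_cap (i := 0) (m := 0) le_rfl) (i := 0) (g := 0) (m := 2) (by omega))
    (isTangle_cap (i := 0) (m := 0) le_rfl)
  have h3 := (zigzag_right (i := 0) (m := 2) (by omega)).append_right (l := 0)
    (B := L ++ [cap 0]) ((hL.widen_right 1).append (isTangle_cap (i := 0) (m := 0) le_rfl))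
  simp only [halfTurn']
  refine (TEq.of_eq (by simp [shift_shift])).trans (h1.trans ((TEq.of_eq (by simp)).trans
    (h2.trans ((TEq.of_eq (by simp)).trans (h3.trans (TEq.of_eq (by simp)))))))

theorem cup_halfTurn' {L : Diagram} (hL : IsTangle 1 1 L) :
    TEq 0 2 ([cup 0] ++ halfTurn' L) ([cup 0] ++ shift 1 L) := by
  have h1 := TEq.append_right (l := 2) (B := shift 1 L ++ [cap 1]) cup_cup.symm
    ((isTangle_shift_one hL (by omega)).append (isTangle_cap (i := 1) (m := 2) (by omega)))
  have h2 := TEq.congr (k := 0) (l := 2) (A := [cup 0]) (B := [cap 1])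
    (isTangle_cup (i := 0) (m := 0) (by omega))
    (pass_left hL (isTangle_cup (i := 0) (m := 0) le_rfl) (i := 2) (j := 1) (m := 0)
      (by omega)).symm (isTangle_cap (i := 1) (m := 2) (by omega))
  have h3 := (zigzag_right (i := 1) (m := 2) (by omega)).append_left (k := 0)
    (A := [cup 0] ++ shift 1 L)
    ((isTangle_cup (i := 0) (m := 0) le_rfl).append (isTangle_shift_one hL (by omega)))
  simp only [halfTurn']
  refine (TEq.of_eq (by simp)).trans (h1.trans ((TEq.of_eq (by simp)).trans
    (h2.trans ((TEq.of_eq (by simp)).trans (h3.trans (TEq.of_eq (by simp)))))))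

theorem cup_halfTurn {L : Diagram} (hL : IsTangle 1 1 L) :
    TEq 0 2 ([cup 0] ++ shift 1 (halfTurn L)) ([cup 0] ++ L) := by
  have h1 := TEq.append_right (l := 2) (B := shift 2 L ++ [cap 1]) cup_cup
    ((isTangle_shift_one hL (by omega)).append (isTangle_cap (i := 1) (m := 2) (by omega)))
  have h2 := TEq.congr (k := 0) (l := 2) (A := [cup 0]) (B := [cap 1])
    (isTangle_cup (i := 0) (m := 0) (by omega))
    (pass_right hL (isTangle_cup (i := 0) (m := 0) le_rfl) (i := 0) (g := 0) (m := 2)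
      (by omega)).symm (isTangle_cap (i := 1) (m := 2) (by omega))
  have h3 := (zigzag_left (i := 0) (m := 2) (by omega)).append_left (k := 0)
    (A := [cup 0] ++ L)
    ((isTangle_cup (i := 0) (m := 0) le_rfl).append (hL.widen_right 1))
  simp only [halfTurn]
  refine (TEq.of_eq (by simp [shift_shift])).trans (h1.trans ((TEq.of_eq (by simp)).trans
    (h2.trans ((TEq.of_eq (by simp)).trans (h3.trans (TEq.of_eq (by simp)))))))

theorem closure_shift {K : Diagram} (hK : IsTangle 1 1 K) :
    Equivalent (closure K) (closure (shift 1 K)) :=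
  Relation.EqvGen.rel _ _ (Step.sphere K hK)

/-- Passing the maximum undoes the half turn but puts the tangle on the other leg of the closing
arc; the sphere move brings it back. -/
theorem closure_halfTurn {L : Diagram} (hL : IsTangle 1 1 L) :
    Equivalent (closure (halfTurn L)) (closure L) := by
  have := ((halfTurn_cap hL).append_left (isTangle_cup (i := 0) (m := 0) le_rfl)).equivalent
  simp only [← List.append_assoc] at this
  exact this.trans (closure_shift hL).symm

theorem closure_halfTurn' {L : Diagram} (hL : IsTangle 1 1 L) :
    Equivalent (closure (halfTurn' L)) (closure L) := by
  have := ((halfTurn'_cap hL).append_left (isTangle_cup (i := 0) (m := 0) le_rfl)).equivalent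
  simp only [← List.append_assoc] at this
  exact (closure_shift (isTangle_halfTurn' hL)).trans this

theorem slide_up {c : Crossing} {L : Diagram} (hL : IsTangle 1 1 L) {i m : ℕ} (h : i + 2 ≤ m) :
    TEq m m (shift i L ++ [cross c i]) ([cross c i] ++ shift (i + 1) L) :=
  TEq.of_move (LocalMove.slideUp i c L hL)
    ((isTangle_shift_one hL (by omega)).append (isTangle_cross h))
    ((isTangle_cross h).append (isTangle_shift_one hL (by omega)))

theorem slide_down {c : Crossing} {L : Diagram} (hL : IsTangle 1 1 L) {i m : ℕ} (h : i + 2 ≤ m) :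
    TEq m m (shift (i + 1) L ++ [cross c i]) ([cross c i] ++ shift i L) :=
  TEq.of_move (LocalMove.slideDown i c L hL)
    ((isTangle_shift_one hL (by omega)).append (isTangle_cross h))
    ((isTangle_cross h).append (isTangle_shift_one hL (by omega)))

/-- An inserted tangle slides up past a slice, unless it sits below a local maximum. -/
theorem slice_up {x : Slice} {m n : ℕ} (hx : IsTangle m n [x]) {j : ℕ} (hj : j < m)
    (h : ¬ (x.piece = .cap ∧ (j = x.pos ∨ j = x.pos + 1))) :
    ∃ j' < n, ∀ L, IsTangle 1 1 L → TEq m n (shift j L ++ [x]) ([x] ++ shift j' L) := by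
  obtain ⟨i, x⟩ := x
  obtain ⟨h1, h2⟩ := isTangle_singleton.1 hx
  simp only at h1 h2 h
  obtain ⟨g, rfl⟩ := Nat.exists_eq_add_of_le h1
  have hn : n = i + x.outs + g := by omega
  subst hn
  have h0 : IsTangle x.ins x.outs [⟨0, x⟩] := ⟨by simp, by simp [IsTangle]⟩
  rcases lt_or_ge j i with hji | hij
  · exact ⟨j, by omega, fun L hL => by simpa using pass_left hL h0 (m := g) hji⟩
  rcases lt_or_ge j (i + x.ins) with hj1 | hj1
  · rcases x with _ | _ | c
    · simp [Piece.ins] at hj1; omega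
    · simp [Piece.ins] at hj1; simp at h; omega
    · simp only [Piece.ins, Piece.outs] at *
      rcases (show j = i ∨ j = i + 1 by omega) with rfl | rfl
      · exact ⟨j + 1, by omega, fun L hL => slide_up hL (by omega)⟩
      · exact ⟨i, by omega, fun L hL => slide_down hL (by omega)⟩
  · obtain ⟨d, rfl⟩ := Nat.exists_eq_add_of_le hj1
    exact ⟨i + x.outs + d, by omega, fun L hL => by
      simpa using pass_right hL h0 (i := i) (g := d) (m := g) (by omega)⟩

/-- An inserted tangle slides down past a slice, unless it sits above a local minimum. -/
theorem slice_down {x : Slice} {m n : ℕ} (hx : IsTangle m n [x]) {j : ℕ} (hj : j < n)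
    (h : ¬ (x.piece = .cup ∧ (j = x.pos ∨ j = x.pos + 1))) :
    ∃ j' < m, ∀ L, IsTangle 1 1 L → TEq m n ([x] ++ shift j L) (shift j' L ++ [x]) := by
  obtain ⟨i, x⟩ := x
  obtain ⟨h1, h2⟩ := isTangle_singleton.1 hx
  simp only at h1 h2 h
  obtain ⟨g, rfl⟩ := Nat.exists_eq_add_of_le h1
  have hn : n = i + x.outs + g := by omega
  subst hn
  have h0 : IsTangle x.ins x.outs [⟨0, x⟩] := ⟨by simp, by simp [IsTangle]⟩
  rcases lt_or_ge j i with hji | hij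
  · exact ⟨j, by omega, fun L hL => by simpa using (pass_left hL h0 (m := g) hji).symm⟩
  rcases lt_or_ge j (i + x.outs) with hj1 | hj1
  · rcases x with _ | _ | c
    · simp [Piece.outs] at hj1; simp at h; omega
    · simp [Piece.outs] at hj1; omega
    · simp only [Piece.ins, Piece.outs] at *
      rcases (show j = i ∨ j = i + 1 by omega) with rfl | rfl
      · exact ⟨j + 1, by omega, fun L hL => (slide_down hL (by omega)).symm⟩
      · exact ⟨i, by omega, fun L hL => (slide_up hL (by omega)).symm⟩
  · obtain ⟨d, rfl⟩ := Nat.exists_eq_add_of_le hj1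
    exact ⟨i + x.ins + d, by omega, fun L hL => by
      simpa using (pass_right hL h0 (i := i) (g := d) (m := g) (by omega)).symm⟩

/-! ### Inserting a tangle into an unknotted strand -/

/-- Two `1`-`1` tangles with equivalent closures. -/
def SameClosure (L' L : Diagram) : Prop := IsTangle 1 1 L' ∧ Equivalent (closure L') (closure L)

/-- Inserting a `1`-`1` tangle anywhere in `r` is the same as inserting it, perhaps turned,
somewhere in `r'`. -/
def Transfers (m n : ℕ) (r r' : Diagram) : Prop :=
  ∀ (A B : Diagram) (k j : ℕ) (L : Diagram), r = A ++ B → IsTangle m k A → IsTangle k n B → j < k →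
    IsTangle 1 1 L → ∃ (A' B' : Diagram) (k' j' : ℕ) (L' : Diagram), r' = A' ++ B' ∧
      IsTangle m k' A' ∧ IsTangle k' n B' ∧ j' < k' ∧ SameClosure L' L ∧
      TEq m n (A ++ shift j L ++ B) (A' ++ shift j' L' ++ B')

/-- An insertion in `r` can be moved to one of the ends of `r`. -/
def MovesOut (m n : ℕ) (r A B : Diagram) (j : ℕ) (L : Diagram) : Prop :=
  ∃ L', SameClosure L' L ∧
    ((∃ j' < m, TEq m n (A ++ shift j L ++ B) (shift j' L' ++ r)) ∨
      ∃ j' < n, TEq m n (A ++ shift j L ++ B) (r ++ shift j' L'))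

theorem SameClosure.refl {L : Diagram} (hL : IsTangle 1 1 L) : SameClosure L L :=
  ⟨hL, Equivalent.refl _⟩

theorem SameClosure.trans {L L' L'' : Diagram} (h : SameClosure L L') (h' : SameClosure L' L'') :
    SameClosure L L'' :=
  ⟨h.1, h.2.trans h'.2⟩

/-- Once the insertion has left `r`, the move from `r` to `r'` can be made without touching it. -/
theorem transfers_of_movesOut {m n : ℕ} {r r' : Diagram} (hr : IsTangle m n r) (h : TEq m n r r')
    (H : ∀ (A B : Diagram) (k j : ℕ) (L : Diagram), r = A ++ B → A ≠ [] → B ≠ [] →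
      IsTangle m k A → IsTangle k n B → j < k → IsTangle 1 1 L → MovesOut m n r A B j L) :
    Transfers m n r r' := by
  intro A B k j L e hA hB hj hL
  have hr' := h.isTangle.1 hr
  have key : MovesOut m n r A B j L := by
    by_cases hA0 : A = []
    · subst hA0
      simp only [List.nil_append] at e
      subst e
      obtain rfl : m = k := hA
      exact ⟨L, .refl hL, Or.inl ⟨j, hj, by simpa using TEq.refl _⟩⟩
    by_cases hB0 : B = []
    · subst hB0
      simp only [List.append_nil] at e
      subst e
      obtain rfl : k = n := hB
      exact ⟨L, .refl hL, Or.inr ⟨j, hj, by simpa using TEq.refl _⟩⟩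
    exact H A B k j L e hA0 hB0 hA hB hj hL
  obtain ⟨L', hL', ⟨j', hj', h1⟩ | ⟨j', hj', h1⟩⟩ := key
  · exact ⟨[], r', m, j', L', rfl, rfl, hr', hj', hL',
      by simpa using h1.trans (h.append_left (isTangle_shift_one hL'.1 hj'))⟩
  · exact ⟨r', [], n, j', L', by simp, hr', rfl, hj', hL',
      by simpa using h1.trans (h.append_right (isTangle_shift_one hL'.1 hj'))⟩

theorem movesOut_down {m n k : ℕ} {x : Slice} {B : Diagram} (hA : IsTangle m k [x])
    (hB : IsTangle k n B) {j : ℕ} (hj : j < k) {L : Diagram} (hL : IsTangle 1 1 L)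
    (h : ¬ (x.piece = .cup ∧ (j = x.pos ∨ j = x.pos + 1))) :
    MovesOut m n ([x] ++ B) [x] B j L := by
  obtain ⟨j', hj', H⟩ := slice_down hA hj h
  exact ⟨L, .refl hL, Or.inl ⟨j', hj', by simpa using (H L hL).append_right hB⟩⟩

theorem movesOut_up {m n k : ℕ} {x : Slice} {A : Diagram} (hA : IsTangle m k A)
    (hB : IsTangle k n [x]) {j : ℕ} (hj : j < k) {L : Diagram} (hL : IsTangle 1 1 L)
    (h : ¬ (x.piece = .cap ∧ (j = x.pos ∨ j = x.pos + 1))) :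
    MovesOut m n (A ++ [x]) A [x] j L := by
  obtain ⟨j', hj', H⟩ := slice_up hB hj h
  exact ⟨L, .refl hL, Or.inr ⟨j', hj', by simpa using (H L hL).append_left hA⟩⟩

theorem split_two {x y : Slice} {A B : Diagram} (h : [x, y] = A ++ B) (hA : A ≠ []) (hB : B ≠ []) :
    A = [x] ∧ B = [y] := by
  rcases A with _ | ⟨a, _ | ⟨b, A⟩⟩
  · simp at hA
  · simp_all
  · simp only [List.cons_append, List.cons.injEq] at h
    exact absurd (List.append_eq_nil_iff.1 h.2.2.symm).2 hB

theorem split_three {x y z : Slice} {A B : Diagram} (h : [x, y, z] = A ++ B) (hA : A ≠ [])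
    (hB : B ≠ []) : A = [x] ∧ B = [y, z] ∨ A = [x, y] ∧ B = [z] := by
  rcases A with _ | ⟨a, A⟩
  · simp at hA
  · simp only [List.cons_append, List.cons.injEq] at h
    obtain ⟨rfl, h⟩ := h
    rcases eq_or_ne A [] with rfl | hA'
    · left; simp_all
    · obtain ⟨rfl, rfl⟩ := split_two h hA' hB
      exact Or.inr ⟨rfl, rfl⟩

/-- Only a leg of a minimum blocks the way down and only a leg of a maximum blocks the way up. If no
strand is both, one of the two ways is open. -/
theorem movesOut_two {m n : ℕ} {x y : Slice}
    (h : ∀ j, ¬ ((x.piece = .cup ∧ (j = x.pos ∨ j = x.pos + 1)) ∧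
      (y.piece = .cap ∧ (j = y.pos ∨ j = y.pos + 1)))) (A B : Diagram) (k j : ℕ) (L : Diagram)
    (e : [x, y] = A ++ B) (hA0 : A ≠ []) (hB0 : B ≠ []) (hA : IsTangle m k A)
    (hB : IsTangle k n B) (hj : j < k) (hL : IsTangle 1 1 L) : MovesOut m n [x, y] A B j L := by
  obtain ⟨rfl, rfl⟩ := split_two e hA0 hB0
  by_cases hx : x.piece = .cup ∧ (j = x.pos ∨ j = x.pos + 1)
  · exact movesOut_up hA hB hj hL fun hy => h j ⟨hx, hy⟩
  · exact movesOut_down hA hB hj hL hx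

/-- An insertion moves from the left to the right leg of a local minimum. -/
theorem cup_left_to_right {L : Diagram} (hL : IsTangle 1 1 L) : ∃ L', SameClosure L' L ∧
    ∀ i m, i ≤ m → TEq m (m + 2) ([cup i] ++ shift i L) ([cup i] ++ shift (i + 1) L') := by
  refine ⟨halfTurn L, ⟨isTangle_halfTurn hL, closure_halfTurn hL⟩, fun i m h => ?_⟩
  obtain ⟨k, rfl⟩ := Nat.exists_eq_add_of_le h
  have := ((cup_halfTurn hL).widen i k).symm
  simp only [shift_append, shift_shift] at this
  rwa [show i + 2 + k = i + k + 2 by omega] at this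

theorem cup_right_to_left {L : Diagram} (hL : IsTangle 1 1 L) : ∃ L', SameClosure L' L ∧
    ∀ i m, i ≤ m → TEq m (m + 2) ([cup i] ++ shift (i + 1) L) ([cup i] ++ shift i L') := by
  refine ⟨halfTurn' L, ⟨isTangle_halfTurn' hL, closure_halfTurn' hL⟩, fun i m h => ?_⟩
  obtain ⟨k, rfl⟩ := Nat.exists_eq_add_of_le h
  have := ((cup_halfTurn' hL).widen i k).symm
  simp only [shift_append, shift_shift] at this
  rwa [show i + 2 + k = i + k + 2 by omega] at this

theorem cap_left_to_right {L : Diagram} (hL : IsTangle 1 1 L) : ∃ L', SameClosure L' L ∧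
    ∀ i m, i ≤ m → TEq (m + 2) m (shift i L ++ [cap i]) (shift (i + 1) L' ++ [cap i]) := by
  refine ⟨halfTurn' L, ⟨isTangle_halfTurn' hL, closure_halfTurn' hL⟩, fun i m h => ?_⟩
  obtain ⟨k, rfl⟩ := Nat.exists_eq_add_of_le h
  have := ((halfTurn'_cap hL).widen i k).symm
  simp only [shift_append, shift_shift] at this
  rwa [show i + 2 + k = i + k + 2 by omega] at this

theorem cap_right_to_left {L : Diagram} (hL : IsTangle 1 1 L) : ∃ L', SameClosure L' L ∧
    ∀ i m, i ≤ m → TEq (m + 2) m (shift (i + 1) L ++ [cap i]) (shift i L' ++ [cap i]) := by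
  refine ⟨halfTurn L, ⟨isTangle_halfTurn hL, closure_halfTurn hL⟩, fun i m h => ?_⟩
  obtain ⟨k, rfl⟩ := Nat.exists_eq_add_of_le h
  have := ((halfTurn_cap hL).widen i k).symm
  simp only [shift_append, shift_shift] at this
  rwa [show i + 2 + k = i + k + 2 by omega] at this

theorem MovesOut.congr {m n : ℕ} {r A B A' B' L L' : Diagram} {j j' : ℕ}
    (h : TEq m n (A ++ shift j L ++ B) (A' ++ shift j' L' ++ B')) (hL : SameClosure L' L)
    (H : MovesOut m n r A' B' j' L') : MovesOut m n r A B j L := by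
  obtain ⟨L'', h1, ⟨j'', hj, h2⟩ | ⟨j'', hj, h2⟩⟩ := H
  · exact ⟨L'', h1.trans hL, Or.inl ⟨j'', hj, h.trans h2⟩⟩
  · exact ⟨L'', h1.trans hL, Or.inr ⟨j'', hj, h.trans h2⟩⟩

theorem movesOut_zigzagLeft {m n i : ℕ} (A B : Diagram) (k j : ℕ) (L : Diagram)
    (e : [cup i, cap (i + 1)] = A ++ B) (hA0 : A ≠ []) (hB0 : B ≠ []) (hA : IsTangle m k A)
    (hB : IsTangle k n B) (hj : j < k) (hL : IsTangle 1 1 L) :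
    MovesOut m n [cup i, cap (i + 1)] A B j L := by
  obtain ⟨rfl, rfl⟩ := split_two e hA0 hB0
  by_cases hx : j = i ∨ j = i + 1
  · by_cases hy : j = i
    · exact movesOut_up hA hB hj hL (by simp; omega)
    · obtain rfl : j = i + 1 := by omega
      obtain ⟨h1, h2⟩ := isTangle_singleton.1 hA
      simp only [Piece.ins, Piece.outs] at h1 h2
      obtain rfl : k = m + 2 := by omega
      -- The middle strand is blocked in both directions. Passing across the minimum to its other
      -- leg frees the insertion, at the price of a half turn.
      obtain ⟨L', hL', H⟩ := cup_right_to_left hL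
      exact MovesOut.congr ((H i m (by omega)).append_right hB) hL'
        (movesOut_up hA hB (by omega) hL'.1 (by simp; omega))
  · exact movesOut_down hA hB hj hL (by simpa using hx)

theorem movesOut_zigzagRight {m n i : ℕ} (A B : Diagram) (k j : ℕ) (L : Diagram)
    (e : [cup (i + 1), cap i] = A ++ B) (hA0 : A ≠ []) (hB0 : B ≠ []) (hA : IsTangle m k A)
    (hB : IsTangle k n B) (hj : j < k) (hL : IsTangle 1 1 L) :
    MovesOut m n [cup (i + 1), cap i] A B j L := by
  obtain ⟨rfl, rfl⟩ := split_two e hA0 hB0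
  by_cases hx : j = i + 1 ∨ j = i + 2
  · by_cases hy : j = i + 2
    · exact movesOut_up hA hB hj hL (by simp; omega)
    · obtain rfl : j = i + 1 := by omega
      obtain ⟨h1, h2⟩ := isTangle_singleton.1 hA
      simp only [Piece.ins, Piece.outs] at h1 h2
      obtain rfl : k = m + 2 := by omega
      obtain ⟨L', hL', H⟩ := cup_left_to_right hL
      exact MovesOut.congr ((H (i + 1) m (by omega)).append_right hB) hL'
        (movesOut_up hA hB (by omega) hL'.1 (by simp; omega))
  · exact movesOut_down hA hB hj hL (by simpa using hx)

/-- An insertion on the loop follows the strand through the crossing and thereby reaches the arc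
that enters or leaves the loop. On the outer leg of the loop it first passes across the extremum. -/
theorem movesOut_oneRight {m n i : ℕ} {c : Crossing} (A B : Diagram) (k j : ℕ) (L : Diagram)
    (e : [cup (i + 1), cross c i, cap (i + 1)] = A ++ B) (hA0 : A ≠ []) (hB0 : B ≠ [])
    (hA : IsTangle m k A) (hB : IsTangle k n B) (hj : j < k) (hL : IsTangle 1 1 L) :
    MovesOut m n [cup (i + 1), cross c i, cap (i + 1)] A B j L := by
  have hT := hA.append hB
  rw [← e] at hT
  have h1 := hT.1
  have h2 := hT.2.2.2
  simp only [Piece.ins, Piece.outs, IsTangle] at h1 h2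
  obtain rfl : m = n := by omega
  have hcup : IsTangle m (m + 2) [cup (i + 1)] := isTangle_cup (by omega)
  have hcross : IsTangle (m + 2) (m + 2) [cross c i] := isTangle_cross (by omega)
  have hcap : IsTangle (m + 2) m [cap (i + 1)] := isTangle_cap (by omega)
  -- the arc that enters at the bottom, and the one that leaves at the top
  have low : ∀ L, IsTangle 1 1 L → ∀ j < m + 2, j ≠ i + 1 → j ≠ i + 2 →
      MovesOut m m [cup (i + 1), cross c i, cap (i + 1)] [cup (i + 1)]
        [cross c i, cap (i + 1)] j L := fun L hL j hj h3 h4 =>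
    movesOut_down hcup (hcross.append hcap) hj hL (by simp; omega)
  have high : ∀ L, IsTangle 1 1 L → ∀ j < m + 2, j ≠ i + 1 → j ≠ i + 2 →
      MovesOut m m [cup (i + 1), cross c i, cap (i + 1)] [cup (i + 1), cross c i]
        [cap (i + 1)] j L := fun L hL j hj h3 h4 =>
    movesOut_up (hcup.append hcross) hcap hj hL (by simp; omega)
  have highMid : ∀ L, IsTangle 1 1 L →
      MovesOut m m [cup (i + 1), cross c i, cap (i + 1)] [cup (i + 1), cross c i]
        [cap (i + 1)] (i + 1) L := fun L hL =>
    MovesOut.congr (by simpa using TEq.congr hcup (slide_up (c := c) (i := i) hL (by omega)).symm hcap)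
      (.refl hL) (low L hL i (by omega) (by omega) (by omega))
  have highRight : ∀ L, IsTangle 1 1 L →
      MovesOut m m [cup (i + 1), cross c i, cap (i + 1)] [cup (i + 1), cross c i]
        [cap (i + 1)] (i + 2) L := fun L hL => by
    obtain ⟨L', hL', H⟩ := cap_right_to_left hL
    exact MovesOut.congr (by
      simpa using (H (i + 1) m (by omega)).append_left (hcup.append hcross)) hL' (highMid L' hL'.1)
  have lowMid : ∀ L, IsTangle 1 1 L →
      MovesOut m m [cup (i + 1), cross c i, cap (i + 1)] [cup (i + 1)]
        [cross c i, cap (i + 1)] (i + 1) L := fun L hL =>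
    MovesOut.congr (by simpa using TEq.congr hcup (slide_down (c := c) (i := i) hL (by omega)) hcap)
      (.refl hL) (high L hL i (by omega) (by omega) (by omega))
  have lowRight : ∀ L, IsTangle 1 1 L →
      MovesOut m m [cup (i + 1), cross c i, cap (i + 1)] [cup (i + 1)]
        [cross c i, cap (i + 1)] (i + 2) L := fun L hL => by
    obtain ⟨L', hL', H⟩ := cup_right_to_left hL
    exact MovesOut.congr (by
      simpa using (H (i + 1) m (by omega)).append_right (hcross.append hcap)) hL' (lowMid L' hL'.1)
  rcases split_three e hA0 hB0 with ⟨rfl, rfl⟩ | ⟨rfl, rfl⟩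
  · obtain rfl := hA.unique hcup
    by_cases h3 : j = i + 1
    · exact h3 ▸ lowMid L hL
    by_cases h4 : j = i + 2
    · exact h4 ▸ lowRight L hL
    exact low L hL j hj h3 h4
  · obtain rfl := hA.unique (hcup.append hcross)
    by_cases h3 : j = i + 1
    · exact h3 ▸ highMid L hL
    by_cases h4 : j = i + 2
    · exact h4 ▸ highRight L hL
    exact high L hL j hj h3 h4

theorem movesOut_oneLeft {m n i : ℕ} {c : Crossing} (A B : Diagram) (k j : ℕ) (L : Diagram)
    (e : [cup i, cross c (i + 1), cap i] = A ++ B) (hA0 : A ≠ []) (hB0 : B ≠ [])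
    (hA : IsTangle m k A) (hB : IsTangle k n B) (hj : j < k) (hL : IsTangle 1 1 L) :
    MovesOut m n [cup i, cross c (i + 1), cap i] A B j L := by
  have hT := hA.append hB
  rw [← e] at hT
  have h1 := hT.2.1
  have h2 := hT.2.2.2
  simp only [Piece.ins, Piece.outs, IsTangle] at h1 h2
  obtain rfl : m = n := by omega
  have hcup : IsTangle m (m + 2) [cup i] := isTangle_cup (by omega)
  have hcross : IsTangle (m + 2) (m + 2) [cross c (i + 1)] := isTangle_cross (by omega)
  have hcap : IsTangle (m + 2) m [cap i] := isTangle_cap (by omega)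
  have low : ∀ L, IsTangle 1 1 L → ∀ j < m + 2, j ≠ i → j ≠ i + 1 →
      MovesOut m m [cup i, cross c (i + 1), cap i] [cup i]
        [cross c (i + 1), cap i] j L := fun L hL j hj h3 h4 =>
    movesOut_down hcup (hcross.append hcap) hj hL (by simp; omega)
  have high : ∀ L, IsTangle 1 1 L → ∀ j < m + 2, j ≠ i → j ≠ i + 1 →
      MovesOut m m [cup i, cross c (i + 1), cap i] [cup i, cross c (i + 1)]
        [cap i] j L := fun L hL j hj h3 h4 =>
    movesOut_up (hcup.append hcross) hcap hj hL (by simp; omega)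
  have highMid : ∀ L, IsTangle 1 1 L →
      MovesOut m m [cup i, cross c (i + 1), cap i] [cup i, cross c (i + 1)]
        [cap i] (i + 1) L := fun L hL =>
    MovesOut.congr
      (by simpa using TEq.congr hcup (slide_down (c := c) (i := i + 1) hL (by omega)).symm hcap)
      (.refl hL) (low L hL (i + 1 + 1) (by omega) (by omega) (by omega))
  have highLeft : ∀ L, IsTangle 1 1 L →
      MovesOut m m [cup i, cross c (i + 1), cap i] [cup i, cross c (i + 1)]
        [cap i] i L := fun L hL => by
    obtain ⟨L', hL', H⟩ := cap_left_to_right hL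
    exact MovesOut.congr (by
      simpa using (H i m (by omega)).append_left (hcup.append hcross)) hL' (highMid L' hL'.1)
  have lowMid : ∀ L, IsTangle 1 1 L →
      MovesOut m m [cup i, cross c (i + 1), cap i] [cup i]
        [cross c (i + 1), cap i] (i + 1) L := fun L hL =>
    MovesOut.congr
      (by simpa using TEq.congr hcup (slide_up (c := c) (i := i + 1) hL (by omega)) hcap)
      (.refl hL) (high L hL (i + 1 + 1) (by omega) (by omega) (by omega))
  have lowLeft : ∀ L, IsTangle 1 1 L →
      MovesOut m m [cup i, cross c (i + 1), cap i] [cup i]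
        [cross c (i + 1), cap i] i L := fun L hL => by
    obtain ⟨L', hL', H⟩ := cup_left_to_right hL
    exact MovesOut.congr (by
      simpa using (H i m (by omega)).append_right (hcross.append hcap)) hL' (lowMid L' hL'.1)
  rcases split_three e hA0 hB0 with ⟨rfl, rfl⟩ | ⟨rfl, rfl⟩
  · obtain rfl := hA.unique hcup
    by_cases h3 : j = i
    · exact h3 ▸ lowLeft L hL
    by_cases h4 : j = i + 1
    · exact h4 ▸ lowMid L hL
    exact low L hL j hj h3 h4
  · obtain rfl := hA.unique (hcup.append hcross)
    by_cases h3 : j = i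
    · exact h3 ▸ highLeft L hL
    by_cases h4 : j = i + 1
    · exact h4 ▸ highMid L hL
    exact high L hL j hj h3 h4

theorem movesOut_three {m n i i' i'' : ℕ} {a b c : Crossing} (A B : Diagram) (k j : ℕ) (L : Diagram)
    (e : [cross a i, cross b i', cross c i''] = A ++ B) (hA0 : A ≠ []) (hB0 : B ≠ [])
    (hA : IsTangle m k A) (hB : IsTangle k n B) (hj : j < k) (hL : IsTangle 1 1 L) :
    MovesOut m n [cross a i, cross b i', cross c i''] A B j L := by
  rcases split_three e hA0 hB0 with ⟨rfl, rfl⟩ | ⟨rfl, rfl⟩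
  · exact movesOut_down hA hB hj hL (by simp)
  · exact movesOut_up hA hB hj hL (by simp)

/-- Insertions next to or inside a tangle `shift i K`. -/
theorem insert_beside {m k n i j : ℕ} {A B L : Diagram} (hA : IsTangle m k (shift i A))
    (hB : IsTangle k n (shift i B)) {p q r : ℕ} (hA' : IsTangle p q A) (hB' : IsTangle q r B)
    (hip : i + p ≤ m) (hj : j < k) (hL : IsTangle 1 1 L) :
    (∃ d < q, j = i + d) ∨ ((∃ j' < m, ∀ C, C = shift i B →
      TEq m n (shift i A ++ shift j L ++ C) (shift j' L ++ (shift i A ++ C))) ∧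
      ∃ j' < n, TEq m n (shift i A ++ shift j L ++ shift i B)
        (shift i A ++ shift i B ++ shift j' L)) := by
  obtain ⟨g, rfl⟩ := Nat.exists_eq_add_of_le hip
  obtain rfl := hA.unique (hA'.widen i g)
  obtain rfl := hB.unique (hB'.widen i g)
  rcases lt_or_ge j i with h | h
  · refine Or.inr ⟨⟨j, by omega, ?_⟩, j, by omega, ?_⟩
    · rintro C rfl
      simpa using (pass_left hL hA' (m := g) h).symm.append_right hB
    · simpa using (pass_left hL hB' (m := g) h).append_left hA
  rcases lt_or_ge j (i + q) with h' | h'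
  · exact Or.inl ⟨j - i, by omega, by omega⟩
  · obtain ⟨d, rfl⟩ := Nat.exists_eq_add_of_le h'
    refine Or.inr ⟨⟨i + p + d, by omega, ?_⟩, i + r + d, by omega, ?_⟩
    · rintro C rfl
      simpa using (pass_right hL hA' (i := i) (g := d) (m := g) (by omega)).symm.append_right hB
    · simpa using (pass_right hL hB' (i := i) (g := d) (m := g) (by omega)).append_left hA

theorem shift_eq_append {i : ℕ} {K A B : Diagram} (h : shift i K = A ++ B) :
    ∃ K1 K2, K = K1 ++ K2 ∧ A = shift i K1 ∧ B = shift i K2 := by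
  obtain ⟨K1, K2, h1, h2, h3⟩ := List.map_eq_append_iff.1 h
  exact ⟨K1, K2, h1, h2.symm, h3.symm⟩

/-- An insertion inside `K` turns `K` into another 1-1 tangle, which can make the same slide as a
whole. An insertion elsewhere leaves the region, because the crossing blocks no strand. Here it
matters that slides are allowed for arbitrary `K`. -/
theorem transfers_slide {m : ℕ} {x : Slice} (hx : IsTangle m m [x]) {a b : ℕ} (ha : a < m)
    (hb : b < m) (hxc : x.piece ≠ .cup ∧ x.piece ≠ .cap)
    (H : ∀ K, IsTangle 1 1 K → TEq m m (shift a K ++ [x]) ([x] ++ shift b K)) (K : Diagram)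
    (hK : IsTangle 1 1 K) :
    Transfers m m (shift a K ++ [x]) ([x] ++ shift b K) ∧
      Transfers m m ([x] ++ shift b K) (shift a K ++ [x]) := by
  have ha' := isTangle_shift_one hK ha
  have hb' := isTangle_shift_one hK hb
  have finish : ∀ {X : Diagram} {j' : ℕ} {r' L : Diagram}, IsTangle m m r' → j' < m →
      IsTangle 1 1 L → (∃ r, TEq m m r r' ∧ (TEq m m X (shift j' L ++ r) ∨
        TEq m m X (r ++ shift j' L))) →
      ∃ (A' B' : Diagram) (k' j' : ℕ) (L' : Diagram), r' = A' ++ B' ∧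
      IsTangle m k' A' ∧ IsTangle k' m B' ∧ j' < k' ∧ SameClosure L' L ∧
      TEq m m X (A' ++ shift j' L' ++ B') := by
    rintro X j' r' L hr' hj' hL ⟨r, hr, h | h⟩
    · exact ⟨[], r', m, j', L, rfl, rfl, hr', hj', .refl hL,
        by simpa using h.trans (hr.append_left (isTangle_shift_one hL hj'))⟩
    · exact ⟨r', [], m, j', L, by simp, hr', rfl, hj', .refl hL,
        by simpa using h.trans (hr.append_right (isTangle_shift_one hL hj'))⟩
  constructor
  · intro A B k j L e hA hB hj hL
    rcases List.append_eq_append_iff.1 e with ⟨A', rfl, h2⟩ | ⟨B', h1, rfl⟩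
    · cases A' with
      | nil =>
        simp only [List.nil_append] at h2
        subst h2
        simp only [List.append_nil] at hA ⊢
        obtain rfl := hA.unique ha'
        obtain ⟨j', hj', h⟩ := slice_up hx hj (by simp [hxc.2])
        refine finish (hx.append hb') hj' hL ⟨_, H K hK, Or.inr ?_⟩
        simpa using (h L hL).append_left ha'
      | cons y A' =>
        simp only [List.cons_append, List.cons.injEq] at h2
        obtain ⟨rfl, h2⟩ := h2
        obtain ⟨rfl, rfl⟩ := List.append_eq_nil_iff.1 h2.symm
        obtain rfl : k = m := hB
        refine finish (hx.append hb') hj hL ⟨_, H K hK, Or.inr ?_⟩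
        simpa using TEq.refl _
    · obtain ⟨K1, K2, rfl, rfl, rfl⟩ := shift_eq_append h1
      obtain ⟨q, hK1, hK2⟩ := isTangle_append.1 hK
      obtain ⟨l, hB1, hB2⟩ := isTangle_append.1 hB
      obtain rfl := hB2.unique_left hx
      rcases insert_beside hA hB1 hK1 hK2 (by omega) hj hL with ⟨d, hd, rfl⟩ | ⟨⟨j', hj', h⟩, -⟩
      · have hK' : IsTangle 1 1 (K1 ++ shift d L ++ K2) :=
          (hK1.append (isTangle_shift_one hL hd)).append hK2
        have hKb : IsTangle l (b + q + (l - b - 1)) (shift b K1) := by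
          have := hK1.widen b (l - b - 1)
          rwa [show b + 1 + (l - b - 1) = l by omega] at this
        have hKb2 : IsTangle (b + q + (l - b - 1)) l (shift b K2) := by
          have := hK2.widen b (l - b - 1)
          rwa [show b + 1 + (l - b - 1) = l by omega] at this
        refine ⟨[x] ++ shift b K1, shift b K2, _, b + d, L, by simp, hx.append hKb, hKb2,
          by omega, .refl hL, ?_⟩
        simpa [shift_shift] using H _ hK'
      · refine finish (hx.append hb') hj' hL ⟨_, H _ hK, Or.inl ?_⟩
        simpa using (h _ rfl).append_right hx
  · intro A B k j L e hA hB hj hL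
    cases A with
    | nil =>
      simp only [List.nil_append] at e
      subst e
      obtain rfl : m = k := hA
      refine finish (ha'.append hx) hj hL ⟨_, (H K hK).symm, Or.inl ?_⟩
      simpa using TEq.refl _
    | cons y A =>
      simp only [List.cons_append, List.nil_append, List.cons.injEq] at e
      obtain ⟨rfl, e⟩ := e
      obtain ⟨K1, K2, rfl, rfl, rfl⟩ := shift_eq_append e
      obtain ⟨q, hK1, hK2⟩ := isTangle_append.1 hK
      obtain ⟨l, hA1, hA2⟩ := isTangle_append.1 (show IsTangle m k ([x] ++ shift b K1) from hA)
      obtain rfl := hA1.unique hx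
      rcases insert_beside hA2 hB hK1 hK2 (by omega) hj hL with ⟨d, hd, rfl⟩ | ⟨-, j', hj', h⟩
      · have hK' : IsTangle 1 1 (K1 ++ shift d L ++ K2) :=
          (hK1.append (isTangle_shift_one hL hd)).append hK2
        have hKb : IsTangle l (a + q + (l - a - 1)) (shift a K1) := by
          have := hK1.widen a (l - a - 1)
          rwa [show a + 1 + (l - a - 1) = l by omega] at this
        have hKb2 : IsTangle (a + q + (l - a - 1)) l (shift a K2) := by
          have := hK2.widen a (l - a - 1)
          rwa [show a + 1 + (l - a - 1) = l by omega] at this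
        refine ⟨shift a K1, shift a K2 ++ [x], _, a + d, L, by simp, hKb, hKb2.append hx,
          by omega, .refl hL, ?_⟩
        simpa [shift_shift] using (H _ hK').symm
      · refine finish (ha'.append hx) hj' hL ⟨_, (H _ hK).symm, Or.inr ?_⟩
        simpa using h.append_left hx

theorem movesOut_nil {m n : ℕ} (A B : Diagram) (k j : ℕ) (L : Diagram) (e : [] = A ++ B)
    (hA0 : A ≠ []) (_ : B ≠ []) (_ : IsTangle m k A) (_ : IsTangle k n B) (_ : j < k)
    (_ : IsTangle 1 1 L) : MovesOut m n [] A B j L :=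
  absurd (List.append_eq_nil_iff.1 e.symm).1 hA0

theorem LocalMove.transfers {r r' : Diagram} (h : LocalMove r r') {m n : ℕ} (hr : IsTangle m n r)
    (hr' : IsTangle m n r') : Transfers m n r r' ∧ Transfers m n r' r := by
  have e := TEq.of_move h hr hr'
  cases h with
  | exchange i g x y =>
    refine ⟨transfers_of_movesOut hr e (movesOut_two fun j => ?_),
      transfers_of_movesOut hr' e.symm (movesOut_two fun j => ?_)⟩
    · rintro ⟨⟨hx, h⟩, -, h'⟩
      simp only at hx
      subst hx
      simp only [Piece.outs] at h h'
      omega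
    · rintro ⟨⟨hx, h⟩, hy, h'⟩
      simp only at hy
      subst hy
      simp only [Piece.ins] at h h'
      omega
  | zigzagLeft i =>
    exact ⟨transfers_of_movesOut hr e movesOut_zigzagLeft,
      transfers_of_movesOut hr' e.symm movesOut_nil⟩
  | zigzagRight i =>
    exact ⟨transfers_of_movesOut hr e movesOut_zigzagRight,
      transfers_of_movesOut hr' e.symm movesOut_nil⟩
  | turn i c =>
    exact ⟨transfers_of_movesOut hr e (movesOut_two (by simp)),
      transfers_of_movesOut hr' e.symm (movesOut_two (by simp))⟩
  | oneRight i c hc =>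
    exact ⟨transfers_of_movesOut hr e movesOut_oneRight,
      transfers_of_movesOut hr' e.symm movesOut_nil⟩
  | oneLeft i c hc =>
    exact ⟨transfers_of_movesOut hr e movesOut_oneLeft,
      transfers_of_movesOut hr' e.symm movesOut_nil⟩
  | two i c hc =>
    exact ⟨transfers_of_movesOut hr e (movesOut_two (by simp)),
      transfers_of_movesOut hr' e.symm movesOut_nil⟩
  | three i a b c ha hb hc habc =>
    exact ⟨transfers_of_movesOut hr e movesOut_three,
      transfers_of_movesOut hr' e.symm movesOut_three⟩
  | slideUp i c K hK =>
    have h1 := hr'.1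
    simp only [Piece.ins] at h1
    have hx : IsTangle m m [cross c i] := isTangle_cross h1
    obtain rfl := hr'.unique (hx.append (isTangle_shift_one hK (show i + 1 < m by omega)))
    exact transfers_slide hx (by omega) (by omega) (by simp)
      (fun K hK => slide_up hK h1) K hK
  | slideDown i c K hK =>
    have h1 := hr'.1
    simp only [Piece.ins] at h1
    have hx : IsTangle m m [cross c i] := isTangle_cross h1
    obtain rfl := hr'.unique (hx.append (isTangle_shift_one hK (show i < m by omega)))
    exact transfers_slide hx (by omega) (by omega) (by simp)
      (fun K hK => slide_down hK h1) K hK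

/-- Inserting a `1`-`1` tangle anywhere in `D` yields its closure. -/
def InsertsTrivially (D : Diagram) : Prop :=
  ∀ (A B : Diagram) (m j : ℕ) (L : Diagram), D = A ++ B → IsTangle 0 m A → IsTangle m 0 B → j < m →
    IsTangle 1 1 L → Equivalent (A ++ shift j L ++ B) (closure L)

theorem InsertsTrivially.of_inside {A B r r' : Diagram} {m n : ℕ} (hA : IsTangle 0 m A)
    (hB : IsTangle n 0 B) (hr : IsTangle m n r) (hr' : IsTangle m n r') (e : TEq m n r r')
    (ht : Transfers m n r' r) (h : InsertsTrivially (A ++ r ++ B)) :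
    InsertsTrivially (A ++ r' ++ B) := by
  intro X Y k j L eq hX hY hj hL
  rcases List.append_eq_append_iff.1 eq with ⟨C, rfl, rfl⟩ | ⟨C, eq', rfl⟩
  · -- the insertion is above `r'`
    obtain ⟨l, h1, h2⟩ := isTangle_append.1 hX
    obtain rfl := h1.unique (hA.append hr')
    have h3 := h (A ++ r ++ C) Y k j L (by simp) ((hA.append hr).append h2) hY hj hL
    have h4 := TEq.congr hA e (h2.append ((isTangle_shift_one hL hj).append hY))
    exact Equivalent.trans (by simpa using h4.equivalent.symm) h3
  rcases List.append_eq_append_iff.1 eq' with ⟨C', rfl, rfl⟩ | ⟨C', rfl, rfl⟩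
  · -- the insertion is inside `r'`
    obtain ⟨l, h1, h2⟩ := isTangle_append.1 hX
    obtain rfl := h1.unique hA
    obtain ⟨l', h3, h4⟩ := isTangle_append.1 hY
    obtain rfl := h4.unique_left hB
    obtain ⟨A', B', k', j', L', rfl, hA', hB', hj', hL', h5⟩ := ht C' C k j L rfl h2 h3 hj hL
    have h6 := h (A ++ A') (B' ++ B) k' j' L' (by simp) (h1.append hA') (hB'.append hB) hj' hL'.1
    have h7 := TEq.congr hA h5 hB
    exact Equivalent.trans (by simpa using h7.equivalent) (Equivalent.trans (by simpa using h6) hL'.2)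
  · -- the insertion is below `r'`
    obtain ⟨l, h1, h2⟩ := isTangle_append.1 hA
    obtain rfl := hX.unique h1
    have h3 := h X (C' ++ r ++ B) k j L (by simp) hX ((h2.append hr).append hB) hj hL
    have h4 := TEq.congr (hX.append ((isTangle_shift_one hL hj).append h2)) e hB
    exact Equivalent.trans (by simpa using h4.equivalent.symm) (by simpa using h3)

theorem split_closure {K X Y : Diagram} (e : closure K = X ++ Y) :
    X = [] ∨ Y = [] ∨ ∃ K1 K2, K = K1 ++ K2 ∧ X = [cup 0] ++ K1 ∧ Y = K2 ++ [cap 0] := by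
  cases X with
  | nil => exact Or.inl rfl
  | cons x X =>
    simp only [closure, List.cons_append, List.nil_append, List.cons.injEq] at e
    obtain ⟨rfl, e⟩ := e
    right
    rcases List.append_eq_append_iff.1 e with ⟨C, rfl, h⟩ | ⟨C, rfl, rfl⟩
    · cases C with
      | nil => exact Or.inr ⟨K, [], by simp, by simp, by simpa using h.symm⟩
      | cons y C =>
        simp only [List.cons_append, List.cons.injEq] at h
        exact Or.inl (List.append_eq_nil_iff.1 h.2.symm).2
    · exact Or.inr ⟨X, C, rfl, rfl, rfl⟩

/-- An insertion inside `K` swings around the sphere together with `K`. An insertion on the closing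
arc is first carried down and across the minimum, after which it is part of the swinging tangle. -/
theorem InsertsTrivially.sphere {K : Diagram} (hK : IsTangle 1 1 K) :
    InsertsTrivially (closure K) ↔ InsertsTrivially (closure (shift 1 K)) := by
  have hcup : IsTangle 0 2 [cup 0] := isTangle_cup (m := 0) le_rfl
  have hcap : IsTangle 2 0 [cap 0] := isTangle_cap (m := 0) le_rfl
  constructor
  · intro h X Y m j L e hX hY hj hL
    rcases split_closure e with rfl | rfl | ⟨_, _, e', rfl, rfl⟩
    · obtain rfl : 0 = m := hX
      omega
    · obtain rfl : m = 0 := hY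
      omega
    obtain ⟨K1, K2, rfl, rfl, rfl⟩ := shift_eq_append e'
    obtain ⟨q, hK1, hK2⟩ := isTangle_append.1 hK
    have hK1' : IsTangle 2 (1 + q + 0) (shift 1 K1) := hK1.widen 1 0
    have hK2' : IsTangle (1 + q + 0) 2 (shift 1 K2) := hK2.widen 1 0
    obtain rfl := hX.unique (hcup.append hK1')
    cases j with
    | zero =>
      obtain ⟨L', hL', H⟩ := cup_left_to_right hL
      have h1 := TEq.congr hcup (pass_left hL hK1 (i := 1) (j := 0) (m := 0) (by omega)).symm
        (hK2'.append hcap)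
      have h2 := (H 0 0 le_rfl).append_right ((hK1'.append hK2').append hcap)
      have h3 := closure_shift (hL'.1.append hK)
      have h4 := h [cup 0] (K1 ++ K2 ++ [cap 0]) 2 0 L' (by simp [closure]) hcup
        ((hK.widen_right 1).append hcap) (by omega) hL'.1
      refine Equivalent.trans ?_ ((h3.symm.trans (Equivalent.trans ?_ h4)).trans hL'.2)
      · simpa [closure] using h1.equivalent.trans (by simpa using h2.equivalent)
      · simpa [closure] using Equivalent.refl _
    | succ j =>
      have hL1 := isTangle_shift_one hL (show j < q by omega)
      have h3 := closure_shift ((hK1.append hL1).append hK2)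
      have h4 := h ([cup 0] ++ K1) (K2 ++ [cap 0]) (q + 1) j L (by simp [closure])
        (hcup.append (hK1.widen_right 1)) ((hK2.widen_right 1).append hcap) (by omega) hL
      refine Equivalent.trans ?_ (h3.symm.trans (Equivalent.trans ?_ h4))
      · simpa [closure, shift_shift, add_comm] using Equivalent.refl _
      · simpa [closure] using Equivalent.refl _
  · intro h X Y m j L e hX hY hj hL
    rcases split_closure e with rfl | rfl | ⟨K1, K2, rfl, rfl, rfl⟩
    · obtain rfl : 0 = m := hX
      omega
    · obtain rfl : m = 0 := hY
      omega
    obtain ⟨q, hK1, hK2⟩ := isTangle_append.1 hK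
    have hK1' : IsTangle 2 (1 + q + 0) (shift 1 K1) := hK1.widen 1 0
    have hK2' : IsTangle (1 + q + 0) 2 (shift 1 K2) := hK2.widen 1 0
    have hK1'' : IsTangle 2 (q + 1) K1 := hK1.widen_right 1
    have hK2'' : IsTangle (q + 1) 2 K2 := hK2.widen_right 1
    obtain rfl := hX.unique (hcup.append hK1'')
    rcases (show j < q ∨ j = q by omega) with hjq | rfl
    · have hL1 := isTangle_shift_one hL hjq
      have h3 := closure_shift ((hK1.append hL1).append hK2)
      have h4 := h ([cup 0] ++ shift 1 K1) (shift 1 K2 ++ [cap 0]) (1 + q + 0) (j + 1) L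
        (by simp [closure]) (hcup.append hK1') (hK2'.append hcap) (by omega) hL
      refine Equivalent.trans ?_ (h3.trans (Equivalent.trans ?_ h4))
      · simpa [closure] using Equivalent.refl _
      · simpa [closure, shift_shift, add_comm] using Equivalent.refl _
    · obtain ⟨L', hL', H⟩ := cup_right_to_left hL
      have h1 := TEq.congr hcup (pass_right hL hK1 (i := 0) (g := 0) (m := 1) (by omega)).symm
        (show IsTangle (0 + j + 1) 0 (K2 ++ [cap 0]) by simpa using hK2''.append hcap)
      have h2 := (H 0 0 le_rfl).append_right ((hK1''.append hK2'').append hcap)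
      have h3 := closure_shift (hL'.1.append hK)
      have h4 := h [cup 0] (shift 1 K1 ++ shift 1 K2 ++ [cap 0]) 2 1 L' (by simp [closure]) hcup
        ((hK1'.append hK2').append hcap) (by omega) hL'.1
      refine Equivalent.trans ?_ ((h3.trans (Equivalent.trans ?_ h4)).trans hL'.2)
      · simpa [closure] using Equivalent.trans (by simpa using h1.equivalent)
          (by simpa using h2.equivalent)
      · simpa [closure] using Equivalent.refl _

theorem Equivalent.insertsTrivially {D D' : Diagram} (h : Equivalent D D') :
    InsertsTrivially D ↔ InsertsTrivially D' := by
  induction h with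
  | rel x y h =>
    cases h with
    | inside A B r r' h h1 h1' =>
      obtain ⟨n, h3, h4⟩ := isTangle_append.1 h1
      obtain ⟨m, h5, h6⟩ := isTangle_append.1 h3
      obtain ⟨n', h3', h4'⟩ := isTangle_append.1 h1'
      obtain rfl := h4.unique_left h4'
      have h7 := h5.append_right h3'
      have e := TEq.of_move h h6 h7
      have ht := h.transfers h6 h7
      exact ⟨.of_inside h5 h4 h6 h7 e ht.2, .of_inside h5 h4 h7 h6 e.symm ht.1⟩
    | sphere K hK => exact InsertsTrivially.sphere hK
  | refl => exact Iff.rfl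
  | symm _ _ _ ih => exact ih.symm
  | trans _ _ _ _ _ ih ih' => exact ih.trans ih'

theorem insertsTrivially_circle : InsertsTrivially circle := by
  intro X Y m j L e hX hY hj hL
  rcases split_closure (K := []) e with rfl | rfl | ⟨K1, K2, e', rfl, rfl⟩
  · obtain rfl : 0 = m := hX
    omega
  · obtain rfl : m = 0 := hY
    omega
  obtain ⟨rfl, rfl⟩ := List.append_eq_nil_iff.1 e'.symm
  obtain rfl : m = 2 := hX.unique (isTangle_cup (m := 0) le_rfl)
  rcases (show j = 0 ∨ j = 1 by omega) with rfl | rfl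
  · simpa [closure] using Equivalent.refl _
  · simpa [closure] using (closure_shift hL).symm

/-- An unknotted summand of a connected sum can be omitted. -/
theorem closure_append_of_circle {K L : Diagram} (hK : IsTangle 1 1 K) (hL : IsTangle 1 1 L)
    (h : Equivalent (closure K) circle) : Equivalent (closure (K ++ L)) (closure L) := by
  have h1 := h.insertsTrivially.2 insertsTrivially_circle
  have h2 := h1 ([cup 0] ++ K) [cap 0] 2 0 L rfl
    ((isTangle_cup (m := 0) le_rfl).append (hK.widen_right 1)) (isTangle_cap (m := 0) le_rfl)
    (by omega) hL
  simpa [closure] using h2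

/-! ### Games on connected sums -/

/-- One crossing of one of the diagrams in a list is resolved. -/
def ListOption (l l' : List Diagram) : Prop :=
  ∃ (l₁ l₂ : List Diagram) (D D' : Diagram), IsOption D D' ∧ l = l₁ ++ D :: l₂ ∧ l' = l₁ ++ D' :: l₂

theorem ListOption.append_right {l l' : List Diagram} (h : ListOption l l') (k : List Diagram) :
    ListOption (l ++ k) (l' ++ k) := by
  obtain ⟨l₁, l₂, D, D', h, rfl, rfl⟩ := h
  exact ⟨l₁, l₂ ++ k, D, D', h, by simp, by simp⟩

theorem ListOption.append_left {l l' : List Diagram} (h : ListOption l l') (k : List Diagram) :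
    ListOption (k ++ l) (k ++ l') := by
  obtain ⟨l₁, l₂, D, D', h, rfl, rfl⟩ := h
  exact ⟨k ++ l₁, l₂, D, D', h, by simp, by simp⟩

theorem listOption_append {l k m : List Diagram} (h : ListOption (l ++ k) m) :
    (∃ l', ListOption l l' ∧ m = l' ++ k) ∨ ∃ k', ListOption k k' ∧ m = l ++ k' := by
  obtain ⟨l₁, l₂, D, D', h, e, rfl⟩ := h
  rcases List.append_eq_append_iff.1 e with ⟨C, rfl, rfl⟩ | ⟨C, rfl, h2⟩
  · exact Or.inr ⟨_, ⟨C, l₂, D, D', h, rfl, rfl⟩, by simp⟩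
  · cases C with
    | nil =>
      simp only [List.nil_append] at h2
      subst h2
      exact Or.inr ⟨_, ⟨[], l₂, D, D', h, rfl, rfl⟩, by simp⟩
    | cons x C =>
      simp only [List.cons_append, List.cons.injEq] at h2
      obtain ⟨rfl, rfl⟩ := h2
      exact Or.inl ⟨_, ⟨l₁, C, D, D', h, rfl, rfl⟩, by simp⟩

theorem IsConnectedSum.option {G H S S' : Diagram} (h : IsConnectedSum G H S)
    (hS : IsOption S S') : (∃ G', IsOption G G' ∧ IsConnectedSum G' H S') ∨
      ∃ H', IsOption H H' ∧ IsConnectedSum G H' S' := by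
  obtain ⟨K, L, hK, hL, h1, h2, h3⟩ := h
  obtain ⟨_, h4, h5⟩ := h3.symm.option hS
  obtain ⟨_, h6, rfl⟩ := isOption_closure.1 h4
  rcases isOption_append.1 h6 with ⟨K', h7, rfl⟩ | ⟨L', h7, rfl⟩
  · obtain ⟨G', h8, h9⟩ := h1.option (isOption_closure.2 ⟨K', h7, rfl⟩)
    exact Or.inl ⟨G', h8, K', L, h7.isTangle.1 hK, hL, h9, h2, h5.symm⟩
  · obtain ⟨H', h8, h9⟩ := h2.option (isOption_closure.2 ⟨L', h7, rfl⟩)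
    exact Or.inr ⟨H', h8, K, L', hK, h7.isTangle.1 hL, h1, h9, h5.symm⟩

theorem IsConnectedSum.option_fst {G H S G' : Diagram} (h : IsConnectedSum G H S)
    (hG : IsOption G G') : ∃ S', IsOption S S' ∧ IsConnectedSum G' H S' := by
  obtain ⟨K, L, hK, hL, h1, h2, h3⟩ := h
  obtain ⟨_, h4, h5⟩ := h1.symm.option hG
  obtain ⟨K', h6, rfl⟩ := isOption_closure.1 h4
  obtain ⟨S', h7, h8⟩ := h3.option
    (isOption_closure.2 ⟨_, isOption_append.2 (Or.inl ⟨K', h6, rfl⟩), rfl⟩)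
  exact ⟨S', h7, K', L, h6.isTangle.1 hK, hL, h5.symm, h2, h8⟩

theorem IsConnectedSum.option_snd {G H S H' : Diagram} (h : IsConnectedSum G H S)
    (hH : IsOption H H') : ∃ S', IsOption S S' ∧ IsConnectedSum G H' S' := by
  obtain ⟨K, L, hK, hL, h1, h2, h3⟩ := h
  obtain ⟨_, h4, h5⟩ := h2.symm.option hH
  obtain ⟨L', h6, rfl⟩ := isOption_closure.1 h4
  obtain ⟨S', h7, h8⟩ := h3.option
    (isOption_closure.2 ⟨_, isOption_append.2 (Or.inr ⟨L', h6, rfl⟩), rfl⟩)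
  exact ⟨S', h7, K, L', hK, h6.isTangle.1 hL, h1, h5.symm, h8⟩

theorem IsConnectedSumOf.option {l : List Diagram} {S S' : Diagram} (h : IsConnectedSumOf l S)
    (hS : IsOption S S') : ∃ l', ListOption l l' ∧ IsConnectedSumOf l' S' := by
  induction h generalizing S' with
  | single T S h =>
    obtain ⟨T', h1, h2⟩ := h.symm.option hS
    exact ⟨[T'], ⟨[], [], T, T', h1, rfl, rfl⟩, .single _ _ h2.symm⟩
  | sum l l' G H S h1 h2 h ih1 ih2 =>
    rcases h.option hS with ⟨G', hG, h3⟩ | ⟨H', hH, h3⟩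
    · obtain ⟨k, h4, h5⟩ := ih1 hG
      exact ⟨_, h4.append_right _, .sum _ _ _ _ _ h5 h2 h3⟩
    · obtain ⟨k, h4, h5⟩ := ih2 hH
      exact ⟨_, h4.append_left _, .sum _ _ _ _ _ h1 h5 h3⟩

theorem IsConnectedSumOf.listOption {l l' : List Diagram} {S : Diagram}
    (h : IsConnectedSumOf l S) (hl : ListOption l l') :
    ∃ S', IsOption S S' ∧ IsConnectedSumOf l' S' := by
  induction h generalizing l' with
  | single T S h =>
    obtain ⟨l₁, l₂, D, D', hD, e, rfl⟩ := hl
    obtain ⟨rfl, rfl, rfl⟩ : l₁ = [] ∧ T = D ∧ l₂ = [] := by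
      rcases l₁ with _ | ⟨x, l₁⟩ <;> simp_all
    obtain ⟨S', h1, h2⟩ := h.option hD
    exact ⟨S', h1, .single _ _ h2⟩
  | sum l k G H S h1 h2 h ih1 ih2 =>
    rcases listOption_append hl with ⟨m, h3, rfl⟩ | ⟨m, h3, rfl⟩
    · obtain ⟨G', hG, h4⟩ := ih1 h3
      obtain ⟨S', h5, h6⟩ := h.option_fst hG
      exact ⟨S', h5, .sum _ _ _ _ _ h4 h2 h6⟩
    · obtain ⟨H', hH, h4⟩ := ih2 h3
      obtain ⟨S', h5, h6⟩ := h.option_snd hH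
      exact ⟨S', h5, .sum _ _ _ _ _ h1 h4 h6⟩

theorem IsConnectedSumOf.unresolved_eq {l : List Diagram} {S : Diagram}
    (h : IsConnectedSumOf l S) : unresolved S = (l.map unresolved).sum := by
  induction h with
  | single T S h => simpa using h.unresolved_eq.symm
  | sum l l' G H S h1 h2 h ih1 ih2 =>
    obtain ⟨K, L, hK, hL, h3, h4, h5⟩ := h
    rw [← h5.unresolved_eq, List.map_append, List.sum_append, ← ih1, ← ih2, ← h3.unresolved_eq,
      ← h4.unresolved_eq]
    simp

theorem IsConnectedSumOf.equivalent_circle {l : List Diagram} {S : Diagram}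
    (h : IsConnectedSumOf l S) (hl : ∀ D ∈ l, Equivalent D circle) : Equivalent S circle := by
  induction h with
  | single T S h => exact h.symm.trans (hl T (by simp))
  | sum l l' G H S h1 h2 h ih1 ih2 =>
    obtain ⟨K, L, hK, hL, h3, h4, h5⟩ := h
    have hG := ih1 fun D hD => hl D (by simp [hD])
    have hH := ih2 fun D hD => hl D (by simp [hD])
    exact h5.symm.trans ((closure_append_of_circle hK hL (h3.trans hG)).trans (h4.trans hH))

/-- The multiplicities of the two parts are natural numbers with product 1, so both are 1, and the
argument descends to the summands. -/
theorem IsConnectedSumOf.colorings_eq {p : ℕ} [NeZero p] {l : List Diagram} {S : Diagram}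
    (h : IsConnectedSumOf l S) (h0 : unresolved S = 0) (hS : colorings p S = p) {D : Diagram}
    (hD : D ∈ l) : colorings p D = p := by
  induction h with
  | single T S h =>
    rw [List.mem_singleton.1 hD, h.colorings_eq (Or.inl (h.unresolved_eq.trans h0)), hS]
  | sum l l' G H S h1 h2 h ih1 ih2 =>
    obtain ⟨K, L, hK, hL, h3, h4, h5⟩ := h
    have h6 := h5.unresolved_eq
    simp only [unresolved_closure, unresolved_append, h0, Nat.add_eq_zero_iff] at h6
    have h7 := h5.colorings_eq (p := p) (Or.inl (by simp [h6]))
    rw [colorings_closure (hK.append hL), multiplicity_append hK, hS] at h7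
    have h8 : multiplicity p K * multiplicity p L = 1 :=
      Nat.eq_of_mul_eq_mul_left (Nat.pos_of_neZero p) (by rw [h7, mul_one])
    obtain ⟨hk, hl⟩ := mul_eq_one.1 h8
    have hGc := h3.colorings_eq (p := p) (Or.inl (by simp [h6]))
    have hHc := h4.colorings_eq (p := p) (Or.inl (by simp [h6]))
    rw [colorings_closure hK, hk, mul_one] at hGc
    rw [colorings_closure hL, hl, mul_one] at hHc
    rcases List.mem_append.1 hD with hD | hD
    · exact ih1 (by rw [← h3.unresolved_eq]; simp [h6]) hGc.symm hD
    · exact ih2 (by rw [← h4.unresolved_eq]; simp [h6]) hHc.symm hD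

/-- The Unknotter wins a connected sum if every summand belongs to a class of diagrams that is
preserved by every move of the Knotter, up to a reply, and in which the Unknotter has a good move.
If `free` fails, the Unknotter needs good moves only in positions of odd size, and wins if he makes
the last move. -/
theorem wins_unknotter (C : Diagram → Prop) (free : Prop)
    (hK : ∀ D D', C D → IsOption D D' → C D' ∨ ∃ D'', IsOption D' D'' ∧ C D'')
    (hU : ∀ D, C D → unresolved D ≠ 0 → free ∨ Odd (unresolved D) → ∃ D', IsOption D D' ∧ C D')
    (hC : ∀ D, C D → unresolved D = 0 → Equivalent D circle)
    (n : ℕ) (l : List Diagram) (S : Diagram) (hS : IsConnectedSumOf l S) (hl : ∀ D ∈ l, C D)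
    (hn : unresolved S = n) :
    (free ∨ Even n → Wins .unknotter .knotter S) ∧
      (free ∨ Odd n → Wins .unknotter .unknotter S) := by
  induction n using Nat.strong_induction_on generalizing l S with
  | _ n ih =>
  have replace : ∀ {l₁ l₂ : List Diagram} {D D' : Diagram}, (∀ E ∈ l₁ ++ D :: l₂, C E) → C D' →
      ∀ E ∈ l₁ ++ D' :: l₂, C E := by
    intro l₁ l₂ D D' h h' E hE
    simp only [List.mem_append, List.mem_cons] at hE h
    rcases hE with hE | rfl | hE
    · exact h E (Or.inl hE)
    · exact h'
    · exact h E (Or.inr (Or.inr hE))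
  rcases Nat.eq_zero_or_pos n with rfl | hpos
  · have h0 : ∀ D ∈ l, unresolved D = 0 := by
      rw [hS.unresolved_eq] at hn
      intro D hD
      exact List.sum_eq_zero_iff.1 hn _ (List.mem_map_of_mem hD)
    have := hS.equivalent_circle fun D hD => hC D (hl D hD) (h0 D hD)
    exact ⟨fun _ => .finished _ _ hn this, fun _ => .finished _ _ hn this⟩
  have drop : ∀ {E E' : Diagram}, IsOption E E' → unresolved E' = unresolved E - 1 := by
    intro E E' h
    have := h.unresolved_eq
    omega
  refine ⟨fun hp => .opponent _ (by omega) fun S' hS' => ?_, fun hp => ?_⟩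
  · obtain ⟨l', ⟨l₁, l₂, D, D', hD, rfl, rfl⟩, h'⟩ := hS.option hS'
    rcases hK D D' (hl D (by simp)) hD with hD' | ⟨D'', hD', hD''⟩
    · refine (ih (n - 1) (by omega) _ S' h' (replace hl hD') (by rw [drop hS', hn])).2 ?_
      exact hp.imp_right fun h => by
        rw [Nat.even_iff] at h; rw [Nat.odd_iff]; omega
    -- A move out of the class is answered in the same summand; class and parity are restored and
    -- the size drops by two.
    · obtain ⟨S'', hS'', h''⟩ := h'.listOption ⟨l₁, l₂, D', D'', hD', rfl, rfl⟩
      have e' := hS'.unresolved_eq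
      have e'' := hS''.unresolved_eq
      refine .own _ S'' hS'' ((ih (n - 2) (by omega) _ S'' h'' (replace hl hD'') (by omega)).1 ?_)
      exact hp.imp_right fun h => by
        rw [Nat.even_iff] at h ⊢; omega
  -- Without `free`, the odd total size forces a summand of odd size, and there the Unknotter has a
  -- good move.
  · obtain ⟨D, hD, h0, hodd⟩ : ∃ D ∈ l, unresolved D ≠ 0 ∧ (free ∨ Odd (unresolved D)) := by
      rw [hS.unresolved_eq] at hn
      rcases hp with hf | hodd
      · by_contra! hall
        have : (l.map unresolved).sum = 0 := List.sum_eq_zero_iff.2 fun x hx => by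
          obtain ⟨D, hD, rfl⟩ := List.mem_map.1 hx
          by_contra h
          exact (hall D hD h).1 hf
        omega
      · by_contra! hall
        have : Even (l.map unresolved).sum := by
          clear hn hS hl ih
          induction l with
          | nil => simp
          | cons D l ihl =>
            rw [List.map_cons, List.sum_cons]
            refine Even.add ?_ (ihl fun E hE => hall E (by simp [hE]))
            by_contra h
            rw [Nat.not_even_iff_odd] at h
            exact (hall D (by simp) h.pos.ne').2 h
        rw [hn] at this
        exact Nat.not_even_iff_odd.2 hodd this
    obtain ⟨D', hD', hC'⟩ := hU D (hl D hD) h0 hodd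
    obtain ⟨l₁, l₂, rfl⟩ := List.append_of_mem hD
    obtain ⟨S', hS', h'⟩ := hS.listOption ⟨l₁, l₂, D, D', hD', rfl, rfl⟩
    refine .own _ S' hS' ((ih (n - 1) (by omega) _ S' h' (replace hl hC') (by rw [drop hS', hn])).1 ?_)
    exact hp.imp_right fun h => by
      rw [Nat.odd_iff] at h; rw [Nat.even_iff]; omega

/-! ### The Knotter's strategies with passes -/

/-- Some number of Fox colorings shows that the diagram is knotted. -/
def Knotted (D : Diagram) : Prop := ∃ p : ℕ, ∃ _ : NeZero p, colorings p D ≠ p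

theorem Knotted.equivalent {D D' : Diagram} (h : Knotted D) (h0 : unresolved D = 0)
    (e : Equivalent D D') : Knotted D' := by
  obtain ⟨p, hp0, hp⟩ := h
  exact ⟨p, hp0, fun h => hp ((e.colorings_eq (Or.inl h0)).trans h)⟩

/-- A move in the game on `D` with `k` passes, which either player may use. -/
def PassMove (k : ℕ) (D : Diagram) (k' : ℕ) (D' : Diagram) : Prop :=
  (k = k' + 1 ∧ D = D') ∨ (k = k' ∧ IsOption D D')

theorem PassMove.count {k k' : ℕ} {D D' : Diagram} (h : PassMove k D k' D') :
    k + unresolved D = k' + unresolved D' + 1 := by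
  rcases h with ⟨rfl, rfl⟩ | ⟨rfl, h⟩
  · omega
  · have := h.unresolved_eq
    omega

/-- The Knotter, moving second, wins the game of `2 * n` moves on `D` with `k` passes. -/
def Second : ℕ → ℕ → Diagram → Prop
  | 0, k, D => k = 0 ∧ unresolved D = 0 ∧ Knotted D
  | n + 1, k, D => ∀ k' D', PassMove k D k' D' →
      ∃ k'' D'', PassMove k' D' k'' D'' ∧ Second n k'' D''

/-- The Knotter makes the last move and wins, for any number of passes that permits this. -/
def KnotterSecond (D : Diagram) : Prop := ∀ k n, k + unresolved D = 2 * n → Second n k D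

/-- The Knotter copies a strategy: the opponent's move is translated from `D` to `E`, answered
there, and the answer is translated back. The numbers of passes may differ, which allows a pass to
simulate a move on a diagram. -/
theorem Second.of_bisim {R : ℕ → Diagram → ℕ → Diagram → Prop}
    (h1 : ∀ {k D l E k' D'}, R k D l E → PassMove k D k' D' →
      ∃ l' E', PassMove l E l' E' ∧ R k' D' l' E')
    (h2 : ∀ {k D l E l' E'}, R k D l E → PassMove l E l' E' →
      ∃ k' D', PassMove k D k' D' ∧ R k' D' l' E')
    (h0 : ∀ {k D l E}, R k D l E → Second 0 l E → Second 0 k D) {n k l : ℕ} {D E : Diagram}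
    (h : R k D l E) (hE : Second n l E) : Second n k D := by
  induction n generalizing k l D E with
  | zero => exact h0 h hE
  | succ n ih =>
    intro k' D' hD
    obtain ⟨l', E', hE', h'⟩ := h1 h hD
    obtain ⟨l'', E'', hE'', hs⟩ := hE l' E' hE'
    obtain ⟨k'', D'', hD'', h''⟩ := h2 h' hE''
    exact ⟨k'', D'', hD'', ih h'' hs⟩

theorem PassMove.equivalent {k k' : ℕ} {D D' E : Diagram} (h : PassMove k D k' D')
    (e : Equivalent D E) : ∃ E', PassMove k E k' E' ∧ Equivalent D' E' := by
  rcases h with ⟨rfl, rfl⟩ | ⟨rfl, h⟩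
  · exact ⟨E, Or.inl ⟨rfl, rfl⟩, e⟩
  · obtain ⟨E', h1, h2⟩ := e.option h
    exact ⟨E', Or.inr ⟨rfl, h1⟩, h2⟩

theorem Second.zero_equivalent {k : ℕ} {D E : Diagram} (h : Second 0 k D) (e : Equivalent D E) :
    Second 0 k E :=
  ⟨h.1, e.unresolved_eq ▸ h.2.1, h.2.2.equivalent h.2.1 e⟩

theorem Second.equivalent {n k : ℕ} {D E : Diagram} (h : Second n k E) (e : Equivalent D E) :
    Second n k D := by
  refine Second.of_bisim (R := fun k D l E => k = l ∧ Equivalent D E) ?_ ?_ ?_ ⟨rfl, e⟩ h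
  · rintro k D l E k' D' ⟨rfl, e⟩ h
    obtain ⟨E', h1, h2⟩ := h.equivalent e
    exact ⟨k', E', h1, rfl, h2⟩
  · rintro k D l E k' D' ⟨rfl, e⟩ h
    obtain ⟨E', h1, h2⟩ := h.equivalent e.symm
    exact ⟨k', E', h1, rfl, h2.symm⟩
  · rintro k D l E ⟨rfl, e⟩ h
    exact h.zero_equivalent e.symm

theorem KnotterSecond.equivalent {D E : Diagram} (h : KnotterSecond E) (e : Equivalent D E) :
    KnotterSecond D :=
  fun k n hn => (h k n (e.unresolved_eq ▸ hn)).equivalent e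

/-! ### Transfer of the Knotter's strategy across unresolved loops and bigons. -/

theorem pseudoOne_iff {P Q : Diagram} : PseudoOne P Q ↔
    ∃ (A B : Diagram) (i j : ℕ), (j = i + 1 ∧ IsTangle 0 0 (A ++ [cup j, cross .flat i, cap j] ++ B) ∨
      i = j + 1 ∧ IsTangle 0 0 (A ++ [cup j, cross .flat i, cap j] ++ B)) ∧
      P = A ++ [cup j, cross .flat i, cap j] ++ B ∧ Q = A ++ B := by
  constructor
  · rintro (⟨A, B, i, h⟩ | ⟨A, B, i, h⟩)
    · exact ⟨A, B, i, i + 1, Or.inl ⟨rfl, h⟩, rfl, rfl⟩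
    · exact ⟨A, B, i + 1, i, Or.inr ⟨rfl, h⟩, rfl, rfl⟩
  · rintro ⟨A, B, i, j, (⟨rfl, h⟩ | ⟨rfl, h⟩), rfl, rfl⟩
    · exact .right A B i h
    · exact .left A B j h

theorem PseudoOne.isTangle {P Q : Diagram} (h : PseudoOne P Q) :
    IsTangle 0 0 P ∧ IsTangle 0 0 Q := by
  have key : ∀ {A B r : Diagram} {m : ℕ}, (∀ n, IsTangle m n r → m = n) →
      IsTangle 0 m A → IsTangle m 0 (r ++ B) → IsTangle 0 0 (A ++ B) := by
    intro A B r m hr hA hB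
    obtain ⟨n, h1, h2⟩ := isTangle_append.1 hB
    obtain rfl := hr n h1
    exact hA.append h2
  rcases h with ⟨A, B, i, h⟩ | ⟨A, B, i, h⟩ <;> refine ⟨h, ?_⟩ <;>
  · rw [List.append_assoc] at h
    obtain ⟨m, h1, h2⟩ := isTangle_append.1 h
    refine key (fun n hn => ?_) h1 h2
    simp only [IsTangle, Piece.ins, Piece.outs] at hn
    omega

theorem PseudoOne.option_left {P Q P' : Diagram} (h : PseudoOne P Q) (hP : IsOption P P') :
    Equivalent P' Q ∨ ∃ Q', IsOption Q Q' ∧ PseudoOne P' Q' := by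
  have hQ := h.isTangle.2
  obtain ⟨A, B, i, j, hA, rfl, rfl⟩ := pseudoOne_iff.1 h
  have ht := hP.isTangle.1 h.isTangle.1
  rcases isOption_append_three.1 hP with ⟨A', h, rfl⟩ | ⟨r, h, rfl⟩ | ⟨B', h, rfl⟩
  · refine Or.inr ⟨A' ++ B, isOption_append.2 (Or.inl ⟨_, h, rfl⟩),
      pseudoOne_iff.2 ⟨A', B, i, j, ?_, rfl, rfl⟩⟩
    rcases hA with h | h
    · exact Or.inl ⟨h.1, ht⟩
    · exact Or.inr ⟨h.1, ht⟩
  · left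
    have : ∃ c, c ≠ Crossing.flat ∧ r = [cup j, cross c i, cap j] := by
      simpa [isOption_cons, not_isOption_nil] using h
    obtain ⟨c, hc, rfl⟩ := this
    refine .rel _ _ (Eq.subst (motive := fun X => Step _ (X ++ B)) (List.append_nil A)
      (.inside A B _ [] ?_ ht (by simpa using hQ)))
    rcases hA with ⟨rfl, _⟩ | ⟨rfl, _⟩
    · exact .oneRight i c hc
    · exact .oneLeft j c hc
  · refine Or.inr ⟨A ++ B', isOption_append.2 (Or.inr ⟨_, h, rfl⟩),
      pseudoOne_iff.2 ⟨A, B', i, j, ?_, rfl, rfl⟩⟩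
    rcases hA with h | h
    · exact Or.inl ⟨h.1, ht⟩
    · exact Or.inr ⟨h.1, ht⟩

theorem PseudoOne.option_right {P Q Q' : Diagram} (h : PseudoOne P Q) (hQ : IsOption Q Q') :
    ∃ P', IsOption P P' ∧ PseudoOne P' Q' := by
  have ht := h.isTangle.1
  obtain ⟨A, B, i, j, hA, rfl, rfl⟩ := pseudoOne_iff.1 h
  obtain ⟨A', B', h1, rfl⟩ : ∃ A' B', IsOption (A ++ [cup j, cross .flat i, cap j] ++ B)
      (A' ++ [cup j, cross .flat i, cap j] ++ B') ∧ Q' = A' ++ B' := by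
    rcases isOption_append.1 hQ with ⟨A', h, rfl⟩ | ⟨B', h, rfl⟩
    · exact ⟨A', B, isOption_append_three.2 (Or.inl ⟨_, h, rfl⟩), rfl⟩
    · exact ⟨A, B', isOption_append_three.2 (Or.inr (Or.inr ⟨_, h, rfl⟩)), rfl⟩
  have ht' := h1.isTangle.1 ht
  refine ⟨_, h1, pseudoOne_iff.2 ⟨A', B', i, j, ?_, rfl, rfl⟩⟩
  exact hA.imp (fun h => ⟨h.1, ht'⟩) (fun h => ⟨h.1, ht'⟩)

theorem PseudoOne.exists_option {P Q : Diagram} (h : PseudoOne P Q) :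
    ∃ P', IsOption P P' ∧ Equivalent P' Q := by
  have hQ := h.isTangle.2
  have hP := h.isTangle.1
  obtain ⟨A, B, i, j, hA, rfl, rfl⟩ := pseudoOne_iff.1 h
  have ho : IsOption (A ++ [cup j, cross .flat i, cap j] ++ B)
      (A ++ [cup j, cross .rise i, cap j] ++ B) :=
    ⟨A ++ [cup j], [cap j] ++ B, i, .rise, by simp, by simp, by simp⟩
  refine ⟨_, ho, .rel _ _ (Eq.subst (motive := fun X => Step _ (X ++ B)) (List.append_nil A)
      (.inside A B _ [] ?_ (ho.isTangle.1 hP) (by simpa using hQ)))⟩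
  rcases hA with ⟨rfl, _⟩ | ⟨rfl, _⟩
  · exact .oneRight i _ (by simp)
  · exact .oneLeft j _ (by simp)

theorem PseudoOne.unresolved_eq {P Q : Diagram} (h : PseudoOne P Q) :
    unresolved P = unresolved Q + 1 := by
  obtain ⟨P', h1, h2⟩ := h.exists_option
  rw [h1.unresolved_eq, h2.unresolved_eq]

/-- A loop resolved in either way is removed by Reidemeister I, so it is worth exactly one pass. In
the simulation it stands for an additional pass on `Q`; once it has been used, the two positions are
equivalent with equally many passes. -/
theorem KnotterSecond.of_pseudoOne {P Q : Diagram} (h : KnotterSecond Q) (hPQ : PseudoOne P Q) :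
    KnotterSecond P := by
  intro k n hn
  have hn' : k + 1 + unresolved Q = 2 * n := by
    have := hPQ.unresolved_eq
    omega
  refine Second.of_bisim
    (R := fun k D l E => (l = k + 1 ∧ PseudoOne D E) ∨ (k = l ∧ Equivalent D E)) ?_ ?_ ?_
    (Or.inl ⟨rfl, hPQ⟩) (h _ _ hn')
  · rintro k D l E k' D' (⟨rfl, e⟩ | ⟨rfl, e⟩) h
    · rcases h with ⟨rfl, rfl⟩ | ⟨rfl, h⟩
      · exact ⟨_, E, Or.inl ⟨rfl, rfl⟩, Or.inl ⟨rfl, e⟩⟩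
      · rcases e.option_left h with h | ⟨E', h1, h2⟩
        · exact ⟨k, E, Or.inl ⟨rfl, rfl⟩, Or.inr ⟨rfl, h⟩⟩
        · exact ⟨_, E', Or.inr ⟨rfl, h1⟩, Or.inl ⟨rfl, h2⟩⟩
    · obtain ⟨E', h1, h2⟩ := h.equivalent e
      exact ⟨k', E', h1, Or.inr ⟨rfl, h2⟩⟩
  · rintro k D l E l' E' (⟨rfl, e⟩ | ⟨rfl, e⟩) h
    · rcases h with ⟨h, rfl⟩ | ⟨rfl, h⟩
      · obtain ⟨D', h1, h2⟩ := e.exists_option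
        exact ⟨k, D', Or.inr ⟨rfl, h1⟩, Or.inr ⟨by omega, h2⟩⟩
      · obtain ⟨D', h1, h2⟩ := e.option_right h
        exact ⟨k, D', Or.inr ⟨rfl, h1⟩, Or.inl ⟨rfl, h2⟩⟩
    · obtain ⟨D', h1, h2⟩ := h.equivalent e.symm
      exact ⟨l', D', h1, Or.inr ⟨rfl, h2.symm⟩⟩
  · rintro k D l E (⟨rfl, e⟩ | ⟨rfl, e⟩) h
    · exact absurd h.1 (by omega)
    · exact h.zero_equivalent e.symm

/-- Deletion of a bigon with two unresolved crossings. -/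
def PseudoTwo (P Q : Diagram) : Prop :=
  ∃ (A B : Diagram) (i : ℕ), IsTangle 0 0 (A ++ [cross .flat i, cross .flat i] ++ B) ∧
    P = A ++ [cross .flat i, cross .flat i] ++ B ∧ Q = A ++ B

theorem PseudoTwo.isTangle {P Q : Diagram} (h : PseudoTwo P Q) :
    IsTangle 0 0 P ∧ IsTangle 0 0 Q := by
  obtain ⟨A, B, i, h, rfl, rfl⟩ := h
  refine ⟨h, ?_⟩
  rw [List.append_assoc] at h
  obtain ⟨m, h1, h2⟩ := isTangle_append.1 h
  obtain ⟨n, h2, h3⟩ := isTangle_append.1 h2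
  simp only [IsTangle, Piece.ins, Piece.outs] at h2
  obtain rfl : m = n := by omega
  exact h1.append h3

theorem PseudoTwo.unresolved_eq {P Q : Diagram} (h : PseudoTwo P Q) :
    unresolved P = unresolved Q + 2 := by
  obtain ⟨A, B, i, h, rfl, rfl⟩ := h
  simp
  omega

/-- Either player can cancel the bigon after the first of its crossings has been resolved. -/
theorem PseudoTwo.option_left {P Q P' : Diagram} (h : PseudoTwo P Q) (hP : IsOption P P') :
    (∃ P'', IsOption P' P'' ∧ Equivalent P'' Q) ∨ ∃ Q', IsOption Q Q' ∧ PseudoTwo P' Q' := by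
  have hQ := h.isTangle.2
  obtain ⟨A, B, i, ht, rfl, rfl⟩ := h
  have ht' := hP.isTangle.1 ht
  rcases isOption_append_three.1 hP with ⟨A', h, rfl⟩ | ⟨r, h, rfl⟩ | ⟨B', h, rfl⟩
  · exact Or.inr ⟨A' ++ B, isOption_append.2 (Or.inl ⟨_, h, rfl⟩), A', B, i, ht', rfl, rfl⟩
  · left
    have : ∃ c, c ≠ Crossing.flat ∧ (r = [cross c i, cross .flat i] ∨
        r = [cross .flat i, cross c i]) := by
      rcases isOption_cons.1 h with ⟨c, hc, _, rfl⟩ | ⟨r', h₁, rfl⟩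
      · exact ⟨c, hc, Or.inl rfl⟩
      · rcases isOption_cons.1 h₁ with ⟨c, hc, _, rfl⟩ | ⟨r', h₂, rfl⟩
        · exact ⟨c, hc, Or.inr rfl⟩
        · exact absurd h₂ (not_isOption_nil _)
    obtain ⟨c, hc, hr⟩ := this
    have key : ∀ d, d ≠ Crossing.flat → IsOption (A ++ r ++ B)
        (A ++ [cross d i, cross d.turn i] ++ B) → ∃ P'', IsOption (A ++ r ++ B) P'' ∧
          Equivalent P'' (A ++ B) := by
      intro d hd ho
      refine ⟨_, ho, .rel _ _ (Eq.subst (motive := fun X => Step _ (X ++ B)) (List.append_nil A)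
        (.inside A B _ [] (.two i d hd) (ho.isTangle.1 ht') (by simpa using hQ)))⟩
    rcases hr with rfl | rfl
    · exact key c hc ⟨A ++ [cross c i], B, i, c.turn, by simpa using hc, by simp, by simp⟩
    · exact key c.turn (by simpa using hc)
        ⟨A, [cross c i] ++ B, i, c.turn, by simpa using hc, by simp, by simp⟩
  · exact Or.inr ⟨A ++ B', isOption_append.2 (Or.inr ⟨_, h, rfl⟩), A, B', i, ht', rfl, rfl⟩

theorem PseudoTwo.option_right {P Q Q' : Diagram} (h : PseudoTwo P Q) (hQ : IsOption Q Q') :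
    ∃ P', IsOption P P' ∧ PseudoTwo P' Q' := by
  obtain ⟨A, B, i, ht, rfl, rfl⟩ := h
  rcases isOption_append.1 hQ with ⟨A', h, rfl⟩ | ⟨B', h, rfl⟩
  · have h1 : IsOption (A ++ [cross .flat i, cross .flat i] ++ B)
        (A' ++ [cross .flat i, cross .flat i] ++ B) :=
      isOption_append_three.2 (Or.inl ⟨A', h, rfl⟩)
    exact ⟨_, h1, A', B, i, h1.isTangle.1 ht, rfl, rfl⟩
  · have h1 : IsOption (A ++ [cross .flat i, cross .flat i] ++ B)
        (A ++ [cross .flat i, cross .flat i] ++ B') :=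
      isOption_append_three.2 (Or.inr (Or.inr ⟨B', h, rfl⟩))
    exact ⟨_, h1, A, B', i, h1.isTangle.1 ht, rfl, rfl⟩

/-- A move in the bigon is answered by the cancelling choice at its other crossing; every other move
is answered as on `Q`. If play on `Q` is over, only the two crossings of the bigon are left. -/
theorem Second.of_pseudoTwo {n k : ℕ} {P Q : Diagram} (h : Second n k Q) (hPQ : PseudoTwo P Q)
    (hn : k + unresolved Q = 2 * n) : Second (n + 1) k P := by
  induction n generalizing k P Q with
  | zero =>
    rintro k' P' (⟨rfl, rfl⟩ | ⟨rfl, hP⟩)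
    · omega
    · rcases hPQ.option_left hP with ⟨P'', h1, h2⟩ | ⟨Q', h1, _⟩
      · exact ⟨k, P'', Or.inr ⟨rfl, h1⟩, h.equivalent h2⟩
      · have := h1.unresolved_eq
        omega
  | succ n ih =>
    have go : ∀ {k' P' Q'}, PassMove k Q k' Q' → PseudoTwo P' Q' →
        ∃ k'' P'', PassMove k' P' k'' P'' ∧ Second (n + 1) k'' P'' := by
      intro k' P' Q' hm hPQ'
      obtain ⟨k'', Q'', hm', hs⟩ := h k' Q' hm
      have e := hm.count
      have e' := hm'.count
      rcases hm' with ⟨rfl, rfl⟩ | ⟨rfl, ho⟩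
      · exact ⟨k'', P', Or.inl ⟨rfl, rfl⟩, ih hs hPQ' (by omega)⟩
      · obtain ⟨P'', h1, h2⟩ := hPQ'.option_right ho
        exact ⟨k', P'', Or.inr ⟨rfl, h1⟩, ih hs h2 (by omega)⟩
    rintro k' P' (⟨rfl, rfl⟩ | ⟨rfl, hP⟩)
    · exact go (Or.inl ⟨rfl, rfl⟩) hPQ
    · rcases hPQ.option_left hP with ⟨P'', h1, h2⟩ | ⟨Q', h1, h2⟩
      · exact ⟨k, P'', Or.inr ⟨rfl, h1⟩, h.equivalent h2⟩
      · exact go (Or.inr ⟨rfl, h1⟩) h2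

theorem KnotterSecond.of_pseudoTwo {P Q : Diagram} (h : KnotterSecond Q) (hPQ : PseudoTwo P Q) :
    KnotterSecond P := by
  intro k n hn
  have := hPQ.unresolved_eq
  obtain ⟨n, rfl⟩ : ∃ m, n = m + 1 := ⟨n - 1, by omega⟩
  exact (h k n (by omega)).of_pseudoTwo hPQ (by omega)

/-- As long as the two extra passes are present, a pass is answered by a pass, which removes them,
and any other move is answered by the given strategy. -/
theorem Second.two_passes {n k : ℕ} {D : Diagram} (h : Second n k D)
    (hn : k + unresolved D = 2 * n) : Second (n + 1) (k + 2) D := by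
  induction n generalizing k D with
  | zero =>
    rintro k' D' (⟨hk, rfl⟩ | ⟨rfl, hD⟩)
    · exact ⟨k, D, Or.inl ⟨by omega, rfl⟩, h⟩
    · have := hD.unresolved_eq
      omega
  | succ n ih =>
    rintro k' D' (⟨hk, rfl⟩ | ⟨rfl, hD⟩)
    · exact ⟨k, D, Or.inl ⟨by omega, rfl⟩, h⟩
    · obtain ⟨k'', D'', hm, hs⟩ := h k D' (Or.inr ⟨rfl, hD⟩)
      have e := hm.count
      have e' := hD.unresolved_eq
      refine ⟨k'' + 2, D'', ?_, ih hs (by omega)⟩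
      rcases hm with ⟨rfl, rfl⟩ | ⟨rfl, hm⟩
      · exact Or.inl ⟨by omega, rfl⟩
      · exact Or.inr ⟨rfl, hm⟩

/-- It suffices to consider the game with at most one pass. -/
theorem KnotterSecond.of_second {D : Diagram} {k n : ℕ} (hk : k ≤ 1)
    (hn : k + unresolved D = 2 * n) (h : Second n k D) : KnotterSecond D := by
  intro l m hm
  obtain ⟨j, rfl⟩ : ∃ j, l = k + 2 * j := ⟨(l - k) / 2, by omega⟩
  obtain rfl : m = n + j := by omega
  clear hm
  induction j with
  | zero => exact h
  | succ j ih => exact ih.two_passes (by omega)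

/-! ### The other summands of a connected sum as a supply of passes. -/

theorem ListOption.passMove {l₁ l₂ l' : List Diagram} {D : Diagram}
    (h : ListOption (l₁ ++ D :: l₂) l') : ∃ l₁' l₂' D', l' = l₁' ++ D' :: l₂' ∧
      PassMove ((l₁ ++ l₂).map unresolved).sum D ((l₁' ++ l₂').map unresolved).sum D' := by
  have drop : ∀ {l l' : List Diagram}, ListOption l l' →
      (l.map unresolved).sum = (l'.map unresolved).sum + 1 := by
    rintro l l' ⟨m₁, m₂, E, E', h, rfl, rfl⟩
    have := h.unresolved_eq
    simp
    omega
  rcases listOption_append h with ⟨l₁', h₁, rfl⟩ | ⟨l₂', h₁, rfl⟩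
  · refine ⟨l₁', l₂, D, rfl, Or.inl ⟨?_, rfl⟩⟩
    have := drop h₁
    simp
    omega
  · rcases listOption_append (l := [D]) (k := l₂) h₁ with ⟨k, h₂, rfl⟩ | ⟨k, h₂, rfl⟩
    · obtain ⟨m₁, m₂, E, E', h₃, e, rfl⟩ := h₂
      obtain ⟨rfl, rfl, rfl⟩ : m₁ = [] ∧ D = E ∧ m₂ = [] := by
        rcases m₁ with _ | ⟨x, m₁⟩ <;> simp_all
      exact ⟨l₁, l₂, E', rfl, Or.inr ⟨rfl, h₃⟩⟩
    · refine ⟨l₁, k, D, rfl, Or.inl ⟨?_, rfl⟩⟩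
      have := drop h₂
      simp
      omega

theorem PassMove.listOption {l₁ l₂ : List Diagram} {D D' : Diagram} {k' : ℕ}
    (h : PassMove ((l₁ ++ l₂).map unresolved).sum D k' D') : ∃ l₁' l₂',
      ListOption (l₁ ++ D :: l₂) (l₁' ++ D' :: l₂') ∧
        k' = ((l₁' ++ l₂').map unresolved).sum := by
  rcases h with ⟨h, rfl⟩ | ⟨rfl, h⟩
  · obtain ⟨E, hE, h0⟩ : ∃ E ∈ l₁ ++ l₂, unresolved E ≠ 0 := by
      by_contra! hall
      have : ((l₁ ++ l₂).map unresolved).sum = 0 := List.sum_eq_zero_iff.2 fun x hx => by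
        obtain ⟨E, hE, rfl⟩ := List.mem_map.1 hx
        exact hall E hE
      omega
    obtain ⟨E', hE'⟩ := exists_isOption h0
    have e := hE'.unresolved_eq
    rcases List.mem_append.1 hE with hE | hE
    · obtain ⟨m₁, m₂, rfl⟩ := List.append_of_mem hE
      refine ⟨m₁ ++ E' :: m₂, l₂, ⟨m₁, m₂ ++ D :: l₂, E, E', hE', by simp, by simp⟩, ?_⟩
      simp at h ⊢
      omega
    · obtain ⟨m₁, m₂, rfl⟩ := List.append_of_mem hE
      refine ⟨l₁, m₁ ++ E' :: m₂, ⟨l₁ ++ D :: m₁, m₂, E, E', hE', by simp, by simp⟩, ?_⟩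
      simp at h ⊢
      omega
  · exact ⟨l₁, l₂, ⟨l₁, l₂, D, D', h, rfl, rfl⟩, rfl⟩

/-- The number of passes is the number of unresolved crossings outside `D`. It is irrelevant how
these are resolved, since a single knotted summand already spoils the coloring count of the sum. -/
theorem Second.wins {n : ℕ} {l₁ l₂ : List Diagram} {D S : Diagram}
    (hS : IsConnectedSumOf (l₁ ++ D :: l₂) S) (hn : unresolved S = 2 * n)
    (h : Second n ((l₁ ++ l₂).map unresolved).sum D) : Wins .knotter .unknotter S := by
  induction n generalizing l₁ l₂ D S with
  | zero =>
    obtain ⟨p, _, hp⟩ := h.2.2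
    refine .finished _ _ hn fun he => hp (hS.colorings_eq hn ?_ (by simp))
    rw [he.colorings_eq (Or.inl hn), colorings_circle]
  | succ n ih =>
    refine .opponent _ (by omega) fun S' hS' => ?_
    obtain ⟨l', hl', h'⟩ := hS.option hS'
    obtain ⟨m₁, m₂, D', rfl, hm⟩ := hl'.passMove
    obtain ⟨k'', D'', hm', hs⟩ := h _ _ hm
    obtain ⟨o₁, o₂, hl'', rfl⟩ := hm'.listOption
    obtain ⟨S'', hS'', h''⟩ := h'.listOption hl''
    have e' := hS'.unresolved_eq
    have e'' := hS''.unresolved_eq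
    exact .own _ S'' hS'' (ih h'' (by omega) hs)

theorem KnotterSecond.wins {l : List Diagram} {D S : Diagram} (h : KnotterSecond D) (hD : D ∈ l)
    (hS : IsConnectedSumOf l S) : (Even (unresolved S) → Wins .knotter .unknotter S) ∧
      (Odd (unresolved S) → Wins .knotter .knotter S) := by
  obtain ⟨l₁, l₂, rfl⟩ := List.append_of_mem hD
  have hu := hS.unresolved_eq
  have hu' : ((l₁ ++ l₂).map unresolved).sum + unresolved D = unresolved S := by
    rw [hu]
    simp
    omega
  constructor
  · rintro ⟨n, hn⟩
    exact (h _ n (by omega)).wins hS (by omega)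
  · rintro ⟨n, hn⟩
    -- To move first, the Knotter imagines one more pass, already spent by the opponent; the reply
    -- of the strategy is his opening move.
    obtain ⟨k, D', hm, hs⟩ :=
      h (((l₁ ++ l₂).map unresolved).sum + 1) (n + 1) (by omega) _ D (Or.inl ⟨rfl, rfl⟩)
    obtain ⟨o₁, o₂, hl, rfl⟩ := hm.listOption
    obtain ⟨S', hS', h'⟩ := hS.listOption hl
    have e := hS'.unresolved_eq
    exact .own _ S' hS' (hs.wins h' (by omega))

/-! ### Closed three-strand words -/

instance {m n : ℕ} : Trans (TEq m n) (TEq m n) (TEq m n) := ⟨TEq.trans⟩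

theorem TEq.inside {m n : ℕ} (A B : Diagram) {r r' : Diagram} (h : LocalMove r r')
    (h1 : IsTangle m n (A ++ r ++ B)) (h2 : IsTangle m n (A ++ r' ++ B)) :
    TEq m n (A ++ r ++ B) (A ++ r' ++ B) :=
  .rel _ _ (.mk A B r r' h h1 h2)

theorem TEq.closure {K K' : Diagram} (h : TEq 1 1 K K') :
    Equivalent (closure K) (closure K') :=
  (TEq.congr (isTangle_cup (i := 0) (m := 0) le_rfl) (h.widen_right 1)
    (isTangle_cap (i := 0) (m := 0) le_rfl)).equivalent

/-- The word `w` as a three-strand tangle: a letter `(x, c)` stands for a crossing in state `c` of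
the strands at the positions `x` and `x + 1`. -/
def braid (w : List (Bool × Crossing)) : Diagram := w.map fun x => cross x.2 x.1.toNat

@[simp] theorem braid_nil : braid [] = [] := rfl

@[simp] theorem braid_cons (x : Bool × Crossing) (w : List (Bool × Crossing)) :
    braid (x :: w) = cross x.2 x.1.toNat :: braid w := rfl

@[simp] theorem braid_append (v w : List (Bool × Crossing)) :
    braid (v ++ w) = braid v ++ braid w := List.map_append

theorem isTangle_braid (w : List (Bool × Crossing)) : IsTangle 3 3 (braid w) := by
  induction w with
  | nil => rfl
  | cons x w ih =>
    refine (isTangle_cross (c := x.2) (i := x.1.toNat) (m := 3) ?_).append ih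
    cases x.1 <;> simp

theorem isTangle_cup_bool (b : Bool) : IsTangle 1 3 [cup b.toNat] :=
  isTangle_cup (m := 1) (by cases b <;> simp)

theorem isTangle_cap_bool (b : Bool) : IsTangle 3 1 [cap b.toNat] :=
  isTangle_cap (m := 1) (by cases b <;> simp)

/-- The one-string tangle given by a word, one minimum and one maximum. -/
def wordTangle (b : Bool) (w : List (Bool × Crossing)) (e : Bool) : Diagram :=
  [cup b.toNat] ++ braid w ++ [cap e.toNat]

/-- The closed diagram given by a word. -/
def wordDiagram (b : Bool) (w : List (Bool × Crossing)) (e : Bool) : Diagram :=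
  closure (wordTangle b w e)

theorem isTangle_wordTangle (b : Bool) (w : List (Bool × Crossing)) (e : Bool) :
    IsTangle 1 1 (wordTangle b w e) :=
  ((isTangle_cup_bool b).append (isTangle_braid w)).append (isTangle_cap_bool e)

theorem IsTangle.closure {K : Diagram} (h : IsTangle 1 1 K) : IsTangle 0 0 (closure K) :=
  ((isTangle_cup (i := 0) (m := 0) le_rfl).append (h.widen_right 1)).append
    (isTangle_cap (i := 0) (m := 0) le_rfl)

theorem Equivalent.isTangle {D E : Diagram} (h : Equivalent D E) :
    IsTangle 0 0 D ↔ IsTangle 0 0 E := by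
  induction h with
  | rel x y h =>
    cases h with
    | inside A B r r' _ h1 h2 => exact ⟨fun _ => h2, fun _ => h1⟩
    | sphere K hK => exact ⟨fun _ => (hK.widen 1 0 |> fun h => ((isTangle_cup (i := 0) (m := 0)
        le_rfl).append h).append (isTangle_cap (i := 0) (m := 0) le_rfl)), fun _ => hK.closure⟩
  | refl => exact Iff.rfl
  | symm _ _ _ ih => exact ih.symm
  | trans _ _ _ _ _ ih ih' => exact ih.trans ih'

theorem wordDiagram_congr {b e : Bool} {u v v' w : List (Bool × Crossing)}
    (h : TEq 3 3 (braid v) (braid v')) :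
    Equivalent (wordDiagram b (u ++ v ++ w) e) (wordDiagram b (u ++ v' ++ w) e) := by
  have := TEq.closure (TEq.congr ((isTangle_cup_bool b).append (isTangle_braid u)) h
    ((isTangle_braid w).append (isTangle_cap_bool e)))
  simpa [wordDiagram, wordTangle] using this

/-! #### The half turn -/

/-- `n` nested arcs. -/
def nest : ℕ → Diagram
  | 0 => []
  | n + 1 => cap n :: nest n

/-- `X'` is the tangle `X` turned by a half turn. -/
def IsRotation (m n : ℕ) (X X' : Diagram) : Prop :=
  IsTangle m n X ∧ IsTangle n m X' ∧ TEq (m + n) 0 (X ++ nest n) (shift m X' ++ nest m)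

theorem isTangle_nest (n : ℕ) : IsTangle (n + n) 0 (nest n) := by
  induction n with
  | zero => rfl
  | succ n ih =>
    have := (isTangle_cap (i := n) (m := n + n) (by omega)).append ih
    rwa [show n + n + 2 = n + 1 + (n + 1) by omega] at this

/-- The upper tangle `Y` travels over the nested arcs first, then changes heights with `X`, and
finally `X` travels over the arcs; hence the order is reversed. -/
theorem IsRotation.append {m n k : ℕ} {X X' Y Y' : Diagram} (hX : IsRotation m n X X')
    (hY : IsRotation n k Y Y') : IsRotation m k (X ++ Y) (Y' ++ X') := by
  obtain ⟨hX, hX', h⟩ := hX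
  obtain ⟨hY, hY', h'⟩ := hY
  refine ⟨hX.append hY, hY'.append hX', ?_⟩
  have h1 := h'.append_left (hX.widen_right k)
  have h2 := (exchange_blocks hX hY').append_right (isTangle_nest n)
  have h3 := h.append_left (A := shift m Y') (by simpa using hY'.widen m 0)
  rw [List.append_assoc, shift_append, List.append_assoc]
  exact h1.trans ((TEq.of_eq (List.append_assoc _ _ _).symm).trans
    (h2.trans ((TEq.of_eq (List.append_assoc _ _ _)).trans h3)))

theorem IsRotation.closure {K K' : Diagram} (h : IsRotation 1 1 K K') :
    Equivalent (closure K) (closure K') := by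
  obtain ⟨hK, hK', h⟩ := h
  have := (h.append_left (isTangle_cup (i := 0) (m := 0) le_rfl)).equivalent
  refine Equivalent.trans ?_ (closure_shift hK').symm
  simpa [KnotGame.closure, nest] using this

theorem isRotation_cup (b : Bool) : IsRotation 1 3 [cup b.toNat] [cap (!b).toNat] := by
  refine ⟨isTangle_cup_bool b, isTangle_cap_bool _, ?_⟩
  cases b
  · change TEq 4 0 [cup 0, cap 2, cap 1, cap 0] [cap 2, cap 0]
    calc TEq 4 0 [cup 0, cap 2, cap 1, cap 0] [cap 0, cup 0, cap 1, cap 0] :=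
          TEq.inside [] [cap 1, cap 0] (.exchange 0 0 .cup .cap)
            (by simp [IsTangle, Piece.ins, Piece.outs]) (by simp [IsTangle, Piece.ins, Piece.outs])
      TEq 4 0 _ [cap 0, cap 0] := TEq.inside [cap 0] [cap 0] (.zigzagLeft 0)
            (by simp [IsTangle, Piece.ins, Piece.outs]) (by simp [IsTangle, Piece.ins, Piece.outs])
      TEq 4 0 _ [cap 2, cap 0] := cap_cap
  · exact TEq.inside [] [cap 1, cap 0] (.zigzagLeft 1)
      (by simp [IsTangle, Piece.ins, Piece.outs]) (by simp [IsTangle, Piece.ins, Piece.outs])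

theorem isRotation_cap (b : Bool) : IsRotation 3 1 [cap b.toNat] [cup (!b).toNat] := by
  refine ⟨isTangle_cap_bool b, isTangle_cup_bool _, ?_⟩
  cases b
  · change TEq 4 0 [cap 0, cap 0] [cup 4, cap 2, cap 1, cap 0]
    refine TEq.symm ?_
    calc TEq 4 0 [cup 4, cap 2, cap 1, cap 0] [cap 2, cup 2, cap 1, cap 0] :=
          (TEq.inside [] [cap 1, cap 0] (.exchange 2 0 .cap .cup)
            (by simp [IsTangle, Piece.ins, Piece.outs])
            (by simp [IsTangle, Piece.ins, Piece.outs])).symm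
      TEq 4 0 _ [cap 2, cap 0] := TEq.inside [cap 2] [cap 0] (.zigzagRight 1)
            (by simp [IsTangle, Piece.ins, Piece.outs]) (by simp [IsTangle, Piece.ins, Piece.outs])
      TEq 4 0 _ [cap 0, cap 0] := cap_cap.symm
  · exact (TEq.inside [] [cap 1, cap 0] (.zigzagRight 2)
      (by simp [IsTangle, Piece.ins, Piece.outs])
      (by simp [IsTangle, Piece.ins, Piece.outs])).symm

theorem turn_cap {c : Crossing} {i m : ℕ} (h : i ≤ m) :
    TEq (m + 3) (m + 1) [cross c (i + 1), cap i] [cross c.turn i, cap (i + 1)] := by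
  refine TEq.of_move (.turn i c) ?_ ?_ <;> simp [IsTangle, Piece.ins, Piece.outs] <;> omega

theorem turn_cap' {c : Crossing} {i m : ℕ} (h : i ≤ m) :
    TEq (m + 3) (m + 1) [cross c i, cap (i + 1)] [cross c.turn (i + 1), cap i] := by
  simpa using (turn_cap (c := c.turn) h).symm

/-- On its way over the nested arcs the crossing makes two quarter turns, so its state comes back
unchanged while its position is reflected. -/
theorem isRotation_cross (c : Crossing) (x : Bool) :
    IsRotation 3 3 [cross c x.toNat] [cross c (!x).toNat] := by
  refine ⟨isTangle_braid [(x, c)], isTangle_braid [(!x, c)], ?_⟩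
  cases x
  · change TEq 6 0 [cross c 0, cap 2, cap 1, cap 0] [cross c 4, cap 2, cap 1, cap 0]
    calc TEq 6 0 [cross c 0, cap 2, cap 1, cap 0] [cap 2, cross c 0, cap 1, cap 0] :=
          TEq.inside [] [cap 1, cap 0] (.exchange 0 0 (.cross c) .cap)
            (by simp [IsTangle, Piece.ins, Piece.outs]) (by simp [IsTangle, Piece.ins, Piece.outs])
      TEq 6 0 _ [cap 2, cross c.turn 1, cap 0, cap 0] :=
          TEq.congr (A := [cap 2]) (B := [cap 0]) (isTangle_cap (m := 4) (by simp))
            (turn_cap' (m := 1) (by simp)) (isTangle_cap (m := 0) (by simp))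
      TEq 6 0 _ [cap 2, cross c.turn 1, cap 2, cap 0] :=
          TEq.append_left (A := [cap 2, cross c.turn 1]) (by simp [IsTangle, Piece.ins, Piece.outs])
            cap_cap
      TEq 6 0 _ [cap 2, cross c 2, cap 1, cap 0] := by
          simpa using TEq.congr (A := [cap 2]) (B := [cap 0]) (isTangle_cap (m := 4) (by simp))
            (turn_cap' (c := c.turn) (i := 1) (m := 1) (by simp))
            (isTangle_cap (m := 0) (by simp))
      TEq 6 0 _ [cross c 4, cap 2, cap 1, cap 0] :=
          TEq.inside [] [cap 1, cap 0] (.exchange 2 0 .cap (.cross c))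
            (by simp [IsTangle, Piece.ins, Piece.outs]) (by simp [IsTangle, Piece.ins, Piece.outs])
  · change TEq 6 0 [cross c 1, cap 2, cap 1, cap 0] [cross c 3, cap 2, cap 1, cap 0]
    calc TEq 6 0 [cross c 1, cap 2, cap 1, cap 0] [cross c.turn 2, cap 1, cap 1, cap 0] :=
          TEq.append_right (B := [cap 1, cap 0]) (turn_cap' (m := 3) (by simp))
            (by simp [IsTangle, Piece.ins, Piece.outs])
      TEq 6 0 _ [cross c.turn 2, cap 3, cap 1, cap 0] :=
          TEq.inside [cross c.turn 2] [cap 0] (.exchange 1 0 .cap .cap)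
            (by simp [IsTangle, Piece.ins, Piece.outs]) (by simp [IsTangle, Piece.ins, Piece.outs])
      TEq 6 0 _ [cross c 3, cap 2, cap 1, cap 0] := by
          simpa using TEq.append_right (B := [cap 1, cap 0])
            (turn_cap' (c := c.turn) (i := 2) (m := 3) (by simp))
            (by simp [IsTangle, Piece.ins, Piece.outs])

/-- The word read from the other end. -/
def flip (w : List (Bool × Crossing)) : List (Bool × Crossing) :=
  (w.map fun x => (!x.1, x.2)).reverse

theorem isRotation_braid (w : List (Bool × Crossing)) :
    IsRotation 3 3 (braid w) (braid (flip w)) := by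
  induction w with
  | nil => exact ⟨rfl, rfl, TEq.refl _⟩
  | cons x w ih => simpa [flip] using (isRotation_cross x.2 x.1).append ih

theorem wordDiagram_flip (b : Bool) (w : List (Bool × Crossing)) (e : Bool) :
    Equivalent (wordDiagram b w e) (wordDiagram (!e) (flip w) (!b)) := by
  refine IsRotation.closure ?_
  simpa [wordTangle] using
    ((isRotation_cup b).append (isRotation_braid w)).append (isRotation_cap e)

/-! #### Moves at the ends -/

/-- The last crossing involves one leg of the maximum and the third strand; turning it moves the
maximum to the other position. -/
theorem wordDiagram_turn (b : Bool) (w : List (Bool × Crossing)) (e : Bool) (c : Crossing) :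
    Equivalent (wordDiagram b (w ++ [(!e, c)]) e) (wordDiagram b (w ++ [(e, c.turn)]) (!e)) := by
  have h : TEq 3 1 [cross c (!e).toNat, cap e.toNat] [cross c.turn e.toNat, cap (!e).toNat] := by
    cases e
    · exact turn_cap (i := 0) (m := 0) le_rfl
    · exact turn_cap' (i := 0) (m := 0) le_rfl
  have := TEq.closure (h.append_left ((isTangle_cup_bool b).append (isTangle_braid w)))
  simpa [wordDiagram, wordTangle] using this

/-- A crossing of the two legs of one maximum is a loop. It is brought to the shape in which the
first Reidemeister move and its unresolved version are formulated. -/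
theorem cross_cap_eq_loop (c : Crossing) :
    TEq 2 0 [cross c 0, cap 0] [cup 2, cross c.turn 1, cap 2, cap 0] := by
  refine TEq.symm ?_
  calc TEq 2 0 [cup 2, cross c.turn 1, cap 2, cap 0] [cup 2, cross c.turn 1, cap 0, cap 0] :=
        TEq.append_left (A := [cup 2, cross c.turn 1]) (by simp [IsTangle, Piece.ins, Piece.outs])
          cap_cap.symm
    TEq 2 0 _ [cup 2, cross c 0, cap 1, cap 0] := by
        simpa using TEq.congr (A := [cup 2]) (B := [cap 0]) (isTangle_cup (m := 2) (by simp))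
          (turn_cap (c := c.turn) (i := 0) (m := 1) (by simp)) (isTangle_cap (m := 0) (by simp))
    TEq 2 0 _ [cross c 0, cup 2, cap 1, cap 0] :=
        (TEq.inside [] [cap 1, cap 0] (.exchange 0 0 (.cross c) .cup)
            (by simp [IsTangle, Piece.ins, Piece.outs])
            (by simp [IsTangle, Piece.ins, Piece.outs])).symm
    TEq 2 0 _ [cross c 0, cap 0] := TEq.inside [cross c 0] [cap 0] (.zigzagRight 1)
            (by simp [IsTangle, Piece.ins, Piece.outs]) (by simp [IsTangle, Piece.ins, Piece.outs])

theorem wordDiagram_loop (b : Bool) (w : List (Bool × Crossing)) (e : Bool) (c : Crossing) :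
    Equivalent (wordDiagram b (w ++ [(e, c)]) e) ([cup 0] ++ [cup b.toNat] ++ braid w ++
      [cup (e.toNat + 2), cross c.turn (e.toNat + 1), cap (e.toNat + 2)] ++
        [cap e.toNat, cap 0]) := by
  have h : TEq 3 1 [cross c e.toNat, cap e.toNat]
      [cup (e.toNat + 2), cross c.turn (e.toNat + 1), cap (e.toNat + 2), cap e.toNat] := by
    cases e
    · exact (cross_cap_eq_loop c).widen 0 1
    · exact (cross_cap_eq_loop c).widen 1 0
  have := TEq.closure (h.append_left ((isTangle_cup_bool b).append (isTangle_braid w)))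
  simpa [wordDiagram, wordTangle, KnotGame.closure] using this

theorem wordDiagram_one {b : Bool} {w : List (Bool × Crossing)} {e : Bool} :
    ∃ P, Equivalent (wordDiagram b (w ++ [(e, .flat)]) e) P ∧ PseudoOne P (wordDiagram b w e) := by
  refine ⟨_, wordDiagram_loop b w e .flat, ?_⟩
  have ht := (Equivalent.isTangle (wordDiagram_loop b w e .flat)).1 (isTangle_wordTangle _ _ _).closure
  have := PseudoOne.right ([cup 0] ++ [cup b.toNat] ++ braid w) [cap e.toNat, cap 0] (e.toNat + 1)
    ht
  simpa [Crossing.turn, wordDiagram, wordTangle, KnotGame.closure] using this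

theorem wordDiagram_two {b : Bool} {v w : List (Bool × Crossing)} {x e : Bool} :
    PseudoTwo (wordDiagram b (v ++ [(x, .flat), (x, .flat)] ++ w) e) (wordDiagram b (v ++ w) e) := by
  have e1 : wordDiagram b (v ++ [(x, .flat), (x, .flat)] ++ w) e =
      [cup 0] ++ [cup b.toNat] ++ braid v ++ [cross .flat x.toNat, cross .flat x.toNat] ++
        (braid w ++ [cap e.toNat, cap 0]) := by
    simp [wordDiagram, wordTangle, KnotGame.closure]
  refine ⟨_, _, x.toNat, ?_, e1, ?_⟩
  · rw [← e1]
    exact (isTangle_wordTangle _ _ e).closure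
  · simp [wordDiagram, wordTangle, KnotGame.closure]

theorem wordDiagram_cancel {b : Bool} {v w : List (Bool × Crossing)} {x e : Bool} {c : Crossing}
    (hc : c ≠ .flat) : Equivalent (wordDiagram b (v ++ [(x, c), (x, c.turn)] ++ w) e)
      (wordDiagram b (v ++ w) e) := by
  have h : TEq 3 3 (braid [(x, c), (x, c.turn)]) (braid []) :=
    TEq.of_move (.two x.toNat c hc) (isTangle_braid _) rfl
  simpa using wordDiagram_congr (u := v) (w := w) h

theorem wordDiagram_one_resolved {b : Bool} {w : List (Bool × Crossing)} {e : Bool} {c : Crossing}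
    (hc : c ≠ .flat) : Equivalent (wordDiagram b (w ++ [(e, c)]) e) (wordDiagram b w e) := by
  refine (wordDiagram_loop b w e c).trans ?_
  have ht := (Equivalent.isTangle (wordDiagram_loop b w e c)).1 (isTangle_wordTangle _ _ _).closure
  have := Step.inside ([cup 0] ++ [cup b.toNat] ++ braid w) [cap e.toNat, cap 0] _ []
    (.oneRight (e.toNat + 1) c.turn (by simpa using hc)) ht
    (by simpa [wordDiagram, wordTangle, KnotGame.closure] using
      (isTangle_wordTangle b w e).closure)
  exact .rel _ _ (by simpa [wordDiagram, wordTangle, KnotGame.closure] using this)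

theorem wordDiagram_nil (b : Bool) : Equivalent (wordDiagram b [] (!b)) circle := by
  have h : TEq 1 1 (wordTangle b [] (!b)) [] := by
    cases b
    · exact zigzag_left (by simp)
    · exact zigzag_right (i := 0) (by simp)
  exact h.closure

/-! ### Reductions -/

/-- `P` is turned into `Q`, up to equivalence, by deletions of unresolved loops and bigons. -/
def Reduces : Diagram → Diagram → Prop :=
  Relation.ReflTransGen fun P Q => Equivalent P Q ∨ PseudoOne P Q ∨ PseudoTwo P Q

theorem Equivalent.reducesByOne {P Q : Diagram} (h : Equivalent P Q) : ReducesByOne P Q :=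
  .single (Or.inl h)

theorem PseudoOne.reducesByOne {P Q : Diagram} (h : PseudoOne P Q) : ReducesByOne P Q :=
  .single (Or.inr h)

theorem ReducesByOne.reduces {P Q : Diagram} (h : ReducesByOne P Q) : Reduces P Q := by
  induction h with
  | refl => exact .refl
  | tail _ h ih => exact ih.tail (h.imp_right Or.inl)

theorem Equivalent.reduces {P Q : Diagram} (h : Equivalent P Q) : Reduces P Q :=
  .single (Or.inl h)

theorem PseudoTwo.reduces {P Q : Diagram} (h : PseudoTwo P Q) : Reduces P Q :=
  .single (Or.inr (Or.inr h))

theorem ReducesByOne.refl (P : Diagram) : ReducesByOne P P := Relation.ReflTransGen.refl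

theorem ReducesByOne.trans {P Q R : Diagram} (h : ReducesByOne P Q) (h' : ReducesByOne Q R) :
    ReducesByOne P R := Relation.ReflTransGen.trans h h'

theorem Reduces.refl (P : Diagram) : Reduces P P := Relation.ReflTransGen.refl

theorem Reduces.trans {P Q R : Diagram} (h : Reduces P Q) (h' : Reduces Q R) :
    Reduces P R := Relation.ReflTransGen.trans h h'

theorem KnotterSecond.of_reduces {P Q : Diagram} (h : KnotterSecond Q) (hPQ : Reduces P Q) :
    KnotterSecond P := by
  induction hPQ using Relation.ReflTransGen.head_induction_on with
  | refl => exact h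
  | head h' _ ih =>
    rcases h' with h' | h' | h'
    · exact ih.equivalent h'
    · exact ih.of_pseudoOne h'
    · exact ih.of_pseudoTwo h'

/-- If 2 = 0, both coloring rules merely exchange the two colors. Hence colorings modulo two survive
resolutions and reductions and detect links among shadows. -/
theorem pieceEval_cross_two {p : ℕ} [NeZero p] (hp : (2 : ZMod p) = 0) (c d : Crossing) (i : ℕ)
    (f : List (ZMod p) → ℕ) (s : List (ZMod p)) :
    pieceEval (.cross c) i f s = pieceEval (.cross d) i f s := by
  induction i generalizing f s with
  | zero =>
    have hneg : ∀ a : ZMod p, -a = a := fun a => by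
      have : (2 : ZMod p) * a = 0 := by rw [hp, zero_mul]
      linear_combination -this
    rcases s with _ | ⟨a, _ | ⟨b, s⟩⟩
    · cases c <;> cases d <;> rfl
    · cases c <;> cases d <;> rfl
    · cases c <;> cases d <;> simp [pieceEval, baseEval, hp, hneg]
  | succ i ih =>
    cases s with
    | nil => rfl
    | cons a s => exact ih _ _

theorem IsOption.colorings_two {D E : Diagram} (h : IsOption D E) :
    colorings 2 D = colorings 2 E := by
  obtain ⟨A, B, i, c, -, rfl, rfl⟩ := h
  have : eval [cross .flat i] (eval B fun _ => 1) = eval [cross c i] (eval (p := 2) B fun _ => 1) :=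
    funext fun s => pieceEval_cross_two (p := 2) (by decide) _ _ _ _ _
  simp only [colorings, eval_append, this]

theorem Equivalent.colorings_two {D E : Diagram} (h : Equivalent D E) :
    colorings 2 D = colorings 2 E := h.colorings_eq (Or.inr (by decide))

theorem PseudoTwo.exists_option {P Q : Diagram} (h : PseudoTwo P Q) :
    ∃ P' P'', IsOption P P' ∧ IsOption P' P'' ∧ Equivalent P'' Q := by
  have hQ := h.isTangle.2
  obtain ⟨A, B, i, ht, rfl, rfl⟩ := h
  have h1 : IsOption (A ++ [cross .flat i, cross .flat i] ++ B)
      (A ++ [cross .rise i, cross .flat i] ++ B) :=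
    ⟨A, [cross .flat i] ++ B, i, .rise, by simp, by simp, by simp⟩
  have h2 : IsOption (A ++ [cross .rise i, cross .flat i] ++ B)
      (A ++ [cross .rise i, cross .fall i] ++ B) :=
    ⟨A ++ [cross .rise i], B, i, .fall, by simp, by simp, by simp⟩
  refine ⟨_, _, h1, h2, .rel _ _ ?_⟩
  have := Step.inside A B _ [] (.two i .rise (by simp)) (h2.isTangle.1 (h1.isTangle.1 ht))
    (by simpa using hQ)
  rwa [List.append_nil] at this

theorem Reduces.colorings_two {P Q : Diagram} (h : Reduces P Q) :
    colorings 2 P = colorings 2 Q := by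
  induction h with
  | refl => rfl
  | tail _ h ih =>
    refine ih.trans ?_
    rcases h with h | h | h
    · exact h.colorings_two
    · obtain ⟨P', h1, h2⟩ := h.exists_option
      rw [h1.colorings_two, h2.colorings_two]
    · obtain ⟨P', P'', h1, h2, h3⟩ := h.exists_option
      rw [h1.colorings_two, h2.colorings_two, h3.colorings_two]

/-- Diagrams that reduce to a circle: the Unknotter wins if he makes the last move. -/
def Unknottable (D : Diagram) : Prop := Reduces D circle

/-- Along the reduction, the resolved crossing belongs to a loop, which disappears anyway, or to a
bigon, which the Unknotter cancels by the partner crossing. Until that stage is reached, move and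
reply are carried along unchanged. -/
theorem Unknottable.reply {D D' : Diagram} (h : Unknottable D) (hD : IsOption D D') :
    Unknottable D' ∨ ∃ D'', IsOption D' D'' ∧ Unknottable D'' := by
  induction h using Relation.ReflTransGen.head_induction_on generalizing D' with
  | refl =>
    have := hD.unresolved_eq
    simp [circle] at this
  | @head P Q h hQ ih =>
    rcases h with h | h | h
    · obtain ⟨Q', h1, h2⟩ := h.option hD
      rcases ih h1 with h3 | ⟨Q'', h3, h4⟩
      · exact Or.inl (h2.reduces.trans h3)
      · obtain ⟨P'', h5, h6⟩ := h2.symm.option h3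
        exact Or.inr ⟨P'', h5, h6.symm.reduces.trans h4⟩
    · rcases h.option_left hD with h | ⟨Q', h1, h2⟩
      · exact Or.inl (h.reduces.trans hQ)
      · rcases ih h1 with h3 | ⟨Q'', h3, h4⟩
        · exact Or.inl (h2.reducesByOne.reduces.trans h3)
        · obtain ⟨P'', h5, h6⟩ := h2.option_right h3
          exact Or.inr ⟨P'', h5, h6.reducesByOne.reduces.trans h4⟩
    · rcases h.option_left hD with ⟨P'', h1, h2⟩ | ⟨Q', h1, h2⟩
      · exact Or.inr ⟨P'', h1, h2.reduces.trans hQ⟩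
      · rcases ih h1 with h3 | ⟨Q'', h3, h4⟩
        · exact Or.inl (h2.reduces.trans h3)
        · obtain ⟨P'', h5, h6⟩ := h2.option_right h3
          exact Or.inr ⟨P'', h5, h6.reduces.trans h4⟩

/-- Bigons are removed in pairs of crossings, so an odd size forces the deletion of a loop somewhere
in the reduction. Resolving the crossing of that loop is the required move. -/
theorem Unknottable.exists_option {D : Diagram} (h : Unknottable D) (hD : Odd (unresolved D)) :
    ∃ D', IsOption D D' ∧ Unknottable D' := by
  induction h using Relation.ReflTransGen.head_induction_on with
  | refl => simp [circle] at hD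
  | @head P Q h hQ ih =>
    rcases h with h | h | h
    · obtain ⟨Q', h1, h2⟩ := ih (h.unresolved_eq ▸ hD)
      obtain ⟨P', h3, h4⟩ := h.symm.option h1
      exact ⟨P', h3, h4.symm.reduces.trans h2⟩
    · obtain ⟨P', h1, h2⟩ := h.exists_option
      exact ⟨P', h1, h2.reduces.trans hQ⟩
    · obtain ⟨Q', h1, h2⟩ := ih (by
        rw [h.unresolved_eq] at hD
        rw [Nat.odd_iff] at hD ⊢
        omega)
      obtain ⟨P', h3, h4⟩ := h.option_right h1
      exact ⟨P', h3, h4.reduces.trans h2⟩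

theorem Unknottable.equivalent_circle {D : Diagram} (h : Unknottable D) (hD : unresolved D = 0) :
    Equivalent D circle := by
  induction h using Relation.ReflTransGen.head_induction_on with
  | refl => exact .refl _
  | head h _ ih =>
    rcases h with h | h | h
    · exact h.trans (ih (h.unresolved_eq ▸ hD))
    · rw [h.unresolved_eq] at hD
      omega
    · rw [h.unresolved_eq] at hD
      omega

/-! ### Words of unresolved crossings -/

/-- A word of unresolved crossings. -/
def flatWord (w : List Bool) : List (Bool × Crossing) := w.map fun x => (x, .flat)

@[simp] theorem flatWord_nil : flatWord [] = [] := rfl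

@[simp] theorem flatWord_cons (x : Bool) (w : List Bool) :
    flatWord (x :: w) = (x, .flat) :: flatWord w := rfl

@[simp] theorem flatWord_append (v w : List Bool) :
    flatWord (v ++ w) = flatWord v ++ flatWord w := List.map_append

/-- The shadow given by a word. -/
def shadow (b : Bool) (w : List Bool) (e : Bool) : Diagram := wordDiagram b (flatWord w) e

theorem unresolved_shadow (b : Bool) (w : List Bool) (e : Bool) :
    unresolved (shadow b w e) = w.length := by
  have : unresolved (braid (flatWord w)) = w.length := by
    induction w with
    | nil => rfl
    | cons x w ih => simp [ih]
  simp [shadow, wordDiagram, wordTangle, this]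

/-- The word read from the other end. -/
def flipWord (w : List Bool) : List Bool := (w.map (!·)).reverse

theorem flip_flatWord (w : List Bool) : flip (flatWord w) = flatWord (flipWord w) := by
  simp [flip, flatWord, flipWord, Function.comp_def]

theorem shadow_flip (b : Bool) (w : List Bool) (e : Bool) :
    Equivalent (shadow b w e) (shadow (!e) (flipWord w) (!b)) := by
  simpa [shadow, flip_flatWord] using wordDiagram_flip b (flatWord w) e

theorem shadow_turn_top (b : Bool) (w : List Bool) (e : Bool) :
    Equivalent (shadow b (w ++ [!e]) e) (shadow b (w ++ [e]) (!e)) := by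
  simpa [shadow, Crossing.turn] using wordDiagram_turn b (flatWord w) e .flat

theorem shadow_turn_bottom (b : Bool) (w : List Bool) (e : Bool) :
    Equivalent (shadow b ((!b) :: w) e) (shadow (!b) (b :: w) e) := by
  have h := shadow_flip b ((!b) :: w) e
  have h' := shadow_turn_top (!e) (flipWord w) (!b)
  have h'' := (shadow_flip (!b) (b :: w) e).symm
  simp only [flipWord, List.map_cons, List.reverse_cons, Bool.not_not] at h h' h''
  exact (h.trans h').trans h''

theorem shadow_one_top (b : Bool) (w : List Bool) (e : Bool) :
    ReducesByOne (shadow b (w ++ [e]) e) (shadow b w e) := by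
  obtain ⟨P, h1, h2⟩ := wordDiagram_one (b := b) (w := flatWord w) (e := e)
  simpa [shadow] using h1.reducesByOne.trans h2.reducesByOne

theorem shadow_one_bottom (b : Bool) (w : List Bool) (e : Bool) :
    ReducesByOne (shadow b (b :: w) e) (shadow b w e) := by
  have h := (shadow_flip b (b :: w) e).reducesByOne
  have h' := shadow_one_top (!e) (flipWord w) (!b)
  simp only [flipWord, List.map_cons, List.reverse_cons] at h h'
  exact (h.trans h').trans (shadow_flip b w e).symm.reducesByOne

theorem shadow_two (b : Bool) (v w : List Bool) (x e : Bool) :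
    Reduces (shadow b (v ++ [x, x] ++ w) e) (shadow b (v ++ w) e) := by
  simpa [shadow] using
    (wordDiagram_two (b := b) (v := flatWord v) (w := flatWord w) (x := x) (e := e)).reduces

/-- Every upper part of a word reduces to one of three. -/
theorem exists_reduces_top (v : List Bool) (e : Bool) :
    ∃ v' e', (v' = [] ∨ v' = [false] ∧ e' = true) ∧
      ∀ b u, Reduces (shadow b (u ++ v) e) (shadow b (u ++ v') e') := by
  induction v with
  | nil => exact ⟨[], e, Or.inl rfl, fun _ _ => .refl _⟩
  | cons x v ih =>
    obtain ⟨v', e', h, hr⟩ := ih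
    have hr' : ∀ b u, Reduces (shadow b (u ++ x :: v) e) (shadow b (u ++ x :: v') e') := by
      intro b u
      simpa using hr b (u ++ [x])
    rcases h with rfl | ⟨rfl, rfl⟩
    · cases x <;> cases e'
      · exact ⟨[], false, Or.inl rfl, fun b u => (hr' b u).trans
          (by simpa using (shadow_one_top b u false).reduces)⟩
      · exact ⟨[false], true, Or.inr ⟨rfl, rfl⟩, hr'⟩
      · exact ⟨[false], true, Or.inr ⟨rfl, rfl⟩, fun b u => (hr' b u).trans
          (shadow_turn_top b u false).reduces⟩
      · exact ⟨[], true, Or.inl rfl, fun b u => (hr' b u).trans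
          (by simpa using (shadow_one_top b u true).reduces)⟩
    · cases x
      · exact ⟨[], true, Or.inl rfl, fun b u => (hr' b u).trans
          (by simpa using shadow_two b u [] false true)⟩
      -- Turning the last letter `false` at the maximum makes it `true`, so it forms a bigon with
      -- the letter before it.
      · refine ⟨[], false, Or.inl rfl, fun b u => (hr' b u).trans ?_⟩
        have h1 := (shadow_turn_top b (u ++ [true]) true).reduces
        have h2 := shadow_two b u [] true false
        simp only [List.append_assoc, Bool.not_true] at h1 h2
        exact h1.trans (by simpa using h2)

theorem exists_reduces_nil (b : Bool) (w : List Bool) (e : Bool) :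
    ∃ b' e', Reduces (shadow b w e) (shadow b' [] e') := by
  obtain ⟨v', e', h, hr⟩ := exists_reduces_top w e
  have hr := hr b []
  rcases h with rfl | ⟨rfl, rfl⟩
  · exact ⟨b, e', hr⟩
  · cases b
    · exact ⟨false, true, hr.trans (shadow_one_bottom false [] true).reduces⟩
    · exact ⟨false, true, hr.trans ((shadow_turn_bottom true [] true).reduces.trans
        (shadow_one_top false [] true).reduces)⟩

theorem shadow_nil_ne (b : Bool) : Equivalent (shadow b [] (!b)) circle := wordDiagram_nil b

theorem colorings_shadow_nil (b : Bool) : colorings 2 (shadow b [] b) = 4 := by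
  have h : colorings 2 (shadow false [] false) = 4 := by decide
  cases b
  · exact h
  · exact (shadow_flip true [] true).colorings_two.trans h

/-- The number of components, detected by colorings modulo two, is greater than one. -/
def IsLink (b : Bool) (w : List Bool) (e : Bool) : Prop := 2 < colorings 2 (shadow b w e)

/-- Every word reduces to a crossingless one. This is a circle if the minimum and the maximum have
different positions, and otherwise consists of two circles, with four colorings modulo two. The
reduction preserves this count. -/
theorem unknottable_or_isLink (b : Bool) (w : List Bool) (e : Bool) :
    Unknottable (shadow b w e) ∨ IsLink b w e := by
  obtain ⟨b', e', h⟩ := exists_reduces_nil b w e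
  by_cases hbe : e' = !b'
  · subst hbe
    exact Or.inl (h.trans (shadow_nil_ne b').reduces)
  · obtain rfl : e' = b' := by cases e' <;> cases b' <;> simp_all
    exact Or.inr (by rw [IsLink, h.colorings_two, colorings_shadow_nil]; omega)

/-! ### The class of diagrams on which the Unknotter always wins -/

/-- Every letter twice, unresolved. -/
def double (u : List Bool) : List Bool := u.flatMap fun x => [x, x]

@[simp] theorem double_nil : double [] = [] := rfl

@[simp] theorem double_cons (x : Bool) (u : List Bool) : double (x :: u) = x :: x :: double u := rfl

@[simp] theorem double_append (u v : List Bool) : double (u ++ v) = double u ++ double v :=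
  List.flatMap_append

/-- The diagrams on which the Unknotter wins, no matter who moves first. -/
inductive Safe : Diagram → Prop
  | circle (D : Diagram) : Equivalent D circle → Safe D
  | odd (b : Bool) (u : List Bool) (e : Bool) (c : Crossing) :
      Safe (wordDiagram b (flatWord (double u) ++ [(!e, c)]) e)
  | equivalent (D E : Diagram) : Equivalent D E → Safe E → Safe D
  | one (D E : Diagram) : PseudoOne D E → Safe E → Safe D

theorem Safe.of_reducesByOne {P Q : Diagram} (h : ReducesByOne P Q) (hQ : Safe Q) : Safe P := by
  induction h using Relation.ReflTransGen.head_induction_on with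
  | refl => exact hQ
  | head h _ ih => exact h.elim (fun h => .equivalent _ _ h ih) (fun h => .one _ _ h ih)

theorem isOption_braid {w : List (Bool × Crossing)} {E : Diagram} :
    IsOption (braid w) E ↔ ∃ w₁ w₂ x c, c ≠ Crossing.flat ∧ w = w₁ ++ (x, .flat) :: w₂ ∧
      E = braid (w₁ ++ (x, c) :: w₂) := by
  constructor
  · intro h
    induction w generalizing E with
    | nil => exact absurd h (not_isOption_nil _)
    | cons y w ih =>
      rcases isOption_cons.1 h with ⟨c, hc, hy, rfl⟩ | ⟨D', h', rfl⟩
      · obtain ⟨y, d⟩ := y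
        obtain rfl : d = .flat := by simpa using hy
        exact ⟨[], w, y, c, hc, rfl, rfl⟩
      · obtain ⟨w₁, w₂, x, c, hc, rfl, rfl⟩ := ih h'
        exact ⟨y :: w₁, w₂, x, c, hc, rfl, rfl⟩
  · rintro ⟨w₁, w₂, x, c, hc, rfl, rfl⟩
    exact ⟨braid w₁, braid w₂, x.toNat, c, hc, by simp, by simp⟩

theorem isOption_wordDiagram {b : Bool} {w : List (Bool × Crossing)} {e : Bool} {E : Diagram} :
    IsOption (wordDiagram b w e) E ↔ ∃ w₁ w₂ x c, c ≠ Crossing.flat ∧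
      w = w₁ ++ (x, .flat) :: w₂ ∧ E = wordDiagram b (w₁ ++ (x, c) :: w₂) e := by
  rw [wordDiagram, isOption_closure]
  simp only [wordTangle, isOption_append_three, isOption_singleton, isOption_braid]
  constructor
  · rintro ⟨K, (⟨A, ⟨c, -, h, -⟩, -⟩ | ⟨s, ⟨w₁, w₂, x, c, hc, rfl, rfl⟩, rfl⟩ | ⟨A, ⟨c, -, h, -⟩, -⟩),
      rfl⟩
    · simp at h
    · exact ⟨w₁, w₂, x, c, hc, rfl, rfl⟩
    · simp at h
  · rintro ⟨w₁, w₂, x, c, hc, rfl, rfl⟩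
    exact ⟨_, Or.inr (Or.inl ⟨_, ⟨w₁, w₂, x, c, hc, rfl, rfl⟩, rfl⟩), rfl⟩

theorem split_double {u w₁ w₂ : List Bool} {x : Bool} (h : double u = w₁ ++ x :: w₂) :
    ∃ u₁ u₂, u = u₁ ++ x :: u₂ ∧ ((w₁ = double u₁ ∧ w₂ = x :: double u₂) ∨
      (w₁ = double u₁ ++ [x] ∧ w₂ = double u₂)) := by
  induction u generalizing w₁ with
  | nil => simp at h
  | cons y u ih =>
    rcases w₁ with _ | ⟨a, _ | ⟨b, w₁⟩⟩
    · simp only [double_cons, List.nil_append, List.cons.injEq] at h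
      obtain ⟨rfl, rfl⟩ := h
      exact ⟨[], u, rfl, Or.inl ⟨rfl, rfl⟩⟩
    · simp only [double_cons, List.cons_append, List.nil_append, List.cons.injEq] at h
      obtain ⟨rfl, rfl, rfl⟩ := h
      exact ⟨[], u, rfl, Or.inr ⟨rfl, rfl⟩⟩
    · simp only [double_cons, List.cons_append, List.cons.injEq] at h
      obtain ⟨rfl, rfl, h⟩ := h
      obtain ⟨u₁, u₂, rfl, h'⟩ := ih h
      refine ⟨y :: u₁, u₂, rfl, ?_⟩
      rcases h' with ⟨rfl, rfl⟩ | ⟨rfl, rfl⟩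
      · exact Or.inl ⟨rfl, rfl⟩
      · exact Or.inr ⟨rfl, rfl⟩

theorem split_flatWord {w : List Bool} {v₁ v₂ : List (Bool × Crossing)} {x : Bool}
    (h : flatWord w = v₁ ++ (x, .flat) :: v₂) :
    ∃ w₁ w₂, w = w₁ ++ x :: w₂ ∧ v₁ = flatWord w₁ ∧ v₂ = flatWord w₂ := by
  obtain ⟨w₁, w₂', rfl, rfl, h'⟩ := List.map_eq_append_iff.1 h
  obtain ⟨y, w₂, rfl, h', rfl⟩ := List.map_eq_cons_iff.1 h'
  obtain rfl : y = x := by simpa using h'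
  exact ⟨w₁, w₂, rfl, rfl, rfl⟩

/-- The crossing joins the two legs of the minimum, if necessary after a quarter turn at the
maximum, and is therefore a loop. -/
theorem wordDiagram_single (b e : Bool) {c : Crossing} (hc : c ≠ .flat) :
    Equivalent (wordDiagram b [(!e, c)] e) circle := by
  have key : ∀ d, d ≠ Crossing.flat → Equivalent (wordDiagram b [(b, d)] (!b)) circle := by
    intro d hd
    have h := wordDiagram_flip b [(b, d)] (!b)
    simp only [flip, Bool.not_not, List.map_cons, List.map_nil, List.reverse_singleton] at h
    exact h.trans ((wordDiagram_one_resolved (w := []) hd).trans (wordDiagram_nil b))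
  by_cases hbe : b = e
  · subst hbe
    exact (wordDiagram_turn b [] b c).trans (key _ (by simpa using hc))
  · obtain rfl : e = !b := by cases e <;> cases b <;> simp_all
    simpa using key c hc

/-- A resolution of the final crossing stays in the class, since its state is arbitrary. In a pair
of equal letters the partner is resolved oppositely, so that the pair cancels. -/
theorem Safe.reply {D D' : Diagram} (h : Safe D) (hD : IsOption D D') :
    Safe D' ∨ ∃ D'', IsOption D' D'' ∧ Safe D'' := by
  induction h generalizing D' with
  | circle D h =>
    have := hD.unresolved_eq
    rw [h.unresolved_eq] at this
    simp [KnotGame.circle] at this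
  | odd b u e c =>
    obtain ⟨v₁, v₂, x, d, hd, h, rfl⟩ := isOption_wordDiagram.1 hD
    rcases List.append_eq_append_iff.1 h with ⟨C, rfl, h2⟩ | ⟨C, h1, h2⟩
    · rcases C with _ | ⟨y, C⟩
      · simp only [List.nil_append, List.cons.injEq, Prod.mk.injEq] at h2
        obtain ⟨⟨rfl, rfl⟩, rfl⟩ := h2
        exact Or.inl (by simpa using Safe.odd b u e d)
      · simp at h2
    · rcases C with _ | ⟨y, C⟩
      · simp only [List.nil_append, List.cons.injEq, Prod.mk.injEq, List.append_nil] at h1 h2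
        obtain ⟨⟨rfl, rfl⟩, rfl⟩ := h2
        rw [← h1]
        exact Or.inl (Safe.odd b u e d)
      · simp only [List.cons_append, List.cons.injEq] at h2
        obtain ⟨rfl, rfl⟩ := h2
        obtain ⟨w₁, w₂, h3, rfl, rfl⟩ := split_flatWord h1
        obtain ⟨u₁, u₂, rfl, h4⟩ := split_double h3
        right
        have key : ∀ a, a ≠ Crossing.flat → Safe (wordDiagram b (flatWord (double u₁) ++
            [(x, a), (x, a.turn)] ++ (flatWord (double u₂) ++ [(!e, c)])) e) := fun a ha =>
          .equivalent _ _ (wordDiagram_cancel ha) (by simpa using Safe.odd b (u₁ ++ u₂) e c)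
        rcases h4 with ⟨rfl, rfl⟩ | ⟨rfl, rfl⟩
        · refine ⟨_, ?_, key d hd⟩
          exact isOption_wordDiagram.2 ⟨flatWord (double u₁) ++ [(x, d)],
            flatWord (double u₂) ++ [(!e, c)], x, d.turn, by simpa using hd, by simp, by simp⟩
        · refine ⟨_, ?_, key d.turn (by simpa using hd)⟩
          exact isOption_wordDiagram.2 ⟨flatWord (double u₁),
            (x, d) :: (flatWord (double u₂) ++ [(!e, c)]), x, d.turn, by simpa using hd, by simp,
            by simp⟩
  | equivalent P Q h _ ih =>
    obtain ⟨Q', h1, h2⟩ := h.option hD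
    rcases ih h1 with h3 | ⟨Q'', h3, h4⟩
    · exact Or.inl (.equivalent _ _ h2 h3)
    · obtain ⟨P'', h5, h6⟩ := h2.symm.option h3
      exact Or.inr ⟨P'', h5, .equivalent _ _ h6.symm h4⟩
  | one P Q h hQ ih =>
    rcases h.option_left hD with h | ⟨Q', h1, h2⟩
    · exact Or.inl (.equivalent _ _ h hQ)
    · rcases ih h1 with h3 | ⟨Q'', h3, h4⟩
      · exact Or.inl (.one _ _ h2 h3)
      · obtain ⟨P'', h5, h6⟩ := h2.option_right h3
        exact Or.inr ⟨P'', h5, .one _ _ h6 h4⟩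

/-- An unresolved final crossing may be resolved at will. If it is resolved, the crossing below it
is resolved so as to cancel it, and the partner of that crossing becomes the new, unresolved final
crossing. This is the tempo that makes the win independent of parity. -/
theorem Safe.exists_option {D : Diagram} (h : Safe D) (hD : unresolved D ≠ 0) :
    ∃ D', IsOption D D' ∧ Safe D' := by
  induction h with
  | circle D h => exact absurd h.unresolved_eq hD
  | odd b u e c =>
    by_cases hc : c = .flat
    · subst hc
      exact ⟨_, isOption_wordDiagram.2 ⟨flatWord (double u), [], !e, .rise, by simp, rfl, rfl⟩,
        .odd b u e .rise⟩
    · rcases List.eq_nil_or_concat' u with rfl | ⟨u, y, rfl⟩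
      · simp [wordDiagram, wordTangle, hc] at hD
      · have key : ∀ e d, d ≠ Crossing.flat → ∃ D', IsOption
            (wordDiagram b (flatWord (double u) ++ [(!e, .flat), (!e, .flat), (!e, d)]) e) D' ∧
              Safe D' := by
          intro e d hd
          refine ⟨_, isOption_wordDiagram.2 ⟨flatWord (double u) ++ [(!e, .flat)], [(!e, d)], !e,
            d.turn, by simpa using hd, by simp, rfl⟩, .equivalent _ _ ?_ (.odd b u e .flat)⟩
          have := wordDiagram_cancel (b := b) (e := e) (v := flatWord (double u) ++ [(!e, .flat)])
            (w := []) (x := !e) (c := d.turn) (by simpa using hd)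
          simpa using this
        by_cases hy : y = !e
        · subst hy
          simpa using key e c hc
        -- The last pair has the other letter; a quarter turn of the final crossing at the maximum
        -- makes the letters agree, so that the previous case applies.
        · obtain rfl : e = y := by cases e <;> cases y <;> simp_all
          obtain ⟨D', h1, h2⟩ := key (!e) c.turn (by simpa using hc)
          have h3 := wordDiagram_turn b (flatWord (double u) ++ [(e, .flat), (e, .flat)]) e c
          have h4 : wordDiagram b (flatWord (double (u ++ [e])) ++ [(!e, c)]) e =
              wordDiagram b (flatWord (double u) ++ [(e, .flat), (e, .flat)] ++ [(!e, c)]) e := by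
            simp
          rw [h4]
          simp only [Bool.not_not] at h1
          obtain ⟨D'', h5, h6⟩ := h3.symm.option (E := D') (by simpa using h1)
          exact ⟨D'', h5, .equivalent _ _ h6.symm h2⟩
  | equivalent P Q h _ ih =>
    obtain ⟨Q', h1, h2⟩ := ih (h.unresolved_eq ▸ hD)
    obtain ⟨P', h3, h4⟩ := h.symm.option h1
    exact ⟨P', h3, .equivalent _ _ h4.symm h2⟩
  | one P Q h hQ ih =>
    obtain ⟨P', h1, h2⟩ := h.exists_option
    exact ⟨P', h1, .equivalent _ _ h2 hQ⟩

theorem Safe.equivalent_circle {D : Diagram} (h : Safe D) (hD : unresolved D = 0) :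
    Equivalent D KnotGame.circle := by
  induction h with
  | circle D h => exact h
  | odd b u e c =>
    have h1 : unresolved (braid (flatWord (double u))) = (double u).length := by
      simpa [shadow, wordDiagram, wordTangle] using unresolved_shadow b (double u) e
    simp only [wordDiagram, wordTangle, unresolved_closure, unresolved_append, braid_append, h1,
      Nat.add_eq_zero_iff, List.length_eq_zero_iff] at hD
    rw [hD.1.2.1]
    refine wordDiagram_single b e fun hc => ?_
    simp [hc] at hD
  | equivalent P Q h _ ih => exact h.trans (ih (h.unresolved_eq ▸ hD))
  | one P Q h hQ ih =>
    rw [h.unresolved_eq] at hD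
    omega

/-! ### Rational diagrams as words -/

/-- The word of a rational tangle. -/
def runs : Bool → List ℕ → List Bool
  | _, [] => []
  | x, a :: l => List.replicate a x ++ runs (!x) l

/-- The position of the maximum that closes the word of a rational tangle. -/
def runsEnd : Bool → List ℕ → Bool
  | x, [] => x
  | x, _ :: l => runsEnd (!x) l

theorem isTangle_addRight {T : Diagram} (h : IsTangle 2 2 T) : IsTangle 2 2 (addRight T) :=
  ((isTangle_cup (i := 1) (m := 2) (by simp)).append (h.widen_right 2)).append
    (by simp [IsTangle, Piece.ins, Piece.outs])

theorem isTangle_addBelow {T : Diagram} (h : IsTangle 2 2 T) : IsTangle 2 2 (addBelow T) :=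
  (isTangle_cross (i := 0) (by simp)).append h

theorem isTangle_rationalTangle (x : Bool) (l : List ℕ) : IsTangle 2 2 (rationalTangle x l) := by
  induction l generalizing x with
  | nil => cases x <;> simp [rationalTangle, IsTangle, Piece.ins, Piece.outs]
  | cons a l ih =>
    cases x
    · rw [rationalTangle]
      induction a with
      | zero => exact ih _
      | succ a iha =>
        rw [Function.iterate_succ_apply']
        exact isTangle_addBelow iha
    · rw [rationalTangle]
      induction a with
      | zero => exact ih _
      | succ a iha =>
        rw [Function.iterate_succ_apply']
        exact isTangle_addRight iha

/-- After a quarter turn at the maxima, the added crossing slides down beside `T` and past the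
minimum. The arc that remains is a zigzag around `T` and is straightened. Thus a crossing added on
the right becomes a letter of the word below `T`. -/
theorem addRight_cap {T : Diagram} (hT : IsTangle 2 2 T) :
    TEq 3 1 (addRight T ++ [cap 1]) ([cross .flat 1] ++ T ++ [cap 1]) := by
  have hT' := hT.widen_right 3
  have hT1 := hT.widen_right 1
  have h1 : TEq 5 1 [cross .flat 2, cap 1, cap 1] [cross .flat 3, cap 2, cap 1] := by
    calc TEq 5 1 [cross .flat 2, cap 1, cap 1] [cross .flat 2, cap 3, cap 1] :=
          TEq.inside [cross .flat 2] [] (.exchange 1 0 .cap .cap)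
            (by simp [IsTangle, Piece.ins, Piece.outs]) (by simp [IsTangle, Piece.ins, Piece.outs])
      TEq 5 1 _ [cross .flat 3, cap 2, cap 1] :=
          TEq.append_right (B := [cap 1]) (turn_cap' (c := .flat) (i := 2) (m := 2) (by simp))
            (isTangle_cap (by simp))
  have h2 : TEq 3 5 ([cup 1] ++ T ++ [cross .flat 3]) ([cross .flat 1] ++ ([cup 1] ++ T)) := by
    have a1 : TEq 5 5 (T ++ [cross .flat 3]) ([cross .flat 3] ++ T) :=
      exchange_blocks hT (isTangle_cross (c := .flat) (i := 1) (m := 3) (by simp))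
    have a2 : TEq 3 5 [cup 1, cross .flat 3] [cross .flat 1, cup 1] :=
      TEq.of_move (.exchange 1 0 .cup (.cross .flat)) (by simp [IsTangle, Piece.ins, Piece.outs])
        (by simp [IsTangle, Piece.ins, Piece.outs])
    have a3 := a1.append_left (isTangle_cup (i := 1) (m := 3) (by simp))
    have a4 := a2.append_right (hT.widen_right 3)
    simp only [List.cons_append, List.nil_append] at a3 a4 ⊢
    exact a3.trans a4
  have h3 : TEq 3 3 ([cup 1] ++ T ++ [cap 2]) T := by
    have a1 : TEq 5 3 (T ++ [cap 2]) ([cap 2] ++ T) :=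
      exchange_blocks hT (isTangle_cap (i := 0) (m := 1) (by simp))
    have a3 := a1.append_left (isTangle_cup (i := 1) (m := 3) (by simp))
    have a4 := (zigzag_left (i := 1) (m := 3) (by simp)).append_right hT1
    simp only [List.cons_append, List.nil_append] at a3 a4 ⊢
    exact a3.trans a4
  have b1 := h1.append_left ((isTangle_cup (i := 1) (m := 3) (by simp)).append hT')
  have b2 := h2.append_right (B := [cap 2, cap 1]) (l := 1)
    (by simp [IsTangle, Piece.ins, Piece.outs])
  have b3 := h3.congr (isTangle_cross (c := .flat) (i := 1) (m := 3) (by simp))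
    (isTangle_cap (i := 1) (m := 1) (by simp))
  simp only [addRight, List.append_assoc, List.cons_append, List.nil_append] at b1 b2 b3 ⊢
  exact b1.trans (b2.trans b3)

/-- Joining the upper right end to a third strand makes twists on the right and twists at the bottom
crossings of neighbouring strands in a single word. Each reflection in the recursive definition
switches the letter. -/
theorem rationalTangle_cap (x : Bool) (l : List ℕ) : TEq 3 1 (rationalTangle x l ++ [cap 1])
    (braid (flatWord (runs x l)) ++ [cap (runsEnd x l).toNat]) := by
  induction l generalizing x with
  | nil =>
    cases x
    -- The reflected trivial tangle followed by the maximum straightens to `cap 0`; this determines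
    -- the value of `runsEnd` at the empty list.
    · exact TEq.inside [cap 0] [] (.zigzagLeft 0) (by simp [IsTangle, Piece.ins, Piece.outs])
        (by simp [IsTangle, Piece.ins, Piece.outs])
    · exact TEq.refl _
  | cons a l ih =>
    cases x
    · rw [rationalTangle, runs, runsEnd]
      induction a with
      | zero => exact ih _
      | succ a iha =>
        rw [Function.iterate_succ_apply']
        simpa [addBelow, List.replicate_succ] using
          iha.append_left (isTangle_cross (c := .flat) (i := 0) (m := 3) (by simp))
    · rw [rationalTangle, runs, runsEnd]
      induction a with
      | zero => exact ih _
      | succ a iha =>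
        rw [Function.iterate_succ_apply']
        have ht : IsTangle 2 2 (addRight^[a] (rationalTangle false l)) :=
          isTangle_rationalTangle true (a :: l)
        refine (addRight_cap ht).trans ?_
        simpa [List.replicate_succ] using
          iha.append_left (isTangle_cross (c := .flat) (i := 1) (m := 3) (by simp))

/-- The closed word differs from the closure of the tangle only in the arc on the right, where the
third strand makes a zigzag that can be straightened. -/
theorem rationalDiagram_equivalent (a : List ℕ) : Equivalent (rationalDiagram a)
    (shadow false (runs true a.reverse) (runsEnd true a.reverse)) := by
  set T := rationalTangle true a.reverse with hT
  have ht : IsTangle 2 2 T := isTangle_rationalTangle _ _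
  have h1 := TEq.closure ((rationalTangle_cap true a.reverse).append_left (isTangle_cup_bool false))
  rw [← hT] at h1
  have h1' : Equivalent (KnotGame.closure ([cup 0] ++ (T ++ [cap 1])))
      (shadow false (runs true a.reverse) (runsEnd true a.reverse)) := by
    simpa [shadow, wordDiagram, wordTangle] using h1
  refine Equivalent.trans (Equivalent.symm ?_) h1'
  have a1 : TEq 2 2 (shift 2 [cup 0] ++ T ++ [cap 1]) T := by
    have h2 := (exchange_blocks ht (isTangle_cup (i := 0) (m := 0) le_rfl)).symm.append_right
      (isTangle_cap (i := 1) (m := 2) (by simp))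
    have h3 := (zigzag_right (i := 1) (m := 2) (by simp)).append_left ht
    simp only [List.append_assoc, List.append_nil] at h2 h3 ⊢
    exact h2.trans h3
  have a2 := (cup_cup.symm.append_right (B := T ++ [cap 1, cap 0]) (l := 0)
    ((ht.widen_right 2).append (by simp [IsTangle, Piece.ins, Piece.outs])))
  have a3 := a1.congr (isTangle_cup (i := 0) (m := 0) le_rfl)
    (isTangle_cap (i := 0) (m := 0) le_rfl)
  have := (a2.trans (by simpa using a3)).equivalent
  simpa [KnotGame.closure, rationalDiagram, ← hT] using this

/-! ### Odd-even shadows -/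

theorem replicate_two_mul (n : ℕ) (x : Bool) :
    List.replicate (2 * n) x = double (List.replicate n x) := by
  induction n with
  | zero => rfl
  | succ n ih => simp [Nat.mul_succ, List.replicate_succ, ih]

theorem exists_runs_eq_double {l : List ℕ} (h : ∀ a ∈ l, Even a) (x : Bool) :
    ∃ u, runs x l = double u := by
  induction l generalizing x with
  | nil => exact ⟨[], rfl⟩
  | cons a l ih =>
    obtain ⟨u, hu⟩ := ih (fun b hb => h b (by simp [hb])) (!x)
    obtain ⟨k, hk⟩ := h a (by simp)
    exact ⟨List.replicate k x ++ u, by simp [runs, hu, hk, ← two_mul, replicate_two_mul]⟩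

theorem runs_concat (x : Bool) (l : List ℕ) (k : ℕ) :
    runs x (l ++ [k]) = runs x l ++ List.replicate k (runsEnd x l) := by
  induction l generalizing x with
  | nil => simp [runs, runsEnd]
  | cons a l ih => simp [runs, runsEnd, ih]

theorem runsEnd_concat (x : Bool) (l : List ℕ) (k : ℕ) :
    runsEnd x (l ++ [k]) = !runsEnd x l := by
  induction l generalizing x with
  | nil => simp [runsEnd]
  | cons a l ih => simp [runsEnd, ih]

theorem flipWord_double (u : List Bool) : flipWord (double u) = double (flipWord u) := by
  induction u with
  | nil => rfl
  | cons x u ih =>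
    simp only [flipWord, double_cons, List.map_cons, List.reverse_cons, double_append] at ih ⊢
    simp [ih]

/-- Even terms give doubled letters. An odd first term puts the unpaired letter at the top of the
word; an odd last term puts it at the bottom, and a half turn brings it to the top. -/
theorem IsOddEvenShadow.safe {O : Diagram} (h : IsOddEvenShadow O) : Safe O := by
  obtain ⟨k, b, ⟨m, rfl⟩, hb, h⟩ := h
  obtain ⟨u, hu⟩ := exists_runs_eq_double (l := b.reverse) (fun a ha => hb a (by simpa using ha)) true
  obtain ⟨u', hu'⟩ :=
    exists_runs_eq_double (l := b.reverse) (fun a ha => hb a (by simpa using ha)) false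
  rcases h with rfl | rfl
  · refine .equivalent _ _ (rationalDiagram_equivalent _) ?_
    rw [List.reverse_cons, runs_concat, runsEnd_concat, hu]
    have := Safe.odd false (u ++ List.replicate m (runsEnd true b.reverse))
      (!runsEnd true b.reverse) .flat
    rw [shadow, List.replicate_succ', replicate_two_mul]
    simpa using this
  · refine .equivalent _ _ ((rationalDiagram_equivalent _).trans (shadow_flip _ _ _)) ?_
    rw [List.reverse_append, List.reverse_singleton, List.singleton_append, runs, Bool.not_true, hu',
      List.replicate_succ, replicate_two_mul]
    have := Safe.odd (!runsEnd true ((2 * m + 1) :: b.reverse))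
      (flipWord (List.replicate m true ++ u')) true .flat
    rw [← flipWord_double] at this
    simpa [shadow, flipWord] using this

/-- A term 0 switches the letter without adding a crossing, so terms 0 and 2 suffice for any doubled
word and any required end. -/
theorem exists_even_runs (v : List Bool) (x e : Bool) :
    ∃ l : List ℕ, (∀ a ∈ l, Even a) ∧ runs x l = double v ∧ runsEnd x l = e := by
  induction v generalizing x with
  | nil =>
    by_cases h : x = e
    · exact ⟨[], by simp, rfl, h⟩
    · exact ⟨[0], by simp, rfl, by cases x <;> cases e <;> simp_all [runsEnd]⟩
  | cons y v ih =>
    obtain ⟨l, h1, h2, h3⟩ := ih (!y)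
    have hl : runs y (2 :: l) = double (y :: v) := by simp [runs, h2, List.replicate_succ]
    by_cases h : x = y
    · subst h
      exact ⟨2 :: l, by simpa using h1, hl, h3⟩
    · obtain rfl : y = !x := by cases x <;> cases y <;> simp_all
      exact ⟨0 :: 2 :: l, by simpa using h1, by simpa [runs] using hl, h3⟩

/-- A word that consists of doubled letters and one final letter is an odd-even shadow. -/
theorem exists_isOddEvenShadow (b : Bool) (u : List Bool) (e : Bool) :
    ∃ O, IsOddEvenShadow O ∧ Equivalent (shadow b (double u ++ [!e]) e) O := by
  have key : ∀ (v : List Bool) (e' : Bool), ∃ O, IsOddEvenShadow O ∧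
      Equivalent (shadow false (true :: double v) e') O := by
    intro v e'
    obtain ⟨l, h1, h2, h3⟩ := exists_even_runs v false e'
    refine ⟨rationalDiagram (l.reverse ++ [1]), ⟨1, l.reverse, odd_one, by simpa using h1,
      Or.inr rfl⟩, ?_⟩
    have := rationalDiagram_equivalent (l.reverse ++ [1])
    simp only [List.reverse_append, List.reverse_singleton, List.reverse_reverse,
      List.singleton_append, runs, runsEnd, Bool.not_true, h2, h3, List.replicate_one] at this
    exact this.symm
  have hf := shadow_flip b (double u ++ [!e]) e
  have hw : flipWord (double u ++ [!e]) = e :: double (flipWord u) := by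
    rw [← flipWord_double]
    simp [flipWord]
  rw [hw] at hf
  obtain ⟨O, h1, h2⟩ := key (flipWord u) (!b)
  refine ⟨O, h1, hf.trans ?_⟩
  -- The single bottom letter is turned at the minimum if the minimum is not at the position
  -- prescribed by `rationalDiagram`.
  cases e
  · exact (shadow_turn_bottom true _ _).trans h2
  · exact h2

/-! ### The determinant of a word -/

/-- The sign with which a crossing twists two strands. -/
def Crossing.sign : Crossing → ℤ
  | fall => -1
  | _ => 1

/-- The colors of three strands. -/
abbrev Colors (R : Type*) := R × R × R

/-- The colors after `t` twists. -/
def twist {R : Type*} [Ring R] (x : Bool) (t : R) (v : Colors R) : Colors R :=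
  match x with
  | false => (v.1 + t * (v.1 - v.2.1), v.2.1 + t * (v.1 - v.2.1), v.2.2)
  | true => (v.1, v.2.1 + t * (v.2.1 - v.2.2), v.2.2 + t * (v.2.1 - v.2.2))

/-- The colors above a minimum, if the through strand has color zero. -/
def startColors {R : Type*} [Ring R] (b : Bool) (a : R) : Colors R :=
  match b with
  | false => (a, a, 0)
  | true => (0, a, a)

/-- The condition for closing with a maximum. -/
def defect {R : Type*} [Ring R] (e : Bool) (v : Colors R) : R :=
  match e with
  | false => v.1 - v.2.1
  | true => v.2.1 - v.2.2

/-- A twist adds the same multiple of the difference to both colors and so preserves the difference;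
successive twists in one position therefore add up. -/
theorem twist_twist {R : Type*} [CommRing R] (x : Bool) (s t : R) (v : Colors R) :
    twist x t (twist x s v) = twist x (s + t) v := by
  cases x <;> simp only [twist] <;> ext <;> simp <;> ring

theorem twist_zero {R : Type*} [Ring R] (x : Bool) (v : Colors R) : twist x 0 v = v := by
  cases x <;> simp [twist]

/-- The colors above a word. -/
def wordColors {R : Type*} [Ring R] (w : List (Bool × Crossing)) (v : Colors R) : Colors R :=
  w.foldl (fun v x => twist x.1 (x.2.sign : R) v) v

/-- The determinant of the closed diagram of a word. -/
def wordDet (b : Bool) (w : List (Bool × Crossing)) (e : Bool) : ℤ :=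
  defect e (wordColors w (startColors b 1))

theorem eval_braid {p : ℕ} [NeZero p] (w : List (Bool × Crossing)) (f : List (ZMod p) → ℕ)
    (v : Colors (ZMod p)) :
    eval (braid w) f [v.1, v.2.1, v.2.2] =
      f [(wordColors w v).1, (wordColors w v).2.1, (wordColors w v).2.2] := by
  induction w generalizing v with
  | nil => rfl
  | cons x w ih =>
    rw [braid_cons, eval, wordColors, List.foldl_cons]
    have := ih (twist x.1 (x.2.sign : ZMod p) v)
    rw [wordColors] at this
    rw [← this]
    obtain ⟨x, c⟩ := x
    cases x <;> cases c <;>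
      simp only [Bool.toNat_false, Bool.toNat_true, pieceEval, baseEval, twist, Crossing.sign] <;>
      congr 2 <;> push_cast <;> ring_nf

/-- The coloring rules are linear with integer coefficients, so one integral computation serves for
every modulus and every color of the minimum. -/
theorem wordColors_smul {p : ℕ} (w : List (Bool × Crossing)) (v : Colors ℤ) (a : ZMod p) :
    wordColors w (v.1 * a, v.2.1 * a, v.2.2 * a) =
      ((wordColors w v).1 * a, (wordColors w v).2.1 * a, (wordColors w v).2.2 * a) := by
  induction w generalizing v with
  | nil => rfl
  | cons x w ih =>
    rw [wordColors, wordColors, List.foldl_cons, List.foldl_cons, ← wordColors, ← wordColors, ← ih]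
    congr 1
    obtain ⟨x, c⟩ := x
    cases x <;> simp only [twist] <;> ext <;> push_cast <;> ring

/-- With color zero on the through strand, the color `a` of the minimum determines all others, and
the two strands at the maximum differ by `a` times the determinant, up to reduction. If this
vanishes, each of the p choices of `a` is admissible. -/
theorem multiplicity_wordTangle {p : ℕ} [NeZero p] (b : Bool) (w : List (Bool × Crossing)) (e : Bool)
    (h : (wordDet b w e : ZMod p) = 0) : multiplicity p (wordTangle b w e) = p := by
  have hclose : ∀ v : Colors (ZMod p), defect e v = 0 →
      eval [cap e.toNat] (fun _ => 1) [v.1, v.2.1, v.2.2] = 1 := by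
    intro v hv
    cases e <;> simp only [defect, sub_eq_zero] at hv <;> simp [eval, pieceEval, baseEval, hv]
  have hstart : ∀ a : ZMod p, eval (braid w) (eval [cap e.toNat] fun _ => 1)
      [(startColors b a).1, (startColors b a).2.1, (startColors b a).2.2] = 1 := by
    intro a
    rw [eval_braid]
    refine hclose _ ?_
    have h1 := wordColors_smul w (startColors b 1) a
    have h2 : startColors b a = (((startColors b (1 : ℤ)).1 : ZMod p) * a,
        ((startColors b (1 : ℤ)).2.1 : ZMod p) * a, ((startColors b (1 : ℤ)).2.2 : ZMod p) * a) := by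
      cases b <;> simp [startColors]
    rw [h2, h1]
    have h3 : (wordDet b w e : ZMod p) * a = 0 := by rw [h, zero_mul]
    rw [← h3, wordDet]
    cases e <;> simp only [defect] <;> push_cast <;> ring
  rw [multiplicity, wordTangle, List.append_assoc, eval_append, eval_append]
  have : ∀ f : List (ZMod p) → ℕ, eval [cup b.toNat] f [0] = ∑ a : ZMod p,
      f [(startColors b a).1, (startColors b a).2.1, (startColors b a).2.2] := by
    intro f
    cases b <;> rfl
  rw [this, Finset.sum_congr rfl fun a _ => hstart a]
  simp [ZMod.card]

/-- A determinant whose absolute value is not 1 has a prime divisor p, also when it is zero, and for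
this p there are p * p colorings instead of p. -/
theorem knotted_wordDiagram {b : Bool} {w : List (Bool × Crossing)} {e : Bool}
    (h : (wordDet b w e).natAbs ≠ 1) : Knotted (wordDiagram b w e) := by
  obtain ⟨p, hp, hdvd⟩ := Nat.exists_prime_and_dvd h
  have : NeZero p := ⟨hp.ne_zero⟩
  refine ⟨p, this, ?_⟩
  rw [wordDiagram, colorings_closure (isTangle_wordTangle _ _ _), multiplicity_wordTangle]
  · have := hp.two_le
    nlinarith
  · rw [ZMod.intCast_zmod_eq_zero_iff_dvd]
    exact Int.natCast_dvd.2 hdvd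

/-! ### The game on runs of crossings -/

/-- Runs of crossings with alternating letters. -/
def runWord : Bool → List (List Crossing) → List (Bool × Crossing)
  | _, [] => []
  | x, r :: rs => (r.map fun c => (x, c)) ++ runWord (!x) rs

/-- The number of twists made so far, and the number of unresolved crossings, of a run. -/
def runState (r : List Crossing) : ℤ × ℕ :=
  ((r.map fun c => if c = .flat then 0 else c.sign).sum, r.count .flat)

/-- Resolve a crossing of the `i`-th run. -/
def resolve : ℕ → Bool → List (ℤ × ℕ) → Option (List (ℤ × ℕ))
  | _, _, [] => none
  | 0, _, (_, 0) :: _ => none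
  | 0, s, (t, n + 1) :: l => some ((t + if s then 1 else -1, n) :: l)
  | i + 1, s, r :: l => (resolve i s l).map (r :: ·)

/-- The colors above some runs. -/
def runColors : Bool → List (ℤ × ℕ) → Colors ℤ → Colors ℤ
  | _, [], v => v
  | x, r :: l, v => runColors (!x) l (twist x r.1 v)

/-- A search for a winning strategy of the Knotter, moving second.  The first entry of a state
counts the passes; `replies` lists moves to be tried after those in the run of the last move. -/
def search (b x e : Bool) (replies : List (ℕ × Bool)) : ℕ → List (ℤ × ℕ) → Bool
  | 0, l => (defect e (runColors x l.tail (startColors b 1))).natAbs != 1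
  | n + 1, l => (List.range l.length).all fun i => [true, false].all fun s =>
      match resolve i s l with
      | none => true
      | some l' => ((i, s) :: (i, !s) :: replies).any fun r =>
          match resolve r.1 r.2 l' with
          | none => false
          | some l'' => search b x e replies n l''

/-- The sum of the signs and the number of unresolved crossings do not depend on the place within
the run, so play on words projects to play on these pairs. -/
theorem resolve_of_option {r : List Crossing} {r₁ r₂ : List Crossing} {c : Crossing}
    (hc : c ≠ .flat) (h : r = r₁ ++ .flat :: r₂) (l : List (ℤ × ℕ)) :
    resolve 0 (c = .rise) (runState r :: l) = some (runState (r₁ ++ c :: r₂) :: l) := by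
  subst h
  have h1 : runState (r₁ ++ .flat :: r₂) =
      ((runState (r₁ ++ c :: r₂)).1 - c.sign, (runState (r₁ ++ c :: r₂)).2 + 1) := by
    simp only [runState, List.map_append, List.sum_append, List.map_cons, List.sum_cons,
      List.count_append, List.count_cons]
    cases c
    · exact absurd rfl hc
    all_goals
      simp [Crossing.sign, add_comm, add_left_comm, add_assoc]
  rw [h1, resolve]
  cases c
  · exact absurd rfl hc
  all_goals simp [Crossing.sign]

theorem exists_resolve {x : Bool} {rs : List (List Crossing)} {v₁ v₂ : List (Bool × Crossing)}
    {z : Bool} {c : Crossing} (hc : c ≠ .flat) (h : runWord x rs = v₁ ++ (z, .flat) :: v₂) :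
    ∃ i s rs', i < rs.length ∧ v₁ ++ (z, c) :: v₂ = runWord x rs' ∧
      resolve i s (rs.map runState) = some (rs'.map runState) := by
  induction rs generalizing x v₁ with
  | nil => simp [runWord] at h
  | cons r rs ih =>
    rw [runWord] at h
    have first : ∀ C, r.map (fun c => (x, c)) = v₁ ++ (z, .flat) :: C → v₂ = C ++ runWord (!x) rs →
        ∃ i s rs', i < (r :: rs).length ∧ v₁ ++ (z, c) :: v₂ = runWord x rs' ∧
          resolve i s ((r :: rs).map runState) = some (rs'.map runState) := by
      rintro C h1 rfl
      obtain ⟨r₁, r', rfl, rfl, h2⟩ := List.map_eq_append_iff.1 h1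
      obtain ⟨d, r₂, rfl, h3, rfl⟩ := List.map_eq_cons_iff.1 h2
      obtain ⟨rfl, rfl⟩ : x = z ∧ d = .flat := by simpa using h3
      exact ⟨0, _, (r₁ ++ c :: r₂) :: rs, by simp, by simp [runWord],
        resolve_of_option hc rfl _⟩
    rcases List.append_eq_append_iff.1 h with ⟨C, rfl, h2⟩ | ⟨C, h1, h2⟩
    · obtain ⟨i, s, rs', hi, h3, h4⟩ := ih h2
      exact ⟨i + 1, s, r :: rs', by simpa using hi, by simp [runWord, ← h3], by simp [resolve, h4]⟩
    · rcases C with _ | ⟨y, C⟩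
      · simp only [List.nil_append, List.append_nil] at h1 h2
        obtain ⟨i, s, rs', hi, h3, h4⟩ := ih (v₁ := []) h2.symm
        exact ⟨i + 1, s, r :: rs', by simpa using hi, by simp [runWord, ← h3, h1],
          by simp [resolve, h4]⟩
      · simp only [List.cons_append, List.cons.injEq] at h2
        obtain ⟨rfl, rfl⟩ := h2
        exact first C h1 rfl

theorem exists_option_of_resolve {x : Bool} {rs : List (List Crossing)} {i : ℕ} {s : Bool}
    {l : List (ℤ × ℕ)} (h : resolve i s (rs.map runState) = some l) :
    ∃ rs' v₁ v₂ z c, c ≠ Crossing.flat ∧ runWord x rs = v₁ ++ (z, .flat) :: v₂ ∧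
      runWord x rs' = v₁ ++ (z, c) :: v₂ ∧ l = rs'.map runState := by
  induction rs generalizing x i l with
  | nil => cases i <;> simp [resolve] at h
  | cons r rs ih =>
    cases i with
    | zero =>
      have hr : Crossing.flat ∈ r := by
        by_contra hr
        rw [List.map_cons, show runState r = ((runState r).1, 0) by
          rw [← List.count_eq_zero.2 hr]; rfl] at h
        simp [resolve] at h
      obtain ⟨r₁, r₂, rfl⟩ := List.append_of_mem hr
      obtain ⟨c, hc, rfl⟩ : ∃ c : Crossing, c ≠ .flat ∧ s = (c = .rise : Bool) := by
        cases s
        · exact ⟨.fall, by simp, by simp⟩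
        · exact ⟨.rise, by simp, by simp⟩
      refine ⟨(r₁ ++ c :: r₂) :: rs, r₁.map (fun c => (x, c)),
        r₂.map (fun c => (x, c)) ++ runWord (!x) rs, x, c, hc, by simp [runWord],
        by simp [runWord], ?_⟩
      rw [List.map_cons, resolve_of_option hc rfl] at h
      simpa using h.symm
    | succ i =>
      simp only [List.map_cons, resolve, Option.map_eq_some_iff] at h
      obtain ⟨l', h, rfl⟩ := h
      obtain ⟨rs', v₁, v₂, z, c, hc, h1, h2, rfl⟩ := ih (x := !x) h
      exact ⟨r :: rs', r.map (fun c => (x, c)) ++ v₁, v₂, z, c, hc, by simp [runWord, h1],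
        by simp [runWord, h2], rfl⟩

theorem wordColors_runWord {x : Bool} {rs : List (List Crossing)}
    (h : ∀ r ∈ rs, Crossing.flat ∉ r) (v : Colors ℤ) :
    wordColors (runWord x rs) v = runColors x (rs.map runState) v := by
  induction rs generalizing x v with
  | nil => rfl
  | cons r rs ih =>
    have h1 : ∀ v, wordColors (r.map fun c => (x, c)) v = twist x (runState r).1 v := by
      have hr := h r (by simp)
      clear h ih
      induction r with
      | nil => exact fun v => (twist_zero x v).symm
      | cons c r ihr =>
        intro v
        simp only [List.mem_cons, not_or] at hr
        have h2 := ihr hr.2 (twist x c.sign v)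
        rw [twist_twist] at h2
        have h3 : (runState (c :: r)).1 = c.sign + (runState r).1 := by
          simp [runState, Ne.symm hr.1]
        rw [h3, ← h2]
        rfl
    rw [runWord, List.map_cons, runColors, ← ih (fun r hr => h r (by simp [hr])), ← h1]
    exact List.foldl_append

theorem unresolved_wordDiagram (b : Bool) (w : List (Bool × Crossing)) (e : Bool) :
    unresolved (wordDiagram b w e) = w.countP fun x => x.2 = .flat := by
  have : unresolved (braid w) = w.countP fun x => x.2 = .flat := by
    induction w with
    | nil => rfl
    | cons x w ih => simp [ih, List.countP_cons]
  simp [wordDiagram, wordTangle, this]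

/-- Soundness of the search: every move of the opponent is a move on the state, and the reply found
there lifts to the word, or to a pass if it concerns the first entry. The list `replies` only
restricts which answers are tried, so it cannot invalidate the conclusion. -/
theorem Second.of_search {b x e : Bool} {replies : List (ℕ × Bool)} {n : ℕ}
    {rs : List (List Crossing)} {t : ℤ} {k : ℕ}
    (h : search b x e replies n ((t, k) :: rs.map runState) = true)
    (hn : k + unresolved (wordDiagram b (runWord x rs) e) = 2 * n) :
    Second n k (wordDiagram b (runWord x rs) e) := by
  induction n generalizing t k rs with
  | zero =>
    refine ⟨by omega, by omega, knotted_wordDiagram ?_⟩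
    have h0 : (runWord x rs).countP (fun x => x.2 = .flat) = 0 := by
      rw [← unresolved_wordDiagram b _ e]
      omega
    rw [wordDet, wordColors_runWord]
    · simpa [search] using h
    · intro r hr hf
      rw [List.countP_eq_zero] at h0
      clear h hn
      induction rs generalizing x with
      | nil => simp at hr
      | cons r' rs ih =>
        rcases List.mem_cons.1 hr with rfl | hr
        · exact absurd (h0 (x, .flat) (by simp [runWord, hf])) (by simp)
        · exact ih (x := !x) (fun y hy => h0 y (by simp [runWord, hy])) hr
  | succ n ih =>
    have step : ∀ i s l', i < rs.length + 1 → resolve i s ((t, k) :: rs.map runState) = some l' →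
        ∃ (r : ℕ × Bool) (l'' : _), resolve r.1 r.2 l' = some l'' ∧
          search b x e replies n l'' = true := by
      intro i s l' hi h1
      simp only [search, List.all_eq_true, List.mem_range] at h
      have h2 := h i (by simpa using hi) s (by cases s <;> simp)
      rw [h1] at h2
      simp only [List.any_eq_true] at h2
      obtain ⟨r, -, h3⟩ := h2
      cases h4 : resolve r.1 r.2 l' with
      | none => simp [h4] at h3
      | some l'' => exact ⟨r, l'', h4, by simpa [h4] using h3⟩
    have reply : ∀ {t' k' rs' i s}, i < rs.length + 1 →
        resolve i s ((t, k) :: rs.map runState) = some ((t', k') :: rs'.map runState) →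
        PassMove k (wordDiagram b (runWord x rs) e) k' (wordDiagram b (runWord x rs') e) →
        ∃ k'' D'', PassMove k' (wordDiagram b (runWord x rs') e) k'' D'' ∧ Second n k'' D'' := by
      intro t' k' rs' i s hi h1 hm
      obtain ⟨⟨j, s'⟩, l'', h2, h3⟩ := step _ _ _ hi h1
      have e1 := hm.count
      cases j with
      | zero =>
        cases k' with
        | zero => simp [resolve] at h2
        | succ k' =>
          simp only [resolve, Option.some.injEq] at h2
          subst h2
          exact ⟨k', _, Or.inl ⟨rfl, rfl⟩, ih h3 (by omega)⟩
      | succ j =>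
        simp only [resolve, Option.map_eq_some_iff] at h2
        obtain ⟨l, h2, rfl⟩ := h2
        obtain ⟨rs'', v₁, v₂, z, c, hc, h4, h5, rfl⟩ := exists_option_of_resolve (x := x) h2
        have hm' : PassMove k' (wordDiagram b (runWord x rs') e) k'
            (wordDiagram b (runWord x rs'') e) :=
          Or.inr ⟨rfl, isOption_wordDiagram.2 ⟨v₁, v₂, z, c, hc, h4, by rw [h5]⟩⟩
        have e2 := hm'.count
        exact ⟨k', _, hm', ih h3 (by omega)⟩
    rintro k' D' (⟨rfl, rfl⟩ | ⟨rfl, hD⟩)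
    -- The sign recorded for a pass is never evaluated, so `true` is an arbitrary choice.
    · exact reply (i := 0) (s := true) (by omega) rfl (Or.inl ⟨rfl, rfl⟩)
    · obtain ⟨v₁, v₂, z, c, hc, h1, rfl⟩ := isOption_wordDiagram.1 hD
      obtain ⟨i, s, rs', hi, h2, h3⟩ := exists_resolve hc h1
      rw [h2] at hD ⊢
      exact reply (t' := t) (i := i + 1) (s := s) (by omega) (by simp [resolve, h3])
        (Or.inr ⟨rfl, hD⟩)

/-- The word with runs of the given lengths. -/
def runLengths (l : List ℕ) : List (List Crossing) := l.map fun a => List.replicate a .flat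

/-- The moves tried in the search for a strategy. -/
def standardReplies (m n : ℕ) : List (ℕ × Bool) :=
  (0, true) :: (m, true) :: (m, false) ::
    (List.range n).flatMap fun i => [(i, true), (i, false)]

/-- By `KnotterSecond.of_second` only one number of passes has to be searched, namely the one in {0,
1} that makes the number of moves even. -/
theorem KnotterSecond.of_search {b x e : Bool} {replies : List (ℕ × Bool)} {l : List ℕ} (k n : ℕ)
    (hk : k ≤ 1) (hn : k + l.sum = 2 * n)
    (h : search b x e replies n ((0, k) :: l.map fun a => (0, a)) = true) :
    KnotterSecond (shadow b (runs x l) e) := by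
  have h1 : flatWord (runs x l) = runWord x (runLengths l) := by
    clear h hn
    induction l generalizing x with
    | nil => rfl
    | cons a l ih =>
      rw [runs, flatWord_append, ih]
      simp [flatWord, runLengths, runWord]
  have h2 : (l.map fun a => ((0 : ℤ), a)) = (runLengths l).map runState := by
    simp [runLengths, runState, Function.comp_def]
  have h3 : (runs x l).length = l.sum := by
    clear h h1 h2 hn
    induction l generalizing x with
    | nil => rfl
    | cons a l ih => simp [runs, ih]
  have h4 : k + unresolved (shadow b (runs x l) e) = 2 * n := by
    rw [unresolved_shadow, h3, hn]
  refine .of_second hk h4 ?_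
  rw [shadow, h1] at h4 ⊢
  rw [h2] at h
  exact .of_search h h4

/-! ### Strategies for the four minimal words. -/

theorem knotterSecond_two_two (b : Bool) :
    KnotterSecond (shadow b [!b, !b, b, b] (!b)) := by
  have h := KnotterSecond.of_search (b := b) (x := !b) (e := !b) (l := [2, 2])
    (replies := standardReplies 1 3) 0 2 (by simp) rfl (by cases b <;> decide +kernel)
  simpa [runs, List.replicate_succ] using h

theorem knotterSecond_two_one_one_two (b : Bool) :
    KnotterSecond (shadow b [!b, !b, b, !b, b, b] (!b)) := by
  have h := KnotterSecond.of_search (b := b) (x := !b) (e := !b) (l := [2, 1, 1, 2])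
    (replies := standardReplies 2 5) 0 3 (by simp) rfl (by cases b <;> decide +kernel)
  simpa [runs, List.replicate_succ] using h

/-- Only one position of the minimum is searched; a half turn of the diagram gives the other. With
seven crossings, one pass makes the number of moves even. -/
theorem knotterSecond_three_one_three (b : Bool) :
    KnotterSecond (shadow b [!b, !b, !b, b, !b, !b, !b] b) := by
  have h := KnotterSecond.of_search (b := false) (x := true) (e := false) (l := [3, 1, 3])
    (replies := standardReplies 2 4) 1 4 (by simp) rfl (by decide +kernel)
  cases b
  · simpa [runs, List.replicate_succ] using h
  · exact h.equivalent (shadow_flip _ _ _)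

theorem knotterSecond_two_two_one_two_two (b : Bool) :
    KnotterSecond (shadow b [!b, !b, b, b, !b, b, b, !b, !b] b) := by
  have h := KnotterSecond.of_search (b := false) (x := true) (e := false) (l := [2, 2, 1, 2, 2])
    (replies := standardReplies 3 6) 1 5 (by simp) rfl (by decide +kernel)
  cases b
  · simpa [runs, List.replicate_succ] using h
  · exact h.equivalent (shadow_flip _ _ _)

/-! ### Classification of words -/

/-- The diagram reduces to an odd-even shadow. -/
def ReducesToOddEven (D : Diagram) : Prop := ∃ O, IsOddEvenShadow O ∧ ReducesByOne D O

/-- The Knotter wins if he makes the last move, or the diagram is not a knot. -/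
def Hard (D : Diagram) : Prop := KnotterSecond D ∨ 2 < colorings 2 D

theorem ReducesToOddEven.of_reducesByOne {P Q : Diagram} (hQ : ReducesToOddEven Q)
    (h : ReducesByOne P Q) : ReducesToOddEven P := by
  obtain ⟨O, h1, h2⟩ := hQ
  exact ⟨O, h1, h.trans h2⟩

theorem Hard.of_reduces {P Q : Diagram} (hQ : Hard Q) (h : Reduces P Q) : Hard P :=
  hQ.imp (fun hQ => hQ.of_reduces h) fun hQ => h.colorings_two ▸ hQ

theorem outcome_of_reducesByOne {P Q : Diagram} (h : ReducesByOne P Q)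
    (hQ : ReducesToOddEven Q ∨ Hard Q) : ReducesToOddEven P ∨ Hard P :=
  hQ.imp (fun hQ => hQ.of_reducesByOne h) fun hQ => hQ.of_reduces h.reduces

theorem reducesToOddEven_double_append (b : Bool) (u : List Bool) (e : Bool) :
    ReducesToOddEven (shadow b (double u ++ [!e]) e) := by
  obtain ⟨O, h1, h2⟩ := exists_isOddEvenShadow b u e
  exact ⟨O, h1, h2.reducesByOne⟩

theorem reducesToOddEven_cons_double (b : Bool) (u : List Bool) (e : Bool) :
    ReducesToOddEven (shadow b ((!b) :: double u) e) := by
  refine (reducesToOddEven_double_append (!e) (flipWord u) (!b)).of_reducesByOne ?_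
  have := (shadow_flip b ((!b) :: double u) e).reducesByOne
  rw [← flipWord_double]
  simpa [flipWord] using this

theorem shadow_replicate_top (b : Bool) (w : List Bool) (e : Bool) (n : ℕ) :
    ReducesByOne (shadow b (w ++ List.replicate n e) e) (shadow b w e) := by
  induction n with
  | zero => simpa using ReducesByOne.refl _
  | succ n ih =>
    have := shadow_one_top b (w ++ List.replicate n e) e
    rw [List.append_assoc, ← List.replicate_succ'] at this
    exact this.trans ih

/-- The crossings are deleted as loops at the maximum until one is left. It must not be deleted as
well, because an odd-even shadow has a crossing; instead it is turned at the minimum. -/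
theorem reducesToOddEven_replicate (b : Bool) (n : ℕ) :
    ReducesToOddEven (shadow b (List.replicate (n + 1) (!b)) (!b)) := by
  have h := shadow_replicate_top b [!b] (!b) n
  rw [List.singleton_append, ← List.replicate_succ] at h
  refine ReducesToOddEven.of_reducesByOne ?_ h
  refine ReducesToOddEven.of_reducesByOne ?_ (shadow_turn_bottom b [] (!b)).reducesByOne
  simpa using reducesToOddEven_double_append (!b) [] (!b)

/-- Dropping a letter of `u` deletes a bigon. This makes it possible to keep only the doubled
letters that matter and leaves finitely many words to be examined. -/
theorem shadow_double_sublist {u' u : List Bool} (h : u'.Sublist u) (b : Bool) (s t : List Bool)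
    (e : Bool) :
    Reduces (shadow b (s ++ double u ++ t) e) (shadow b (s ++ double u' ++ t) e) := by
  induction h generalizing s with
  | slnil => exact .refl _
  | cons x _ ih => exact (by simpa using shadow_two b s _ x e : Reduces _ _).trans (ih s)
  | cons_cons x _ ih => simpa using ih (s ++ [x, x])

theorem shadow_replicate_two (b : Bool) (s t : List Bool) (x : Bool) (n k : ℕ) (e : Bool) :
    Reduces (shadow b (s ++ List.replicate (k + 2 * n) x ++ t) e)
      (shadow b (s ++ List.replicate k x ++ t) e) := by
  have := shadow_double_sublist (List.nil_sublist (List.replicate n x)) b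
    (s ++ List.replicate k x) t e
  simpa [List.replicate_add, replicate_two_mul] using this

theorem hard_double_self (b : Bool) (u : List Bool) : Hard (shadow b (double u) b) := by
  have := shadow_double_sublist (List.nil_sublist u) b [] [] b
  simp only [List.nil_append, List.append_nil, double_nil] at this
  exact Hard.of_reduces (Or.inr (by rw [colorings_shadow_nil]; omega)) this

theorem hard_double_not {b : Bool} {u : List Bool} (h : b ∈ u) :
    Hard (shadow b (double ((!b) :: u)) (!b)) := by
  have := shadow_double_sublist ((List.singleton_sublist.2 h).cons_cons (!b)) b [] [] (!b)
  simp only [List.nil_append, List.append_nil] at this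
  exact Hard.of_reduces (Or.inl (knotterSecond_two_two b)) this

/-- If the maximum is above the minimum, all pairs cancel and a link of two circles remains;
otherwise a doubled `b` survives and gives the minimal word (2,2). -/
theorem hard_double_append {b x : Bool} {u : List Bool} (h : x = b ∨ b ∈ u) :
    Hard (shadow b (double ((!b) :: u)) x) := by
  rcases Bool.eq_or_eq_not x b with rfl | rfl
  · exact hard_double_self _ _
  · exact hard_double_not (h.resolve_left (by simp))

theorem hard_double_append' {b x : Bool} {u : List Bool} (h : x = b ∨ b ∈ u) :
    Hard (shadow b (double ((!b) :: (u ++ [x]))) (!x)) := by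
  rcases Bool.eq_or_eq_not x b with rfl | rfl
  · exact hard_double_not (by simp)
  · simpa using hard_double_self b ((!b) :: (u ++ [!b]))

theorem eq_replicate_of_not_mem {b : Bool} {u : List Bool} (h : b ∉ u) :
    u = List.replicate u.length (!b) :=
  List.eq_replicate_of_mem fun x hx => (Bool.eq_or_eq_not x b).resolve_left fun e => h (e ▸ hx)

/-- Normal forms of the lower part of a word. -/
inductive NormalForm (b : Bool) : List Bool → Prop
  | loop : NormalForm b [b]
  | single : NormalForm b [!b]
  | even (u : List Bool) : NormalForm b (double ((!b) :: u))
  | odd (u : List Bool) (x : Bool) : NormalForm b (double ((!b) :: u) ++ [x])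
  | tail (u : List Bool) (x : Bool) (j : ℕ) : x = b ∨ b ∈ u →
      NormalForm b (double ((!b) :: u) ++ [x] ++ List.replicate (j + 1) (!x))
  | consEven (u : List Bool) : b ∈ u → NormalForm b ((!b) :: double ((!b) :: u))
  | consOdd (u : List Bool) (x : Bool) : x = b ∨ b ∈ u →
      NormalForm b ((!b) :: double ((!b) :: u) ++ [x])
  | consTail (u : List Bool) (x : Bool) (j : ℕ) : x = b ∨ b ∈ u →
      NormalForm b ((!b) :: double ((!b) :: u) ++ [x, !x] ++ List.replicate j x)

/-! #### The words on which the Unknotter cannot win any more -/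

/-- The words in which the search for a reduction ends. -/
def isMinimalWord (b : Bool) (w : List Bool) (e : Bool) : Bool :=
  (w, e) ∈ [([!b, !b, b, b], !b), ([!b, !b, b, !b, b, b], !b), ([!b, !b, !b, b, !b, !b, !b], b),
    ([!b, !b, b, b, !b, b, b, !b, !b], b)]

/-- Deletions of equal neighbours. -/
def bigons : List Bool → List (List Bool)
  | x :: y :: w => (if x = y then [w] else []) ++ (bigons (y :: w)).map (x :: ·)
  | _ => []

/-- A search for a reduction to a minimal word. -/
def minimalSearch : ℕ → Bool → List Bool → Bool → Bool
  | 0, b, w, e => isMinimalWord b w e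
  | n + 1, b, w, e => isMinimalWord b w e ||
      ((bigons w).any fun w' => minimalSearch n b w' e) ||
      (match w with
        | [] => false
        | x :: w => if x = b then minimalSearch n b w e else minimalSearch n (!b) (b :: w) e) ||
      (match w.reverse with
        | [] => false
        | x :: v => if x = e then minimalSearch n b v.reverse e
          else minimalSearch n b (v.reverse ++ [e]) (!e))

theorem knotterSecond_of_isMinimalWord {b : Bool} {w : List Bool} {e : Bool}
    (h : isMinimalWord b w e = true) : KnotterSecond (shadow b w e) := by
  simp only [isMinimalWord, List.mem_cons, Prod.mk.injEq, List.not_mem_nil, or_false,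
    decide_eq_true_eq] at h
  rcases h with ⟨rfl, rfl⟩ | ⟨rfl, rfl⟩ | ⟨rfl, rfl⟩ | ⟨rfl, rfl⟩
  · exact knotterSecond_two_two b
  · exact knotterSecond_two_one_one_two b
  · exact knotterSecond_three_one_three _
  · exact knotterSecond_two_two_one_two_two _

theorem exists_of_mem_bigons {w w' : List Bool} (h : w' ∈ bigons w) :
    ∃ s x t, w = s ++ [x, x] ++ t ∧ w' = s ++ t := by
  induction w generalizing w' with
  | nil => simp [bigons] at h
  | cons x w ih =>
    cases w with
    | nil => simp [bigons] at h
    | cons y w =>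
      simp only [bigons, List.mem_append, List.mem_map] at h
      rcases h with h | ⟨v, h, rfl⟩
      · split at h
        · rename_i hxy
          subst hxy
          obtain rfl : w' = w := by simpa using h
          exact ⟨[], x, w', rfl, rfl⟩
        · simp at h
      · obtain ⟨s, z, t, h1, rfl⟩ := ih h
        exact ⟨x :: s, z, t, by simp [h1], rfl⟩

theorem knotterSecond_of_minimalSearch {n : ℕ} {b : Bool} {w : List Bool} {e : Bool}
    (h : minimalSearch n b w e = true) : KnotterSecond (shadow b w e) := by
  induction n generalizing b w e with
  | zero => exact knotterSecond_of_isMinimalWord h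
  | succ n ih =>
    simp only [minimalSearch, Bool.or_eq_true, List.any_eq_true] at h
    rcases h with ((h | ⟨w', h1, h2⟩) | h) | h
    · exact knotterSecond_of_isMinimalWord h
    · obtain ⟨s, x, t, rfl, rfl⟩ := exists_of_mem_bigons h1
      exact (ih h2).of_reduces (shadow_two b s t x e)
    · cases w with
      | nil => simp at h
      | cons x w =>
        simp only at h
        split at h
        · rename_i hx
          subst hx
          exact (ih h).of_reduces (shadow_one_bottom x w e).reduces
        · rename_i hx
          obtain rfl : x = !b := (Bool.eq_or_eq_not x b).resolve_left hx
          exact (ih h).of_reduces (shadow_turn_bottom b w e).reduces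
    · rcases List.eq_nil_or_concat' w with rfl | ⟨v, x, rfl⟩
      · simp at h
      · simp only [List.reverse_append, List.reverse_singleton, List.singleton_append,
          List.reverse_reverse] at h
        split at h
        · rename_i hx
          subst hx
          exact (ih h).of_reduces (shadow_one_top b v x).reduces
        · rename_i hx
          obtain rfl : x = !e := (Bool.eq_or_eq_not x e).resolve_left hx
          exact (ih h).of_reduces (shadow_turn_top b v e).reduces

/-- A test that a word stays hard for every continuation. -/
def hardTest (b : Bool) (w : List Bool) : Bool :=
  [([], false), ([], true), ([false], true)].all fun c : List Bool × Bool =>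
    decide (2 < colorings 2 (shadow b (w ++ c.1) c.2)) || minimalSearch 4 b (w ++ c.1) c.2

/-- By `exists_reduces_top` every continuation reduces to one of three, independently of the word
below it, so three closings decide about all of them. -/
theorem hard_of_hardTest {b : Bool} {w : List Bool} (h : hardTest b w = true) (v : List Bool)
    (e : Bool) : Hard (shadow b (w ++ v) e) := by
  obtain ⟨v', e', hv, hr⟩ := exists_reduces_top v e
  refine Hard.of_reduces ?_ (hr b w)
  simp only [hardTest, List.all_eq_true, Bool.or_eq_true, decide_eq_true_eq] at h
  have : (v', e') ∈ [([], false), ([], true), (([false] : List Bool), true)] := by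
    rcases hv with rfl | ⟨rfl, rfl⟩
    · cases e' <;> simp
    · simp
  exact (h _ this).symm.imp_left knotterSecond_of_minimalSearch

theorem exists_eq_add_two_mul (j : ℕ) : ∃ k n, (k = 1 ∨ k = 2) ∧ j + 1 = k + 2 * n := by
  rcases Nat.even_or_odd' j with ⟨n, rfl | rfl⟩
  · exact ⟨1, n, Or.inl rfl, by omega⟩
  · exact ⟨2, n, Or.inr rfl, by omega⟩

/-- Deleting bigons shortens the block of letters `!x` to length 1 or 2 and the doubled part to one
or two letters; the remaining words are tested by computation. -/
theorem hard_tail_append {b x : Bool} {u : List Bool} (h : x = b ∨ b ∈ u) (j : ℕ) (v : List Bool)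
    (e : Bool) :
    Hard (shadow b (double ((!b) :: u) ++ [x] ++ List.replicate (j + 1) (!x) ++ [x] ++ v) e) := by
  obtain ⟨k, n, hk, hj⟩ := exists_eq_add_two_mul j
  rw [hj]
  have h1 := shadow_replicate_two b (double ((!b) :: u) ++ [x]) ([x] ++ v) (!x) n k e
  simp only [← List.append_assoc] at h1
  refine Hard.of_reduces ?_ h1
  rcases Bool.eq_or_eq_not x b with rfl | rfl
  · have h2 := shadow_double_sublist ((List.nil_sublist u).cons_cons (!x)) x []
      ([x] ++ List.replicate k (!x) ++ [x] ++ v) e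
    simp only [← List.append_assoc, List.nil_append] at h2
    refine Hard.of_reduces (hard_of_hardTest ?_ v e) h2
    rcases hk with rfl | rfl <;> cases x <;> decide +kernel
  -- If the stray letter is `!b`, the word has to keep a doubled `b` as well; otherwise it would
  -- lose the alternation that makes it hard.
  · have hb : b ∈ u := h.resolve_left (by simp)
    have h2 := shadow_double_sublist ((List.singleton_sublist.2 hb).cons_cons (!b)) b []
      ([!b] ++ List.replicate k (!!b) ++ [!b] ++ v) e
    simp only [← List.append_assoc, List.nil_append] at h2
    refine Hard.of_reduces (hard_of_hardTest ?_ v e) h2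
    rcases hk with rfl | rfl <;> cases b <;> decide +kernel

/-- As in `hard_tail_append`, bigon deletions leave finitely many words for the test. The block may
be empty here, hence the additional length 0. -/
theorem hard_consTail_append {b x : Bool} {u : List Bool} (h : x = b ∨ b ∈ u) (j : ℕ)
    (v : List Bool) (e : Bool) :
    Hard (shadow b ((!b) :: double ((!b) :: u) ++ [x, !x] ++ List.replicate j x ++ [!x] ++ v) e) := by
  obtain ⟨k, n, hk, rfl⟩ : ∃ k n, (k = 0 ∨ k = 1 ∨ k = 2) ∧ j = k + 2 * n := by
    cases j with
    | zero => exact ⟨0, 0, by simp, rfl⟩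
    | succ j =>
      obtain ⟨k, n, hk, hj⟩ := exists_eq_add_two_mul j
      exact ⟨k, n, Or.inr hk, hj⟩
  have h1 := shadow_replicate_two b ((!b) :: double ((!b) :: u) ++ [x, !x]) ([!x] ++ v) x n k e
  simp only [← List.append_assoc] at h1
  refine Hard.of_reduces ?_ h1
  rcases Bool.eq_or_eq_not x b with rfl | rfl
  · have h2 := shadow_double_sublist ((List.nil_sublist u).cons_cons (!x)) x [!x]
      ([x, !x] ++ List.replicate k x ++ [!x] ++ v) e
    simp only [← List.append_assoc, List.singleton_append] at h2
    refine Hard.of_reduces (hard_of_hardTest ?_ v e) h2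
    rcases hk with rfl | rfl | rfl <;> cases x <;> decide +kernel
  · have hb : b ∈ u := h.resolve_left (by simp)
    -- Here the doubled `!b` is dropped and only a doubled `b` is kept, since the initial single
    -- `!b` already precedes it.
    have h2 := shadow_double_sublist (((List.singleton_sublist.2 hb)).cons (!b)) b [!b]
      ([!b, !!b] ++ List.replicate k (!b) ++ [!!b] ++ v) e
    simp only [← List.append_assoc, List.singleton_append] at h2
    refine Hard.of_reduces (hard_of_hardTest ?_ v e) h2
    rcases hk with rfl | rfl | rfl <;> cases b <;> decide +kernel

/-! #### Closing a normal form -/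

/-- Without the doubled letters a word of two letters remains, and its closure is a link. -/
theorem hard_consOdd {b x : Bool} {u : List Bool} :
    Hard (shadow b ((!b) :: double ((!b) :: u) ++ [x]) (!x)) := by
  have h := shadow_double_sublist (List.nil_sublist ((!b) :: u)) b [!b] [x] (!x)
  simp only [List.singleton_append, double_nil, List.append_nil] at h
  refine Hard.of_reduces (Or.inr ?_) h
  cases b <;> cases x <;> decide +kernel

/-- With the maximum above the minimum the closure is a link. Otherwise, if no `b` occurs, the whole
word is a single run of loops at the maximum; if one occurs, the minimal word (2,2) is present. -/
theorem outcome_even (b : Bool) (u : List Bool) (e : Bool) :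
    ReducesToOddEven (shadow b (double ((!b) :: u)) e) ∨
      Hard (shadow b (double ((!b) :: u)) e) := by
  rcases Bool.eq_or_eq_not e b with rfl | rfl
  · exact Or.inr (hard_double_self _ _)
  · by_cases h : b ∈ u
    · exact Or.inr (hard_double_not h)
    · left
      rw [eq_replicate_of_not_mem h, ← List.replicate_succ, ← replicate_two_mul]
      exact reducesToOddEven_replicate b _

/-- Letters under the maximum are loops or can be turned into the other letter. This either leaves
doubled letters with one stray letter at an end, which is odd-even, or permits bigon deletions down
to a link or a minimal word. -/
theorem NormalForm.outcome {b : Bool} {w : List Bool} (h : NormalForm b w) (e : Bool) :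
    ReducesToOddEven (shadow b w e) ∨ Hard (shadow b w e) := by
  cases h with
  | loop =>
    rcases Bool.eq_or_eq_not e b with rfl | rfl
    · exact Or.inr (Hard.of_reduces (hard_double_self e []) (shadow_one_bottom e [] e).reduces)
    · left
      simpa using reducesToOddEven_double_append b [] (!b)
  | single =>
    rcases Bool.eq_or_eq_not e b with rfl | rfl
    · exact Or.inl (reducesToOddEven_double_append e [] e)
    · exact Or.inl (reducesToOddEven_replicate b 0)
  | even u => exact outcome_even b u e
  | odd u x =>
    rcases Bool.eq_or_eq_not x e with rfl | rfl
    · exact outcome_of_reducesByOne (shadow_one_top b _ x) (outcome_even b u x)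
    · exact Or.inl (reducesToOddEven_double_append b _ e)
  | tail u x j h =>
    rcases Bool.eq_or_eq_not e x with rfl | rfl
    · right
      obtain ⟨k, n, hk, hj⟩ := exists_eq_add_two_mul j
      rw [hj]
      have h1 := shadow_replicate_two b (double ((!b) :: u) ++ [e]) [] (!e) n k e
      simp only [List.append_nil] at h1
      refine Hard.of_reduces ?_ h1
      rcases hk with rfl | rfl
      -- A tail of length 1 is turned at the maximum and completes the stray letter to a pair.
      · have h2 := (shadow_turn_top b (double ((!b) :: u) ++ [e]) e).reduces
        refine Hard.of_reduces ?_ h2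
        simpa using hard_double_append' h
      · have h2 := shadow_two b (double ((!b) :: u) ++ [e]) [] (!e) e
        simp only [List.append_nil] at h2
        exact ((hard_double_append h).of_reduces (shadow_one_top b _ e).reduces).of_reduces h2
    · left
      refine ReducesToOddEven.of_reducesByOne ?_ (shadow_replicate_top b _ (!x) (j + 1))
      simpa using reducesToOddEven_double_append b ((!b) :: u) (!x)
  | consEven u h => exact Or.inl (reducesToOddEven_cons_double b _ e)
  | consOdd u x h =>
    rcases Bool.eq_or_eq_not e x with rfl | rfl
    · exact Or.inl ((reducesToOddEven_cons_double b _ e).of_reducesByOne (shadow_one_top b _ e))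
    · exact Or.inr hard_consOdd
  | consTail u x j h =>
    rcases Bool.eq_or_eq_not e x with rfl | rfl
    · left
      refine ReducesToOddEven.of_reducesByOne ?_ (shadow_replicate_top b _ e j)
      have h1 := (shadow_turn_top b ((!b) :: double ((!b) :: u) ++ [e]) e).reducesByOne
      simp only [List.append_assoc, List.singleton_append] at h1
      refine ReducesToOddEven.of_reducesByOne ?_ h1
      simpa using reducesToOddEven_cons_double b ((!b) :: (u ++ [e])) (!e)
    · right
      -- If `j` is even, the block cancels, the letter before it becomes a loop, and a link remains.
      -- If `j` is odd, turning the last letter produces a continuation covered by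
      -- `hard_consTail_append`.
      rcases Nat.even_or_odd' j with ⟨n, rfl | rfl⟩
      · have h1 := shadow_replicate_two b ((!b) :: double ((!b) :: u) ++ [x, !x]) [] x n 0 (!x)
        simp only [List.append_nil, zero_add, List.replicate_zero] at h1
        refine Hard.of_reduces ?_ h1
        have h2 := (shadow_one_top b ((!b) :: double ((!b) :: u) ++ [x]) (!x)).reduces
        simp only [List.append_assoc, List.singleton_append] at h2
        exact hard_consOdd.of_reduces h2
      · have h1 := shadow_turn_top b
          ((!b) :: double ((!b) :: u) ++ [x, !x] ++ List.replicate (2 * n) x) (!x)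
        rw [List.replicate_succ', ← List.append_assoc]
        simp only [Bool.not_not] at h1
        refine Hard.of_reduces ?_ h1.reduces
        simpa using hard_consTail_append h (2 * n) [] x

/-! #### Appending a letter to a normal form -/

/-- The lower part of a word has a normal form, or the Unknotter has lost. -/
def Classified (b : Bool) (w : List Bool) : Prop :=
  (∃ b' w', NormalForm b' w' ∧
    ∀ v e, ReducesByOne (shadow b (w ++ v) e) (shadow b' (w' ++ v) e)) ∨
      ∀ v e, Hard (shadow b (w ++ v) e)

theorem NormalForm.classified {b : Bool} {w : List Bool} (h : NormalForm b w) : Classified b w :=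
  Or.inl ⟨b, w, h, fun _ _ => .refl _⟩

theorem Classified.of_reducesByOne {b b' : Bool} {w w' : List Bool} (h : Classified b' w')
    (hr : ∀ v e, ReducesByOne (shadow b (w ++ v) e) (shadow b' (w' ++ v) e)) : Classified b w := by
  rcases h with ⟨b'', w'', h1, h2⟩ | h
  · exact Or.inl ⟨b'', w'', h1, fun v e => (hr v e).trans (h2 v e)⟩
  · exact Or.inr fun v e => (h v e).of_reduces (hr v e).reduces

/-- A copy of the stray top letter completes a pair, a different letter starts a tail. In the two
tail forms one letter can be repeated indefinitely, while the other makes every continuation hard.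
The side conditions on `b` ensure that the word is not a single run. -/
theorem NormalForm.append {b : Bool} {w : List Bool} (h : NormalForm b w) (z : Bool) :
    Classified b (w ++ [z]) := by
  cases h with
  | loop =>
    -- The bottom loop may be deleted now because another letter follows it; alone, it had to be
    -- kept as the one crossing of an odd-even shadow.
    rcases Bool.eq_or_eq_not z b with rfl | rfl
    · exact NormalForm.loop.classified.of_reducesByOne fun v e => shadow_one_bottom z (z :: v) e
    · exact NormalForm.single.classified.of_reducesByOne fun v e =>
        shadow_one_bottom b ((!b) :: v) e
  | single =>
    rcases Bool.eq_or_eq_not z b with rfl | rfl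
    -- Turning the bottom letter moves the minimum to the other position and makes the two letters
    -- equal.
    · refine (NormalForm.even (b := !z) []).classified.of_reducesByOne fun v e => ?_
      simpa using (shadow_turn_bottom z (z :: v) e).reducesByOne
    · exact (NormalForm.even []).classified
  | even u => exact (NormalForm.odd u z).classified
  | odd u x =>
    rcases Bool.eq_or_eq_not z x with rfl | rfl
    · simpa using (NormalForm.even (u ++ [z])).classified
    · by_cases h : x = b ∨ b ∈ u
      · simpa using (NormalForm.tail u x 0 h).classified
      · rw [not_or] at h
        obtain rfl : x = !b := (Bool.eq_or_eq_not x b).resolve_left h.1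
        -- All letters so far are `!b`, an odd number of them, so the unpaired one may be regarded
        -- as the first instead of the last.
        have h1 : double ((!b) :: u) ++ [!b] = (!b) :: double ((!b) :: u) := by
          rw [eq_replicate_of_not_mem h.2, ← List.replicate_succ, ← replicate_two_mul,
            ← List.replicate_succ, ← List.replicate_succ']
        rw [h1]
        exact (NormalForm.consOdd u (!!b) (by simp)).classified
  | tail u x j h =>
    rcases Bool.eq_or_eq_not z x with rfl | rfl
    · exact Or.inr fun v e => hard_tail_append h j v e
    · have := (NormalForm.tail u x (j + 1) h).classified
      rwa [List.replicate_succ', ← List.append_assoc] at this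
  | consEven u h => exact (NormalForm.consOdd u z (Or.inr h)).classified
  | consOdd u x h =>
    rcases Bool.eq_or_eq_not z x with rfl | rfl
    · simpa using (NormalForm.consEven (u ++ [z]) (by simpa [or_comm, eq_comm] using h)).classified
    · simpa using (NormalForm.consTail u x 0 h).classified
  | consTail u x j h =>
    rcases Bool.eq_or_eq_not z x with rfl | rfl
    · have := (NormalForm.consTail u z (j + 1) h).classified
      rwa [List.replicate_succ', ← List.append_assoc] at this
    · exact Or.inr fun v e => hard_consTail_append h j v e

theorem Classified.append {b : Bool} {w : List Bool} (h : Classified b w) (z : Bool) :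
    Classified b (w ++ [z]) := by
  rcases h with ⟨b', w', h1, h2⟩ | h
  · refine (h1.append z).of_reducesByOne fun v e => ?_
    simpa using h2 (z :: v) e
  · exact Or.inr fun v e => by simpa using h (z :: v) e

theorem classified {b : Bool} {w : List Bool} (hw : w ≠ []) : Classified b w := by
  induction w using List.reverseRecOn with
  | nil => exact absurd rfl hw
  | append_singleton w z ih =>
    by_cases h : w = []
    · subst h
      rcases Bool.eq_or_eq_not z b with rfl | rfl
      · exact NormalForm.loop.classified
      · exact NormalForm.single.classified
    · exact (ih h).append z

/-- Every word with a crossing reduces to an odd-even shadow, or the Knotter wins if he makes the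
last move, or its diagram is not a knot. -/
theorem shadow_outcome {b : Bool} {w : List Bool} (hw : w ≠ []) (e : Bool) :
    ReducesToOddEven (shadow b w e) ∨ Hard (shadow b w e) := by
  rcases classified (b := b) hw with ⟨b', w', h1, h2⟩ | h
  · have := h2 [] e
    simp only [List.append_nil] at this
    exact outcome_of_reducesByOne this (h1.outcome e)
  · simpa using Or.inr (h [] e)

/-! ### Rational shadows -/

theorem IsRationalShadow.exists_word {T : Diagram} (h : IsRationalShadow T) :
    ∃ b w e, Equivalent T (shadow b w e) ∧ colorings 2 T ≤ 2 := by
  obtain ⟨a, rfl, h⟩ := h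
  exact ⟨_, _, _, rationalDiagram_equivalent a, IsKnot.colorings_two_le h⟩

theorem IsRationalShadow.unknottable {T : Diagram} (h : IsRationalShadow T) : Unknottable T := by
  obtain ⟨b, w, e, h1, h2⟩ := h.exists_word
  rcases unknottable_or_isLink b w e with h3 | h3
  · exact h1.reduces.trans h3
  · rw [IsLink, ← h1.colorings_two] at h3
    omega

theorem IsRationalShadow.safe {T : Diagram} (h : IsRationalShadow T)
    (hT : unresolved T = 0 ∨ ∃ O, IsOddEvenShadow O ∧ ReducesByOne T O) : Safe T := by
  rcases hT with hT | ⟨O, hO, hr⟩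
  · exact .circle _ (h.unknottable.equivalent_circle hT)
  · exact .of_reducesByOne hr hO.safe

theorem IsRationalShadow.knotterSecond {T : Diagram} (h : IsRationalShadow T)
    (hT : ¬ (unresolved T = 0 ∨ ∃ O, IsOddEvenShadow O ∧ ReducesByOne T O)) : KnotterSecond T := by
  obtain ⟨b, w, e, h1, h2⟩ := h.exists_word
  rw [not_or] at hT
  have hw : w ≠ [] := by
    rintro rfl
    exact hT.1 (h1.unresolved_eq.trans (unresolved_shadow b [] e))
  rcases shadow_outcome hw e with h3 | h3 | h3
  · exact absurd (h3.of_reducesByOne h1.reducesByOne) hT.2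
  · exact h3.equivalent h1
  -- The link case is excluded, since a knot has at most two colorings modulo two.
  · rw [← h1.colorings_two] at h3
    omega

end KnotGame

theorem mainTheorem2 (T : List KnotGame.Diagram) (S : KnotGame.Diagram)
    (hT : ∀ t ∈ T, KnotGame.IsRationalShadow t) (hS : KnotGame.IsConnectedSumOf T S) :
    ((∀ t ∈ T, KnotGame.unresolved t = 0 ∨
        ∃ O, KnotGame.IsOddEvenShadow O ∧ KnotGame.ReducesByOne t O) →
      ∀ first : KnotGame.Player, KnotGame.Wins KnotGame.Player.unknotter first S) ∧
    ((¬ ∀ t ∈ T, KnotGame.unresolved t = 0 ∨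
        ∃ O, KnotGame.IsOddEvenShadow O ∧ KnotGame.ReducesByOne t O) →
      (Even (KnotGame.unresolved S) →
        ∀ first : KnotGame.Player, KnotGame.Wins first.other first S) ∧
      (Odd (KnotGame.unresolved S) →
        ∀ first : KnotGame.Player, KnotGame.Wins first first S)) := by
  refine ⟨fun h first => ?_, fun h => ?_⟩
  · have hw := KnotGame.wins_unknotter KnotGame.Safe True (fun _ _ h h' => h.reply h')
      (fun _ h h0 _ => h.exists_option h0) (fun _ h h0 => h.equivalent_circle h0) _ T S hS
      (fun t ht => (hT t ht).safe (h t ht)) rfl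
    cases first
    · exact hw.2 (Or.inl trivial)
    · exact hw.1 (Or.inl trivial)
  -- The summands are still unknottable, being rational; this gives the Unknotter a win in the
  -- parities where he moves last, hence `free` is `False`.
  · have hw := KnotGame.wins_unknotter KnotGame.Unknottable False (fun _ _ h h' => h.reply h')
      (fun _ h _ h1 => h.exists_option (h1.resolve_left id)) (fun _ h h0 => h.equivalent_circle h0)
      _ T S hS (fun t ht => (hT t ht).unknottable) rfl
    push Not at h
    obtain ⟨t, ht, h0, hO⟩ := h
    have hk := ((hT t ht).knotterSecond (by
      rintro (h | ⟨O, h1, h2⟩)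
      · exact h0 h
      · exact hO O h1 h2)).wins ht hS
    -- In all four cases the winner is the player who makes the last move: `hw` serves the Unknotter
    -- and `hk` the Knotter.
    refine ⟨fun he first => ?_, fun ho first => ?_⟩
    · cases first
      · exact hk.1 he
      · exact hw.1 (Or.inr he)
    · cases first
      · exact hw.2 (Or.inr ho)
      · exact hk.2 ho
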